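/- **Barnes double gamma function.** For $\tau>0$ and $\Re w>0$ let $\zeta_2(s,w\,|\,\tau)=\frac1{\Gamma(s)}\int_0^\infty t^{s-1}\frac{e^{-wt}}{(1-e^{-t})(1-e^{-\tau t})}\,dt$ for $\Re s>2$, continued meromorphically in $s$, and $\Gamma_2(w\,|\,\tau)=\exp\bigl(\partial_s\zeta_2(s,w\,|\,\tau)|_{s=0}\bigr)$. For $b_0>0$ and $b_1,b_2\ge 0$, $\beta_{2,2}(\tau;b_0,b_1,b_2)$ denotes the probability law on $(0,1]$ with, for $\Re q>-b_0$, $$\mathbf E[\beta^q]=\frac{\Gamma_2(q+b_0|\tau)}{\Gamma_2(b_0|\tau)}\frac{\Gamma_2(b_0+b_1|\tau)}{\Gamma_2(q+b_0+b_1|\tau)}\frac{\Gamma_2(b_0+b_2|\tau)}{\Gamma_2(q+b_0+b_2|\tau)}\frac{\Gamma_2(q+b_0+b_1+b_2|\tau)}{\Gamma_2(b_0+b_1+b_2|\tau)} .$$ **Theorem.** Let $\tau>1$ and $\lambda_1,\lambda_2>-1/\tau$. There is exactly one probability law $M=M_{(\tau,\lambda_1,\lambda_2)}$ on $(0,\infty)$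 such that for all $q\in\mathbb C$ with $\Re q<\tau$ the moment $\mathbf E[M^q]$ exists and $$\mathbf E[M^q]=\tau^{q/\tau}(2\pi)^q\,\Gamma(1-1/\tau)^{-q}\,\frac{\Gamma_2(1-q+\tau(1+\lambda_1)|\tau)}{\Gamma_2(1+\tau(1+\lambda_1)|\tau)}\frac{\Gamma_2(1-q+\tau(1+\lambda_2)|\tau)}{\Gamma_2(1+\tau(1+\lambda_2)|\tau)}\frac{\Gamma_2(-q+\tau|\tau)}{\Gamma_2(\tau|\tau)}\frac{\Gamma_2(2-q+\tau(2+\lambda_1+\lambda_2)|\tau)}{\Gamma_2(2-2q+\tau(2+\lambda_1+\lambda_2)|\tau)} .$$ It has the following properties. 1. (Factorization) With $x_i=1+\tau(1+\lambda_i)$, $$M\overset{\text{law}}=\frac{2\pi\,2^{-[3(1+\tau)+2\tau(\lambda_1+\lambda_2)]/\tau}}{\Gamma(1-1/\tau)}\;L\,X_1X_2X_3\,Y,$$ where the factors are independent, $\log L\sim\mathcal N(0,4\log 2/\tau)$, $Y$ has the Fréchet density $\tau y^{-1-\tau}e^{-y^{-\tau}}$ on $y>0$, and the laws $X_1^{-1}\sim\beta_{2,2}\bigl(\tau;\min(x_1,x_2),\tfrac{|x_2-x_1|}2,\tfrac{|x_2-x_1|}2\bigr)$,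 $X_2^{-1}\sim\beta_{2,2}\bigl(\tau;\tfrac{x_1+x_2}2,\tfrac12,\tfrac\tau2\bigr)$, $X_3^{-1}\sim\beta_{2,2}\bigl(\tau;1+\tau,\tfrac{x_1+x_2-1-\tau}2,\tfrac{x_1+x_2-1-\tau}2\bigr)$ exist. 2. (Positive moments) For every integer $0\le l<\tau$, $\mathbf E[M^l]$ is finite and equals the product in Selberg's integral formula, $$\mathbf E[M^l]=\prod_{k=0}^{l-1}\frac{\Gamma(1-(k+1)/\tau)}{\Gamma(1-1/\tau)}\frac{\Gamma(1+\lambda_1-k/\tau)\Gamma(1+\lambda_2-k/\tau)}{\Gamma(2+\lambda_1+\lambda_2-(l+k-1)/\tau)} .$$ 3. (Negative moments) For every integer $l\ge0$, $\mathbf E[M^{-l}]$ is finite and $$\mathbf E[M^{-l}]=\prod_{k=0}^{l-1}\frac{\Gamma(2+\lambda_1+\lambda_2+(l+2+k)/\tau)\,\Gamma(1-1/\tau)}{\Gamma(1+\lambda_1+(k+1)/\tau)\Gamma(1+\lambda_2+(k+1)/\tau)\Gamma(1+k/\tau)} .$$ 4. $\log M$ is absolutely continuous and infinitely divisible. 5.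 The Stieltjes moment problems for $M$ and $M^{-1}$ are indeterminate: for each of these two laws there is a different measure on $[0,\infty)$ having the same moments of all orders $l=0,1,2,\dots$ (as elements of $[0,\infty]$). 6. If $\widetilde M$ is a probability law on $(0,\infty)$ with $\widetilde M\overset{\text{law}}=L\,N$, where $L$ is as in 1 and $N$ is some law independent of $L$, and if the negative moments $\mathbf E[\widetilde M^{-l}]$, $l\ge 0$, are those given in 3, then $\widetilde M\overset{\text{law}}=M$. -/

import Mathlib

open MeasureTheory ProbabilityTheory

/-! ### Barnes double zeta and double gamma functions -/

/-- The Barnes double zeta function on `Re s > 2`, `Re w > 0`,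
`ζ₂(s, w | a₁, a₂) = (1 / Γ(s)) ∫₀^∞ t^(s-1) e^(-w t) / ((1 - e^(-a₁ t)) (1 - e^(-a₂ t))) dt`,
which equals `∑ (w + k₁ a₁ + k₂ a₂)^(-s)` over `k₁, k₂ ≥ 0`. -/
noncomputable def barnesZeta₂ (a₁ a₂ : ℝ) (s w : ℂ) : ℂ :=
  (Complex.Gamma s)⁻¹ *
    mellin (fun t : ℝ => Complex.exp (-w * t) /
      ((1 - Complex.exp (-(a₁ : ℂ) * t)) * (1 - Complex.exp (-(a₂ : ℂ) * t)))) s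

/-- `F` is the analytic continuation of `s ↦ ζ₂(s, w | a₁, a₂)` from `Re s > 2` to the connected
open set `{Re s > -1} \ {1, 2}`, a neighbourhood of `s = 0`. By the identity theorem the values
of `F` on this set are unique, so they are the values there of the meromorphic continuation
to `ℂ`, whose only poles are `1` and `2`. -/
def IsBarnesZeta₂Continuation (a₁ a₂ : ℝ) (w : ℂ) (F : ℂ → ℂ) : Prop :=
  DifferentiableOn ℂ F ({s : ℂ | -1 < s.re} \ {1, 2}) ∧
    ∀ s : ℂ, 2 < s.re → F s = barnesZeta₂ a₁ a₂ s w

/-- The log-gamma function `L₂(w | a₁, a₂) = ∂ₛ ζ₂(s, w | a₁, a₂)` at `s = 0`, for `Re w > 0`. -/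
noncomputable def barnesLogGamma₂ (a₁ a₂ : ℝ) (w : ℂ) : ℂ :=
  deriv (Classical.epsilon (IsBarnesZeta₂Continuation a₁ a₂ w)) 0

/-- The Barnes double gamma function `Γ₂(w | a₁, a₂) = exp L₂(w | a₁, a₂)`, for `Re w > 0`. -/
noncomputable def barnesGamma₂ (a₁ a₂ : ℝ) (w : ℂ) : ℂ :=
  Complex.exp (barnesLogGamma₂ a₁ a₂ w)

/-- `Γ₂(w | τ) = Γ₂(w | 1, τ)`. -/
noncomputable def doubleGamma (τ : ℝ) (w : ℂ) : ℂ := barnesGamma₂ 1 τ w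

/-! ### Laws on the half-line -/

/-- `μ` is a probability distribution on `(0, ∞)`. -/
def IsLawOnPos (μ : Measure ℝ) : Prop :=
  IsProbabilityMeasure μ ∧ μ (Set.Iic 0) = 0

/-- The `q`-th moment `E[X^q]`, where `X` has law `μ`, exists and equals `c`. -/
def HasComplexMoment (μ : Measure ℝ) (q c : ℂ) : Prop :=
  Integrable (fun x : ℝ => (x : ℂ) ^ q) μ ∧ ∫ x : ℝ, (x : ℂ) ^ q ∂μ = c

/-- The Mellin transform `η_{2,2}(q | τ, b)` of the Barnes beta distribution. -/
noncomputable def barnesEta₂₂ (τ b₀ b₁ b₂ : ℝ) (q : ℂ) : ℂ :=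
  doubleGamma τ (q + b₀) / doubleGamma τ b₀ *
    (doubleGamma τ (b₀ + b₁) / doubleGamma τ (q + b₀ + b₁)) *
    (doubleGamma τ (b₀ + b₂) / doubleGamma τ (q + b₀ + b₂)) *
    (doubleGamma τ (q + b₀ + b₁ + b₂) / doubleGamma τ (b₀ + b₁ + b₂))

/-- `μ` is the Barnes beta distribution `β_{2,2}(τ, b)`: the probability distribution on `(0, 1]`
with `E[β^q] = η_{2,2}(q | τ, b)` for `Re q > -b₀`. -/
def IsBarnesBeta₂₂ (τ b₀ b₁ b₂ : ℝ) (μ : Measure ℝ) : Prop :=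
  IsProbabilityMeasure μ ∧ μ (Set.Ioc 0 1)ᶜ = 0 ∧
    ∀ q : ℂ, -b₀ < q.re → HasComplexMoment μ q (barnesEta₂₂ τ b₀ b₁ b₂ q)

/-- The law of `X⁻¹`, where `X` has law `μ`. -/
noncomputable def invLaw (μ : Measure ℝ) : Measure ℝ := μ.map (fun x => x⁻¹)

/-- The law of `L = exp 𝒩(0, 4 log 2 / τ)`. -/
noncomputable def lognormalLaw (τ : ℝ) : Measure ℝ :=
  (gaussianReal 0 (Real.toNNReal (4 * Real.log 2 / τ))).map Real.exp

/-- The Fréchet law `τ y^(-1-τ) exp(-y^(-τ)) dy` on `y > 0`. -/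
noncomputable def frechetLaw (τ : ℝ) : Measure ℝ :=
  (volume.restrict (Set.Ioi 0)).withDensity
    (fun y => ENNReal.ofReal (τ * y ^ (-1 - τ) * Real.exp (-y ^ (-τ))))

/-- The law `μ` is infinitely divisible: for every `n ≥ 1` it is the `n`-fold convolution
power of a probability law. -/
def IsInfinitelyDivisible (μ : Measure ℝ) : Prop :=
  ∀ n : ℕ, 0 < n → ∃ ν : Measure ℝ, IsProbabilityMeasure ν ∧
    μ = (fun ρ : Measure ℝ => Measure.conv ν ρ)^[n] (Measure.dirac 0)

/-- The Stieltjes moment problem of a law `μ` on `(0, ∞)` is indeterminate: some other measure on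
`[0, ∞)` has the same moments of all orders `l = 0, 1, 2, …` (as elements of `[0, ∞]`). -/
def IsStieltjesIndeterminate (μ : Measure ℝ) : Prop :=
  ∃ ν : Measure ℝ, ν (Set.Iio 0) = 0 ∧
    (∀ l : ℕ, ∫⁻ x, ENNReal.ofReal (x ^ l) ∂ν = ∫⁻ x, ENNReal.ofReal (x ^ l) ∂μ) ∧ ν ≠ μ

/-! ### The Selberg integral distribution -/

/-- The explicit ratio of double gamma functions whose value at `q` is `E[M^q]`. -/
noncomputable def selbergMellin (τ lam₁ lam₂ : ℝ) (q : ℂ) : ℂ :=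
  (τ : ℂ) ^ (q / τ) * ((2 * Real.pi : ℝ) : ℂ) ^ q * (Real.Gamma (1 - 1 / τ) : ℂ) ^ (-q) *
    (doubleGamma τ (1 - q + τ * (1 + lam₁)) / doubleGamma τ (1 + τ * (1 + lam₁))) *
    (doubleGamma τ (1 - q + τ * (1 + lam₂)) / doubleGamma τ (1 + τ * (1 + lam₂))) *
    (doubleGamma τ (-q + τ) / doubleGamma τ τ) *
    (doubleGamma τ (2 - q + τ * (2 + lam₁ + lam₂)) /
      doubleGamma τ (2 - 2 * q + τ * (2 + lam₁ + lam₂)))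

/-- `M` is a probability law on `(0, ∞)` with `E[M^q]` given by the explicit expression for
`Re q < τ`. -/
def IsSelbergLaw (τ lam₁ lam₂ : ℝ) (M : Measure ℝ) : Prop :=
  IsLawOnPos M ∧ ∀ q : ℂ, q.re < τ → HasComplexMoment M q (selbergMellin τ lam₁ lam₂ q)

/-- The product in the closed form of the `l`-dimensional Selberg integral with weight
`∏ sᵢ^λ₁ (1 - sᵢ)^λ₂ ∏_{i<j} |sᵢ - sⱼ|^(-2/τ)` on `[0, 1]^l`. -/
noncomputable def selbergPosMoment (τ lam₁ lam₂ : ℝ) (l : ℕ) : ℝ :=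
  ∏ k ∈ Finset.range l,
    Real.Gamma (1 - (k + 1) / τ) / Real.Gamma (1 - 1 / τ) *
      (Real.Gamma (1 + lam₁ - k / τ) * Real.Gamma (1 + lam₂ - k / τ) /
        Real.Gamma (2 + lam₁ + lam₂ - ((l : ℝ) + k - 1) / τ))

/-- The explicit product for the negative moment of order `-l`. -/
noncomputable def selbergNegMoment (τ lam₁ lam₂ : ℝ) (l : ℕ) : ℝ :=
  ∏ k ∈ Finset.range l,
    Real.Gamma (2 + lam₁ + lam₂ + ((l : ℝ) + 2 + k) / τ) * Real.Gamma (1 - 1 / τ) /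
      (Real.Gamma (1 + lam₁ + (k + 1) / τ) * Real.Gamma (1 + lam₂ + (k + 1) / τ) *
        Real.Gamma (1 + k / τ))

/-- The constant in front of `L X₁ X₂ X₃ Y`. -/
noncomputable def selbergConst (τ lam₁ lam₂ : ℝ) : ℝ :=
  2 * Real.pi * (2 : ℝ) ^ (-((3 * (1 + τ) + 2 * τ * (lam₁ + lam₂)) / τ)) / Real.Gamma (1 - 1 / τ)

open Filter Topology Set Asymptotics

/-! ### Weak limits and infinitely divisible laws -/

/-! Everything rests on an integral formula for `L₂ = log Γ₂`. Subtracting from the kernel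
`e^{-wt}/((1-e^{-t})(1-e^{-τt}))` its singular part at `t = 0`, damped by `e^{-t}`, continues the
zeta integral to `Re s > -1`. Differentiating at `s = 0` writes `L₂(w)` as a convergent integral
plus a term affine in `w` (`barnesLogGamma₂_eq`).

In the ratio of eight double gammas defining `η_{2,2}` the subtracted terms cancel. What remains is
`exp ∫ (e^{-qt} - 1) k(t) dt` with an explicit density `k ≥ 0` (`barnesEta₂₂_eq_exp`). Such an
exponential is the Laplace transform of a limit of compound Poisson laws, so `β_{2,2} = e^{-X}`
exists; exponential tilting extends the formula to `Re q > -b₀` (`exists_law_of_levyDensity`).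

Two relations for `Γ₂` do the rest. The duplication formula (`barnesLogGamma₂_two_mul`) comes from
splitting the kernel. The shift `Γ₂(w)/Γ₂(w+1) = Γ(w/τ) τ^{w/τ-1/2} (2π)^{-1/2}`
(`doubleGamma_div_add_one`) comes from Bohr–Mollerup on the positive axis, the constant being fixed
by duplication, and then from the identity theorem. Together they factor the proposed Mellin
transform into those of a constant, a lognormal, three inverse Barnes betas and a Fréchet variable
(`selbergMellin_eq`); the product of independent factors is therefore the required law. Uniqueness
is read off on the imaginary axis, where the Mellin transform is the characteristic function of `log
M`. Iterating the shift gives the integer moments.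

The remaining properties use the factorization. Every factor has a Lévy–Khintchine exponent, so `log
M` is infinitely divisible, and its Gaussian summand makes it absolutely continuous. The lognormal
factor can be perturbed without changing any integer moment, whence indeterminacy of both moment
problems (`isStieltjesIndeterminate_lognormalLaw_mconv`). Once the lognormal is divided out, the
inverse of the cofactor has moments at most `A^l l!`, which determine it (`eq_of_lintegral_pow_eq`);
hence the characterization by negative moments. -/

theorem exists_tendsto_of_tendsto_charFun {μ : ℕ → ProbabilityMeasure ℝ} {φ : ℝ → ℂ}
    (hφ : ContinuousAt φ 0)
    (h : ∀ u, Tendsto (fun n => charFun (μ n : Measure ℝ) u) atTop (𝓝 (φ u))) :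
    ∃ ν : ProbabilityMeasure ℝ, Tendsto μ atTop (𝓝 ν) ∧
      ∀ u, charFun (ν : Measure ℝ) u = φ u := by
  have h_tight : IsTightMeasureSet (Set.range fun n => (μ n : Measure ℝ)) :=
    isTightMeasureSet_of_tendsto_charFun hφ h
  have h_compact : IsCompact (closure (Set.range μ)) :=
    isCompact_closure_of_isTightMeasureSet (by
      convert h_tight using 1
      ext x; simp)
  -- Prokhorov supplies a limit along an ultrafilter only. Its characteristic function is forced to
  -- be `φ`, and this upgrades to convergence of the whole sequence.
  obtain ⟨ν, -, hν⟩ := h_compact.ultrafilter_le_nhds ((Ultrafilter.of atTop).map μ)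
    (.trans (by simp) (monotone_principal subset_closure))
  have hν : Tendsto μ (Ultrafilter.of atTop : Ultrafilter ℕ) (𝓝 ν) := hν
  have key : ∀ u, charFun (ν : Measure ℝ) u = φ u := by
    intro u
    refine tendsto_nhds_unique ?_ ((h u).mono_left (Ultrafilter.of_le atTop))
    rw [ProbabilityMeasure.tendsto_iff_forall_integral_rclike_tendsto ℂ] at hν
    simp_rw [charFun_eq_integral_innerProbChar]
    exact hν _
  exact ⟨ν, ProbabilityMeasure.tendsto_of_tendsto_charFun fun u => by
    rw [key]; exact h u, key⟩

/-- `μ` is a probability law on `[0, ∞)` with Laplace transform `φ` on `Re q ≥ 0`. -/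
structure HasLaplace (μ : Measure ℝ) (φ : ℂ → ℂ) : Prop where
  prob : IsProbabilityMeasure μ
  nonneg : μ (Iio 0) = 0
  eq : ∀ q : ℂ, 0 ≤ q.re → ∫ x : ℝ, Complex.exp (-q * x) ∂μ = φ q

theorem HasLaplace.ae_nonneg {μ : Measure ℝ} {φ : ℂ → ℂ} (h : HasLaplace μ φ) :
    ∀ᵐ x ∂μ, 0 ≤ x := by
  rw [ae_iff]
  convert h.nonneg using 2
  ext x; simp

theorem norm_cexp_neg_mul_le_one {q : ℂ} (hq : 0 ≤ q.re) {x : ℝ} (hx : 0 ≤ x) :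
    ‖Complex.exp (-q * x)‖ ≤ 1 := by
  rw [Complex.norm_exp]
  simpa using mul_nonneg hq hx

theorem HasLaplace.integrable {μ : Measure ℝ} {φ : ℂ → ℂ} (h : HasLaplace μ φ) {q : ℂ}
    (hq : 0 ≤ q.re) : Integrable (fun x : ℝ => Complex.exp (-q * x)) μ := by
  have := h.prob
  refine Integrable.of_bound (by fun_prop) 1 ?_
  filter_upwards [h.ae_nonneg] with x hx using norm_cexp_neg_mul_le_one hq hx

theorem HasLaplace.charFun {μ : Measure ℝ} {φ : ℂ → ℂ} (h : HasLaplace μ φ) (u : ℝ) :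
    charFun μ u = φ (-(u * Complex.I)) := by
  rw [charFun_apply_real, ← h.eq _ (by simp)]
  congr 1 with x
  ring_nf

theorem hasLaplace_dirac_zero : HasLaplace (Measure.dirac 0) 1 where
  prob := inferInstance
  nonneg := by simp
  eq q _ := by simp

theorem HasLaplace.conv {μ ν : Measure ℝ} {φ ψ : ℂ → ℂ} (hμ : HasLaplace μ φ)
    (hν : HasLaplace ν ψ) : HasLaplace (μ.conv ν) (φ * ψ) := by
  have := hμ.prob
  have := hν.prob
  have hnn : (μ.conv ν) (Iio 0) = 0 := by
    rw [Measure.conv, Measure.map_apply (by fun_prop) measurableSet_Iio, ← ae_eq_empty,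
      eventuallyEq_empty]
    have h1 := (Measure.quasiMeasurePreserving_fst (μ := μ) (ν := ν)).ae hμ.ae_nonneg
    have h2 := (Measure.quasiMeasurePreserving_snd (μ := μ) (ν := ν)).ae hν.ae_nonneg
    filter_upwards [h1, h2] with x hx hy
    simp only [mem_preimage, mem_Iio, not_lt]
    positivity
  refine ⟨inferInstance, hnn, fun q hq => ?_⟩
  rw [integral_conv]
  · simp only [Complex.ofReal_add, mul_add, Complex.exp_add, integral_const_mul,
      integral_mul_const, hμ.eq q hq, hν.eq q hq, Pi.mul_apply]
  · refine Integrable.of_bound (by fun_prop) 1 ?_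
    have : ∀ᵐ x ∂(μ.conv ν), 0 ≤ x := by
      rw [ae_iff]
      convert hnn using 2
      ext x; simp
    filter_upwards [this] with x hx using norm_cexp_neg_mul_le_one hq hx

theorem HasLaplace.iterate_conv {μ : Measure ℝ} {φ : ℂ → ℂ} (hμ : HasLaplace μ φ) (n : ℕ) :
    HasLaplace ((fun ρ : Measure ℝ => Measure.conv μ ρ)^[n] (Measure.dirac 0)) (φ ^ n) := by
  induction n with
  | zero => exact hasLaplace_dirac_zero
  | succ n ih =>
    rw [Function.iterate_succ_apply', pow_succ']
    exact hμ.conv ih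

/-- Convergence on the imaginary axis produces the limit law. Weak convergence then carries the
transform to all of `Re q ≥ 0`, because `e^{-qx}` is bounded there on `[0, ∞)`. -/
theorem exists_hasLaplace_of_tendsto {μ : ℕ → Measure ℝ} {φ : ℕ → ℂ → ℂ} {ψ : ℂ → ℂ}
    (h : ∀ n, HasLaplace (μ n) (φ n))
    (hlim : ∀ q : ℂ, 0 ≤ q.re → Tendsto (fun n => φ n q) atTop (𝓝 (ψ q)))
    (hc : ContinuousAt (fun u : ℝ => ψ (-(u * Complex.I))) 0) :
    ∃ ν, HasLaplace ν ψ := by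
  let m : ℕ → ProbabilityMeasure ℝ := fun n => ⟨μ n, (h n).prob⟩
  obtain ⟨ν, hν, hchar⟩ := exists_tendsto_of_tendsto_charFun (μ := m) hc fun u => by
    have := hlim (-(u * Complex.I)) (by simp)
    simpa only [m, ProbabilityMeasure.coe_mk, (h _).charFun u] using this
  have hnn : (ν : Measure ℝ) (Iio 0) = 0 := by
    have := ProbabilityMeasure.le_liminf_measure_open_of_tendsto hν (isOpen_Iio (a := (0 : ℝ)))
    refine le_antisymm (this.trans ?_) bot_le
    simp [m, (h _).nonneg]
  have hae : ∀ᵐ x ∂(ν : Measure ℝ), 0 ≤ x := by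
    rw [ae_iff]
    convert hnn using 2
    ext x; simp
  refine ⟨ν, inferInstance, hnn, fun q hq => ?_⟩
  -- Replacing `x` by `max x 0` makes the integrand bounded on the whole line without changing its
  -- integral against laws on `[0, ∞)`.
  let f : BoundedContinuousFunction ℝ ℂ :=
    BoundedContinuousFunction.ofNormedAddCommGroup
      (fun x => Complex.exp (-q * ((max x 0 : ℝ) : ℂ))) (by fun_prop) 1
      (fun x => norm_cexp_neg_mul_le_one hq (le_max_right _ _))
  have hf : ∀ ρ : Measure ℝ, (∀ᵐ x ∂ρ, 0 ≤ x) →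
      ∫ x, f x ∂ρ = ∫ x : ℝ, Complex.exp (-q * x) ∂ρ := by
    intro ρ hρ
    refine integral_congr_ae ?_
    filter_upwards [hρ] with x hx
    simp [f, max_eq_left hx]
  rw [ProbabilityMeasure.tendsto_iff_forall_integral_rclike_tendsto ℂ] at hν
  have h1 := hν f
  rw [hf _ hae] at h1
  refine tendsto_nhds_unique h1 ?_
  refine (hlim q hq).congr fun n => ?_
  rw [← (h n).eq q hq]
  exact (hf _ (h n).ae_nonneg).symm

/-- The compound Poisson law with jump density `k`. -/
theorem exists_hasLaplace_of_integrableOn {k : ℝ → ℝ} (hk : IntegrableOn k (Ioi 0))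
    (hk0 : ∀ t, 0 < t → 0 ≤ k t) :
    ∃ ν, HasLaplace ν fun q =>
      Complex.exp (∫ t in Ioi (0 : ℝ), (Complex.exp (-q * t) - 1) * k t) := by
  set K : Measure ℝ := (volume.restrict (Ioi 0)).withDensity fun t => ENNReal.ofReal (k t) with hK
  have haek : ∀ᵐ t ∂(volume.restrict (Ioi (0 : ℝ))), 0 ≤ k t := by
    filter_upwards [ae_restrict_mem measurableSet_Ioi] with t ht using hk0 t ht
  set c : ℝ := ∫ t in Ioi (0 : ℝ), k t with hc
  have hc0 : 0 ≤ c := integral_nonneg_of_ae haek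
  have hKuniv : K univ = ENNReal.ofReal c := by
    rw [hK, withDensity_apply _ MeasurableSet.univ, Measure.restrict_univ, hc,
      ofReal_integral_eq_lintegral_ofReal hk haek]
  have hKfin : IsFiniteMeasure K := ⟨by rw [hKuniv]; exact ENNReal.ofReal_lt_top⟩
  have hKneg : K (Iio 0) = 0 := by
    refine withDensity_absolutelyContinuous _ _ ?_
    rw [Measure.restrict_apply measurableSet_Iio]
    have : Iio (0 : ℝ) ∩ Ioi 0 = ∅ := by ext x; simp; intro h; linarith
    simp [this]
  have hKint : ∀ f : ℝ → ℂ, ∫ x, f x ∂K = ∫ t in Ioi (0 : ℝ), f t * k t := by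
    intro f
    rw [hK, integral_withDensity_eq_integral_toReal_smul₀ hk.1.aemeasurable.ennreal_ofReal
      (by simp)]
    refine integral_congr_ae ?_
    filter_upwards [haek] with t ht
    rw [ENNReal.toReal_ofReal ht, Complex.real_smul, mul_comm]
  let κ : ℂ → ℂ := fun q => ∫ t in Ioi (0 : ℝ), Complex.exp (-q * t) * k t
  have hint : ∀ q : ℂ, 0 ≤ q.re → Integrable (fun t : ℝ => Complex.exp (-q * t) * k t)
      (volume.restrict (Ioi 0)) := by
    intro q hq
    refine Integrable.mono hk (by
      have := hk.1
      fun_prop) ?_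
    filter_upwards [ae_restrict_mem measurableSet_Ioi] with t ht
    rw [norm_mul, Complex.norm_real]
    exact mul_le_of_le_one_left (norm_nonneg _) (norm_cexp_neg_mul_le_one hq (le_of_lt ht))
  have hκ : ∀ q : ℂ, 0 ≤ q.re →
      ∫ t in Ioi (0 : ℝ), (Complex.exp (-q * t) - 1) * k t = κ q - c := by
    intro q hq
    simp only [sub_mul, one_mul]
    have hkC : Integrable (fun t => (k t : ℂ)) (volume.restrict (Ioi 0)) := hk.ofReal
    rw [integral_sub (hint q hq) hkC, hc, integral_complex_ofReal]
  -- Poisson approximation: a jump law of weight `1/n` mixed with an atom at `0`. The transform of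
  -- the `n`-fold convolution is `((1 + κ/n)/(1 + c/n))^n`, with limit `exp (κ - c)`. For `n = 0`,
  -- division by zero leaves the plain Dirac mass.
  let m : ℕ → Measure ℝ := fun n => ENNReal.ofReal (1 + c / n)⁻¹ •
    (Measure.dirac 0 + ENNReal.ofReal (1 / n) • K)
  have hm : ∀ n, HasLaplace (m n) fun q => ((1 + c / n : ℝ) : ℂ)⁻¹ * (1 + κ q / n) := by
    intro n
    have hpos : (0 : ℝ) < 1 + c / n := by positivity
    refine ⟨⟨?_⟩, ?_, fun q hq => ?_⟩
    · simp only [m, Measure.smul_apply, Measure.add_apply, hKuniv, smul_eq_mul, measure_univ]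
      rw [← ENNReal.ofReal_mul (by positivity), ← ENNReal.ofReal_one,
        ← ENNReal.ofReal_add (by norm_num) (by positivity), ← ENNReal.ofReal_mul (by positivity)]
      congr 1
      rw [one_div_mul_eq_div, inv_mul_cancel₀ hpos.ne']
    · simp [m, hKneg]
    · have hi : Integrable (fun x : ℝ => Complex.exp (-q * x)) K := by
        refine Integrable.of_bound (by fun_prop) 1 ?_
        have : ∀ᵐ x ∂K, 0 ≤ x := by
          rw [ae_iff]
          convert hKneg using 2
          ext x; simp
        filter_upwards [this] with x hx using norm_cexp_neg_mul_le_one hq hx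
      simp only [m]
      rw [integral_smul_measure, integral_add_measure (integrable_dirac (by simp))
        (hi.smul_measure (by simp)), integral_smul_measure, hKint, integral_dirac,
        ENNReal.toReal_ofReal (by positivity), ENNReal.toReal_ofReal (by positivity)]
      simp only [Complex.real_smul, κ]
      push_cast
      simp
      left; ring
  refine exists_hasLaplace_of_tendsto (fun n => (hm n).iterate_conv n) (fun q hq => ?_) ?_
  · have h1 : Tendsto (fun n : ℕ => (1 + (c : ℂ) / n) ^ n) atTop (𝓝 (Complex.exp c)) :=
      Complex.tendsto_one_add_div_pow_exp _
    have h2 : Tendsto (fun n : ℕ => (1 + κ q / n) ^ n) atTop (𝓝 (Complex.exp (κ q))) :=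
      Complex.tendsto_one_add_div_pow_exp _
    rw [hκ q hq, sub_eq_neg_add, Complex.exp_add, Complex.exp_neg]
    refine ((h1.inv₀ (Complex.exp_ne_zero _)).mul h2).congr fun n => ?_
    simp [mul_pow]
  · have : ∀ u : ℝ, ∫ t in Ioi (0 : ℝ), (Complex.exp (-(-(u * Complex.I)) * t) - 1) * k t =
        charFun K u - c := by
      intro u
      rw [hκ _ (by simp), charFun_apply_real, hKint]
      simp only [κ]
      congr 2 with t
      ring_nf
    simp only [this]
    fun_prop

/-! ### From finite to infinite jump measures -/

theorem norm_cexp_sub_one_le {z : ℂ} (hz : z.re ≤ 0) : ‖Complex.exp z - 1‖ ≤ ‖z‖ := by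
  have hconv : Convex ℝ {w : ℂ | w.re ≤ 0} := convex_halfSpace_re_le 0
  have := hconv.norm_image_sub_le_of_norm_hasDerivWithin_le (f := Complex.exp)
    (f' := Complex.exp) (C := 1) (x := 0) (y := z)
    (fun w _ => (Complex.hasDerivAt_exp w).hasDerivWithinAt)
    (fun w hw => by rw [Complex.norm_exp]; exact Real.exp_le_one_iff.2 hw) (by simp) hz
  simpa using this

/-- The mean value inequality again, now on the half-plane cut by the ball of radius `‖z‖`: there
the derivative `e^w - 1` is at most `‖z‖` by the first-order bound. -/
theorem norm_cexp_sub_one_sub_le {z : ℂ} (hz : z.re ≤ 0) :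
    ‖Complex.exp z - 1 - z‖ ≤ ‖z‖ ^ 2 := by
  have hconv : Convex ℝ ({w : ℂ | w.re ≤ 0} ∩ Metric.closedBall 0 ‖z‖) :=
    (convex_halfSpace_re_le 0).inter (convex_closedBall _ _)
  have := hconv.norm_image_sub_le_of_norm_hasDerivWithin_le
    (f := fun w => Complex.exp w - 1 - w)
    (f' := fun w => Complex.exp w - 1) (C := ‖z‖) (x := 0) (y := z)
    (fun w _ => (((Complex.hasDerivAt_exp w).sub_const 1).sub (hasDerivAt_id w)).hasDerivWithinAt)
    (fun w hw => (norm_cexp_sub_one_le hw.1).trans (by simpa using hw.2)) (by simp)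
    ⟨hz, by simp⟩
  simpa [sq] using this

theorem tendsto_setIntegral_indicator {f : ℝ → ℂ} (hf : IntegrableOn f (Ioi 0)) :
    Tendsto (fun n : ℕ => ∫ t in Ioi (0 : ℝ), (Ioi (1 / ((n : ℝ) + 1))).indicator f t) atTop
      (𝓝 (∫ t in Ioi (0 : ℝ), f t)) := by
  refine tendsto_integral_of_dominated_convergence (fun t => ‖f t‖)
    (fun n => hf.1.indicator measurableSet_Ioi) hf.norm
    (fun n => ae_of_all _ fun t => norm_indicator_le_norm_self _ _) ?_
  filter_upwards [ae_restrict_mem measurableSet_Ioi] with t ht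
  refine tendsto_const_nhds.congr' ?_
  have := tendsto_one_div_add_atTop_nhds_zero_nat (𝕜 := ℝ)
  filter_upwards [this.eventually (gt_mem_nhds (mem_Ioi.1 ht))] with n hn
  exact (indicator_of_mem (mem_Ioi.2 hn) f).symm

/-- Only measurability of `k` is recovered; `k` itself may fail to be integrable at `0`. -/
theorem integrableOn_of_mul {k g : ℝ → ℝ} (hg : Continuous g) (hg0 : ∀ t, 0 < t → 0 < g t)
    (hk : IntegrableOn (fun t => g t * k t) (Ioi 0)) :
    AEStronglyMeasurable k (volume.restrict (Ioi 0)) := by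
  have h : AEStronglyMeasurable (fun t => (g t)⁻¹ * (g t * k t)) (volume.restrict (Ioi 0)) :=
    hg.measurable.inv.aestronglyMeasurable.mul hk.1
  refine h.congr ?_
  filter_upwards [ae_restrict_mem measurableSet_Ioi] with t ht
  field_simp [(hg0 t ht).ne']

/-- Away from `0`, where `(n+1) t ≥ 1`, a lower power of `t` is dominated by a constant times a
higher one. -/
theorem integrableOn_indicator_of_mul {k : ℝ → ℝ} (j m : ℕ) (hjm : j ≤ m)
    (hk : IntegrableOn (fun t => t ^ m * k t) (Ioi 0)) (n : ℕ) :
    IntegrableOn (fun t => t ^ j * (Ioi (1 / ((n : ℝ) + 1))).indicator k t) (Ioi 0) := by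
  have hkm : AEStronglyMeasurable k (volume.restrict (Ioi 0)) :=
    integrableOn_of_mul (continuous_pow m) (fun t ht => pow_pos ht m) hk
  refine Integrable.mono (hk.const_mul (((n : ℝ) + 1) ^ (m - j)))
    ((continuous_pow j).aestronglyMeasurable.mul (hkm.indicator measurableSet_Ioi)) ?_
  filter_upwards [ae_restrict_mem measurableSet_Ioi] with t (ht : 0 < t)
  by_cases h : t ∈ Ioi (1 / ((n : ℝ) + 1))
  · rw [indicator_of_mem h]
    have h1 : 1 ≤ ((n : ℝ) + 1) * t := by
      have := (div_lt_iff₀' (by positivity)).1 (mem_Ioi.1 h)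
      linarith
    have h2 : 1 ≤ (((n : ℝ) + 1) * t) ^ (m - j) := one_le_pow₀ h1
    have h3 : t ^ m = t ^ (m - j) * t ^ j := by rw [← pow_add, Nat.sub_add_cancel hjm]
    rw [h3, show ((n : ℝ) + 1) ^ (m - j) * (t ^ (m - j) * t ^ j * k t) =
      (((n : ℝ) + 1) * t) ^ (m - j) * (t ^ j * k t) by rw [mul_pow]; ring, norm_mul ((((n : ℝ) + 1) * t) ^ (m - j))]
    refine le_mul_of_one_le_left (norm_nonneg _) ?_
    rwa [Real.norm_of_nonneg (by positivity)]
  · rw [indicator_of_notMem h, mul_zero, norm_zero]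
    exact norm_nonneg _

theorem integrableOn_cexp_sub_one_mul {k : ℝ → ℝ} (hk : IntegrableOn (fun t => t * k t) (Ioi 0))
    {q : ℂ} (hq : 0 ≤ q.re) :
    IntegrableOn (fun t : ℝ => (Complex.exp (-q * t) - 1) * k t) (Ioi 0) := by
  have hkm := integrableOn_of_mul continuous_id (fun t ht => ht) hk
  refine Integrable.mono (hk.const_mul ‖q‖) (by
    have : AEStronglyMeasurable (fun t => (k t : ℂ)) (volume.restrict (Ioi 0)) :=
      Complex.continuous_ofReal.comp_aestronglyMeasurable hkm
    exact (Continuous.aestronglyMeasurable (by fun_prop)).mul this) ?_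
  filter_upwards [ae_restrict_mem measurableSet_Ioi] with t (ht : 0 < t)
  rw [norm_mul, norm_mul, norm_mul, norm_norm, Complex.norm_real, ← mul_assoc]
  gcongr
  refine (norm_cexp_sub_one_le (by simpa using mul_nonneg hq ht.le)).trans ?_
  simp

/-- Discarding jumps below `1/(n+1)` leaves compound Poisson laws. Since `|e^{-qt} - 1| ≤ |q| t`,
integrability of `t k(t)` lets `n → ∞` without compensation. -/
theorem exists_hasLaplace_of_integrableOn_mul {k : ℝ → ℝ}
    (hk : IntegrableOn (fun t => t * k t) (Ioi 0)) (hk0 : ∀ t, 0 < t → 0 ≤ k t) :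
    ∃ ν, HasLaplace ν fun q =>
      Complex.exp (∫ t in Ioi (0 : ℝ), (Complex.exp (-q * t) - 1) * k t) := by
  have hkm := integrableOn_of_mul continuous_id (fun t ht => ht) hk
  have hfin : ∀ n : ℕ, ∃ ν, HasLaplace ν fun q =>
      Complex.exp (∫ t in Ioi (0 : ℝ), (Complex.exp (-q * t) - 1) *
        ((Ioi (1 / ((n : ℝ) + 1))).indicator k t : ℝ)) := fun n =>
    exists_hasLaplace_of_integrableOn
      (by simpa using integrableOn_indicator_of_mul 0 1 zero_le_one (by simpa using hk) n)
      (fun t ht => indicator_nonneg (fun s hs => hk0 s ((by positivity : (0 : ℝ) <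
        1 / ((n : ℝ) + 1)).trans hs)) t)
  choose ν hν using hfin
  refine exists_hasLaplace_of_tendsto hν (fun q hq => ?_) ?_
  · refine (Complex.continuous_exp.tendsto _).comp ?_
    refine (tendsto_setIntegral_indicator (integrableOn_cexp_sub_one_mul hk hq)).congr fun n => ?_
    congr 1 with t
    by_cases h : t ∈ Ioi (1 / ((n : ℝ) + 1))
    · simp only [indicator_of_mem h]
    · simp only [indicator_of_notMem h]; simp
  · refine ContinuousAt.comp Complex.continuous_exp.continuousAt ?_
    refine continuousAt_of_dominated (bound := fun t => ‖t * k t‖) ?_ ?_ hk.norm ?_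
    · exact Eventually.of_forall fun u => (integrableOn_cexp_sub_one_mul hk (by simp)).1
    · filter_upwards [Metric.ball_mem_nhds (0 : ℝ) one_pos] with u hu
      filter_upwards [ae_restrict_mem measurableSet_Ioi] with t (ht : 0 < t)
      rw [norm_mul, norm_mul, Complex.norm_real]
      gcongr
      refine (norm_cexp_sub_one_le (by simp)).trans ?_
      have : |u| ≤ 1 := by simpa using (mem_ball_zero_iff.1 hu).le
      simpa using mul_le_of_le_one_left (abs_nonneg t) this
    · exact ae_of_all _ fun t => by fun_prop

theorem integrableOn_cexp_sub_one_sub_mul {k : ℝ → ℝ}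
    (hk : IntegrableOn (fun t => t ^ 2 * k t) (Ioi 0)) (u : ℝ) :
    IntegrableOn (fun t : ℝ => (Complex.exp (u * t * Complex.I) - 1 - u * t * Complex.I) * k t)
      (Ioi 0) := by
  have hkm := integrableOn_of_mul (continuous_pow 2) (fun t ht => by positivity) hk
  refine Integrable.mono (hk.const_mul (u ^ 2)) (by
    have : AEStronglyMeasurable (fun t => (k t : ℂ)) (volume.restrict (Ioi 0)) :=
      Complex.continuous_ofReal.comp_aestronglyMeasurable hkm
    exact (Continuous.aestronglyMeasurable (by fun_prop)).mul this) ?_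
  filter_upwards [ae_restrict_mem measurableSet_Ioi] with t (ht : 0 < t)
  rw [norm_mul, norm_mul, norm_mul, Complex.norm_real, ← mul_assoc]
  gcongr
  refine (norm_cexp_sub_one_sub_le (by simp)).trans ?_
  simp [mul_pow]

/-- Lévy–Khintchine: infinitely divisible laws whose Lévy measure is carried by `(0, ∞)`, has a
density and a finite second moment. -/
theorem exists_charFun_eq_levyKhintchine {k : ℝ → ℝ}
    (hk : IntegrableOn (fun t => t ^ 2 * k t) (Ioi 0)) (hk0 : ∀ t, 0 < t → 0 ≤ k t)
    (a : ℝ) (v : NNReal) :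
    ∃ ν : Measure ℝ, IsProbabilityMeasure ν ∧ ∀ u : ℝ, charFun ν u =
      Complex.exp (u * a * Complex.I - v * u ^ 2 / 2 + ∫ t in Ioi (0 : ℝ),
        (Complex.exp (u * t * Complex.I) - 1 - u * t * Complex.I) * k t) := by
  have hkm := integrableOn_of_mul (continuous_pow 2) (fun t ht => by positivity) hk
  let kn : ℕ → ℝ → ℝ := fun n => (Ioi (1 / ((n : ℝ) + 1))).indicator k
  have hkn1 : ∀ n, IntegrableOn (fun t => t * kn n t) (Ioi 0) := fun n => by
    simpa [kn] using integrableOn_indicator_of_mul 1 2 one_le_two hk n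
  have hfin : ∀ n : ℕ, ∃ ν, HasLaplace ν fun q =>
      Complex.exp (∫ t in Ioi (0 : ℝ), (Complex.exp (-q * t) - 1) * (kn n t : ℝ)) := fun n =>
    exists_hasLaplace_of_integrableOn
      (by simpa [kn] using integrableOn_indicator_of_mul 0 2 zero_le_two hk n)
      (fun t ht => indicator_nonneg (fun s hs => hk0 s ((by positivity : (0 : ℝ) <
        1 / ((n : ℝ) + 1)).trans hs)) t)
  choose ν hν using hfin
  have := fun n => (hν n).prob
  -- The mean of the truncated law. Recentring by it creates the compensator `-iut`, after which the
  -- second moment of `k` controls the limit; `d n` itself may diverge.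
  let d : ℕ → ℝ := fun n => ∫ t in Ioi (0 : ℝ), t * kn n t
  let ρ : ℕ → ProbabilityMeasure ℝ := fun n =>
    ⟨(ν n).map (· + -d n), Measure.isProbabilityMeasure_map (by fun_prop)⟩
  have hρ : ∀ n u, charFun (ρ n : Measure ℝ) u = Complex.exp (∫ t in Ioi (0 : ℝ),
      (Complex.exp (u * t * Complex.I) - 1 - u * t * Complex.I) * kn n t) := by
    intro n u
    simp only [ρ, ProbabilityMeasure.coe_mk]
    rw [charFun_map_add_const, (hν n).charFun, ← Complex.exp_add]
    congr 1
    have h1 : ((d n : ℝ) : ℂ) = ∫ t in Ioi (0 : ℝ), ((t * kn n t : ℝ) : ℂ) :=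
      (integral_complex_ofReal).symm
    have h2 : (((inner ℝ (-d n) u : ℝ) : ℂ)) * Complex.I = -(u * Complex.I) * d n := by
      simp; ring
    have h3 : Integrable (fun t : ℝ => ((t * kn n t : ℝ) : ℂ)) (volume.restrict (Ioi 0)) :=
      (hkn1 n).ofReal
    rw [h2, h1, ← integral_const_mul, ← integral_add
      (integrableOn_cexp_sub_one_mul (hkn1 n) (by simp)) (h3.const_mul _)]
    congr 1 with t
    push_cast
    rw [show -(-((u : ℂ) * Complex.I)) * (t : ℂ) = u * t * Complex.I by ring]
    ring
  obtain ⟨μ, -, hμ⟩ := exists_tendsto_of_tendsto_charFun (μ := ρ) (φ := fun u : ℝ =>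
      Complex.exp (∫ t in Ioi (0 : ℝ),
        (Complex.exp (u * t * Complex.I) - 1 - u * t * Complex.I) * k t)) (by
      refine ContinuousAt.comp Complex.continuous_exp.continuousAt ?_
      refine continuousAt_of_dominated (bound := fun t => ‖t ^ 2 * k t‖) ?_ ?_ hk.norm ?_
      · exact Eventually.of_forall fun u => (integrableOn_cexp_sub_one_sub_mul hk u).1
      · filter_upwards [Metric.ball_mem_nhds (0 : ℝ) one_pos] with u hu
        filter_upwards [ae_restrict_mem measurableSet_Ioi] with t (ht : 0 < t)
        rw [norm_mul, norm_mul, Complex.norm_real]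
        gcongr
        refine (norm_cexp_sub_one_sub_le (by simp)).trans ?_
        have h1 : |u| ≤ 1 := by simpa using (mem_ball_zero_iff.1 hu).le
        have h2 : |u| ^ 2 ≤ 1 := pow_le_one₀ (abs_nonneg u) h1
        simp only [norm_mul, Complex.norm_real, Real.norm_eq_abs, Complex.norm_I, mul_one,
          mul_pow, norm_pow]
        exact mul_le_of_le_one_left (by positivity) h2
      · exact ae_of_all _ fun t => by fun_prop) (fun u => by
    simp only [hρ]
    refine (Complex.continuous_exp.tendsto _).comp ?_
    refine (tendsto_setIntegral_indicator (integrableOn_cexp_sub_one_sub_mul hk u)).congr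
      fun n => ?_
    congr 1 with t
    simp only [kn]
    by_cases h : t ∈ Ioi (1 / ((n : ℝ) + 1))
    · simp only [indicator_of_mem h]
    · simp only [indicator_of_notMem h]; simp)
  -- The drift and the Gaussian part enter by one convolution.
  refine ⟨(gaussianReal a v).conv μ, inferInstance, fun u => ?_⟩
  rw [charFun_conv, hμ, charFun_gaussianReal, ← Complex.exp_add]

/-- The transform at `Re q < 0` is reached by tilting. The law with density `e^{ct} k(t)`,
reweighted by `e^{-cx}`, has exponent `E(p+c) - E(c)`, which is the exponent for `k` at `p` and is
defined for `Re p ≥ -c`. It has the characteristic function of the original law, so the two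
coincide. -/
theorem exists_law_of_levyDensity {k : ℝ → ℝ} {b : ℝ} (hb : 0 < b)
    (hk : ∀ c < b, IntegrableOn (fun t => t * (Real.exp (c * t) * k t)) (Ioi 0))
    (hk0 : ∀ t, 0 < t → 0 ≤ k t) :
    ∃ ν : Measure ℝ, IsProbabilityMeasure ν ∧ ν (Iio 0) = 0 ∧ ∀ q : ℂ, -b < q.re →
      Integrable (fun x : ℝ => Complex.exp (-q * x)) ν ∧
      ∫ x : ℝ, Complex.exp (-q * x) ∂ν =
        Complex.exp (∫ t in Ioi (0 : ℝ), (Complex.exp (-q * t) - 1) * k t) := by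
  have hk1 : IntegrableOn (fun t => t * k t) (Ioi 0) := by simpa using hk 0 hb
  obtain ⟨ν, hν⟩ := exists_hasLaplace_of_integrableOn_mul hk1 hk0
  refine ⟨ν, hν.prob, hν.nonneg, fun q hq => ?_⟩
  obtain ⟨c, hcb, hc0, hcq⟩ : ∃ c < b, 0 ≤ c ∧ -c ≤ q.re :=
    ⟨max 0 (-q.re), max_lt hb (by linarith), le_max_left _ _, by
      linarith [le_max_right 0 (-q.re)]⟩
  obtain ⟨νc, hνc⟩ := exists_hasLaplace_of_integrableOn_mul (hk c hcb)
    (fun t ht => mul_nonneg (Real.exp_nonneg _) (hk0 t ht))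
  have := hν.prob
  have := hνc.prob
  set E : ℂ → ℂ := fun q => ∫ t in Ioi (0 : ℝ), (Complex.exp (-q * t) - 1) *
    ((Real.exp (c * t) * k t : ℝ) : ℂ) with hE
  have hexp : ∀ x : ℝ, ((Real.exp (-c * x) : ℝ) : ℂ) = Complex.exp (-(c : ℂ) * x) := by
    intro x; push_cast; rfl
  have hi : Integrable (fun x => Real.exp (-c * x)) νc := by
    refine Integrable.of_bound (by fun_prop) 1 ?_
    filter_upwards [hνc.ae_nonneg] with x hx
    rw [Real.norm_of_nonneg (Real.exp_nonneg _)]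
    exact Real.exp_le_one_iff.2 (by nlinarith)
  have hZ : ((∫ x, Real.exp (-c * x) ∂νc : ℝ) : ℂ) = Complex.exp (E c) := by
    rw [← integral_complex_ofReal]
    simp only [hexp]
    exact hνc.eq c (by simpa using hc0)
  have hint : ∀ p : ℂ, -c ≤ p.re →
      Integrable (fun x : ℝ => Complex.exp (-p * x)) (νc.tilted fun x => -c * x) ∧
      ∫ x : ℝ, Complex.exp (-p * x) ∂(νc.tilted fun x => -c * x) =
        Complex.exp (∫ t in Ioi (0 : ℝ), (Complex.exp (-p * t) - 1) * k t) := by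
    intro p hp
    have hp' : 0 ≤ (p + c).re := by simp; linarith
    have hcc : 0 ≤ (c : ℂ).re := by simpa using hc0
    have hmul : ∀ x : ℝ, Real.exp (-c * x) • Complex.exp (-p * x) =
        Complex.exp (-(p + c) * x) := by
      intro x
      rw [Complex.real_smul, hexp, ← Complex.exp_add]
      ring_nf
    constructor
    · rw [integrable_tilted_iff hi]
      simp only [hmul]
      exact hνc.integrable hp'
    · rw [integral_tilted]
      simp only [div_eq_inv_mul, mul_smul, hmul]
      rw [integral_smul, Complex.real_smul, hνc.eq _ hp', Complex.ofReal_inv, hZ,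
        ← Complex.exp_neg, ← Complex.exp_add]
      congr 1
      simp only [hE]
      rw [neg_add_eq_sub, ← integral_sub (integrableOn_cexp_sub_one_mul (hk c hcb) hp')
        (integrableOn_cexp_sub_one_mul (hk c hcb) hcc)]
      congr 1 with t
      have : ((Real.exp (c * t) : ℝ) : ℂ) = Complex.exp (c * t) := by push_cast; rfl
      have h2 : Complex.exp (-(p + c) * t) * Complex.exp (c * t) = Complex.exp (-p * t) := by
        rw [← Complex.exp_add]; ring_nf
      have h3 : Complex.exp (-(c : ℂ) * t) * Complex.exp (c * t) = 1 := by
        rw [← Complex.exp_add]; simp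
      rw [Complex.ofReal_mul, this]
      linear_combination (k t : ℂ) * (h2 - h3)
  have hprob : IsProbabilityMeasure (νc.tilted fun x => -c * x) := isProbabilityMeasure_tilted hi
  have heq : νc.tilted (fun x => -c * x) = ν := by
    refine Measure.ext_of_charFun ?_
    ext u
    rw [hν.charFun, charFun_apply_real, ← (hint (-(u * Complex.I)) (by simpa using hc0)).2]
    congr 1 with x
    ring_nf
  rw [← heq]
  exact hint q hcq

/-! ### Second order expansions at `0+` -/

/-- `f t = a + b t + c t² + O(t³)` as `t → 0+`. -/
def HasQuadExpansion (f : ℝ → ℂ) (a b c : ℂ) : Prop :=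
  (fun t : ℝ => f t - (a + b * t + c * t ^ 2)) =O[𝓝[>] 0] fun t : ℝ => (t : ℂ) ^ 3

theorem HasQuadExpansion.tendsto {f : ℝ → ℂ} {a b c : ℂ} (hf : HasQuadExpansion f a b c) :
    Tendsto f (𝓝[>] 0) (𝓝 a) := by
  have h1 : Tendsto (fun t : ℝ => f t - (a + b * t + c * t ^ 2)) (𝓝[>] 0) (𝓝 0) := by
    refine hf.trans_tendsto (tendsto_nhdsWithin_of_tendsto_nhds ?_)
    exact (Continuous.tendsto' (by fun_prop) _ _ (by simp))
  have h2 : Tendsto (fun t : ℝ => a + b * t + c * t ^ 2) (𝓝[>] 0) (𝓝 a) :=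
    tendsto_nhdsWithin_of_tendsto_nhds (Continuous.tendsto' (by fun_prop) _ _ (by simp))
  simpa using h1.add h2

theorem isBigO_one_of_continuous {f : ℝ → ℂ} (hf : Continuous f) :
    f =O[𝓝[>] 0] (fun _ => (1 : ℂ)) :=
  (hf.tendsto 0).isBigO_one ℂ |>.mono nhdsWithin_le_nhds

theorem HasQuadExpansion.mul {f g : ℝ → ℂ} {a b c a' b' c' : ℂ} (hf : HasQuadExpansion f a b c)
    (hg : HasQuadExpansion g a' b' c') :
    HasQuadExpansion (fun t => f t * g t) (a * a') (a * b' + b * a')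
      (a * c' + b * b' + c * a') := by
  have h1 := IsBigO.mul hf (hg.tendsto.isBigO_one ℂ)
  have h2 := (isBigO_one_of_continuous
    (f := fun t : ℝ => a + b * t + c * t ^ 2) (by fun_prop)).mul hg
  -- The terms of degree three and four in the product of the two quadratic polynomials.
  have h3 := (isBigO_one_of_continuous (f := fun t : ℝ => b * c' + c * b' + c * c' * t)
    (by fun_prop)).mul (isBigO_refl (fun t : ℝ => (t : ℂ) ^ 3) (𝓝[>] 0))
  simp only [mul_one, one_mul] at h1 h2 h3
  refine ((h1.add h2).add h3).congr_left fun t => ?_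
  ring

theorem HasQuadExpansion.congr {f g : ℝ → ℂ} {a b c a' b' c' : ℂ} (hf : HasQuadExpansion f a b c)
    (h : ∀ t, 0 < t → f t = g t) (ha : a = a') (hb : b = b') (hc : c = c') :
    HasQuadExpansion g a' b' c' := by
  subst ha hb hc
  refine hf.congr' ?_ EventuallyEq.rfl
  filter_upwards [self_mem_nhdsWithin] with t ht
  rw [h t ht]

/-- The candidate polynomial times `f` is `1 + O(t³)`; divide by `f`, which tends to `1`. -/
theorem HasQuadExpansion.inv {f : ℝ → ℂ} {b c : ℂ} (hf : HasQuadExpansion f 1 b c) :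
    HasQuadExpansion (fun t => (f t)⁻¹) 1 (-b) (b ^ 2 - c) := by
  have hQ : HasQuadExpansion (fun t : ℝ => 1 + -b * t + (b ^ 2 - c) * t ^ 2) 1 (-b)
      (b ^ 2 - c) := by
    simp only [HasQuadExpansion, sub_self]
    exact isBigO_zero _ _
  have h1 := (hf.mul hQ).congr (fun t _ => rfl) (mul_one _) (b' := 0) (by ring)
    (c' := 0) (by ring)
  have h2 := ((hf.tendsto.inv₀ one_ne_zero).isBigO_one ℂ).mul h1.neg_left
  simp only [one_mul] at h2
  refine h2.congr' ?_ EventuallyEq.rfl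
  filter_upwards [hf.tendsto.eventually_ne one_ne_zero] with t ht
  field_simp
  ring

theorem cexp_mul_sub_isBigO (z : ℂ) (n : ℕ) :
    (fun t : ℝ => Complex.exp (z * t) - ∑ i ∈ Finset.range n, (z * t) ^ i / i.factorial)
      =O[𝓝[>] 0] fun t : ℝ => (t : ℂ) ^ n := by
  have h := (Complex.exp_sub_sum_range_isBigO_pow n).comp_tendsto
    (k := fun t : ℝ => z * (t : ℂ)) (l' := 𝓝[>] 0)
    (tendsto_nhdsWithin_of_tendsto_nhds (Continuous.tendsto' (by fun_prop) _ _ (by simp)))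
  refine h.trans ?_
  simp only [Function.comp_def, mul_pow]
  exact isBigO_const_mul_self _ _ _

theorem hasQuadExpansion_cexp (z : ℂ) :
    HasQuadExpansion (fun t => Complex.exp (z * t)) 1 z (z ^ 2 / 2) := by
  refine (cexp_mul_sub_isBigO z 3).congr_left fun t => ?_
  simp [Finset.sum_range_succ]
  ring

theorem hasQuadExpansion_one_sub_cexp_div {a : ℂ} (ha : a ≠ 0) :
    HasQuadExpansion (fun t => (1 - Complex.exp (-a * t)) / (a * t)) 1 (-a / 2) (a ^ 2 / 6) := by
  have h := ((cexp_mul_sub_isBigO (-a) 4).mul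
    (isBigO_refl (fun t : ℝ => ((t : ℂ))⁻¹) (𝓝[>] 0))).const_mul_left (-a⁻¹)
  refine h.congr' ?_ ?_
  · filter_upwards [self_mem_nhdsWithin] with t (ht : 0 < t)
    have : (t : ℂ) ≠ 0 := by exact_mod_cast ht.ne'
    simp [Finset.sum_range_succ, Nat.factorial]
    field_simp
    ring
  · filter_upwards [self_mem_nhdsWithin] with t (ht : 0 < t)
    have : (t : ℂ) ≠ 0 := by exact_mod_cast ht.ne'
    field_simp

/-! ### Analytic continuation of the double zeta function -/

/-- The integrand `e^(-w t) / ((1 - e^(-t)) (1 - e^(-τ t)))`. -/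
noncomputable def barnesKernel (τ : ℝ) (w : ℂ) (t : ℝ) : ℂ :=
  Complex.exp (-w * t) /
    ((1 - Complex.exp (-((1 : ℝ) : ℂ) * t)) * (1 - Complex.exp (-(τ : ℂ) * t)))

/-- The coefficient of `1/t` in the expansion at `0` of `e^t` times the kernel; the leading one is
`1/(τ t²)`. -/
noncomputable def barnesCoeff₁ (τ : ℝ) (w : ℂ) : ℂ := (1 + τ) / (2 * τ) + (1 - w) / τ

/-- The value `ζ₂(0, w | τ)`. -/
noncomputable def barnesCoeff₂ (τ : ℝ) (w : ℂ) : ℂ :=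
  (1 / τ + τ) / 12 + 1 / 4 + (1 + τ) / (2 * τ) * (1 - w) + (1 - w) ^ 2 / (2 * τ)

/-- The factor `e^{-t}` gives decay at infinity, keeps the Mellin transform a combination of gamma
values, and does not depend on `w`, so that differences in `w` stay polynomial. -/
noncomputable def barnesPrincipal (τ : ℝ) (w : ℂ) (t : ℝ) : ℂ :=
  Complex.exp (-t) * (1 / τ / t ^ 2 + barnesCoeff₁ τ w / t + barnesCoeff₂ τ w)

noncomputable def barnesRemainder (τ : ℝ) (w : ℂ) (t : ℝ) : ℂ :=
  barnesKernel τ w t - barnesPrincipal τ w t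

theorem one_sub_cexp_neg_mul_ne_zero {a t : ℝ} (ha : 0 < a) (ht : 0 < t) :
    1 - Complex.exp (-(a : ℂ) * t) ≠ 0 := by
  have : Real.exp (-a * t) < 1 := by
    rw [← Real.exp_zero]; exact Real.exp_lt_exp.2 (by nlinarith [mul_pos ha ht])
  rw [sub_ne_zero]
  intro h
  have h2 : ((Real.exp (-a * t) : ℝ) : ℂ) = 1 := by push_cast; exact h.symm
  norm_cast at h2
  linarith

/-- With `e^{-t}/(τ t²)` taken out, the kernel is a product of three quadratic expansions, so the
error is `O(t³)/t²`. This single order of vanishing moves convergence from `Re s > 0` to `Re s >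
-1`, past the point `s = 0`. -/
theorem barnesRemainder_isBigO_zero {τ : ℝ} (hτ : 0 < τ) (w : ℂ) :
    barnesRemainder τ w =O[𝓝[>] 0] fun t : ℝ => t ^ (-(-1 : ℝ)) := by
  have hτ' : (τ : ℂ) ≠ 0 := by exact_mod_cast hτ.ne'
  have h := ((hasQuadExpansion_cexp (1 - w)).mul
    (hasQuadExpansion_one_sub_cexp_div (a := ((1 : ℝ) : ℂ)) (by simp)).inv).mul
    (hasQuadExpansion_one_sub_cexp_div hτ').inv
  have h2 := ((h.const_mul_left (1 / τ)).mul
    (isBigO_refl (fun t : ℝ => ((t : ℂ) ^ 2)⁻¹) (𝓝[>] 0))).mul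
    (isBigO_one_of_continuous (f := fun t : ℝ => Complex.exp (-t)) (by fun_prop))
  refine (h2.congr' ?_ EventuallyEq.rfl).trans (IsBigO.of_norm_eventuallyLE ?_)
  · filter_upwards [self_mem_nhdsWithin] with t (ht : 0 < t)
    have ht' : (t : ℂ) ≠ 0 := by exact_mod_cast ht.ne'
    have h1 := one_sub_cexp_neg_mul_ne_zero one_pos ht
    have h3 := one_sub_cexp_neg_mul_ne_zero hτ ht
    have h4 : Complex.exp ((1 - w) * t) * Complex.exp (-t) = Complex.exp (-w * t) := by
      rw [← Complex.exp_add]; ring_nf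
    have h5 : Complex.exp ((1 - w) * t) = Complex.exp (-w * t) * Complex.exp t := by
      rw [← Complex.exp_add]; ring_nf
    simp only [barnesRemainder, barnesKernel, barnesPrincipal, barnesCoeff₁, barnesCoeff₂, ← h4]
    field_simp
    push_cast
    ring
  · filter_upwards [self_mem_nhdsWithin] with t (ht : 0 < t)
    have ht' : (t : ℂ) ≠ 0 := by exact_mod_cast ht.ne'
    rw [show (t : ℂ) ^ 3 * ((t : ℂ) ^ 2)⁻¹ * 1 = t by field_simp]
    simp [abs_of_pos ht]

theorem barnesKernel_continuousOn {τ : ℝ} (hτ : 0 < τ) (w : ℂ) :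
    ContinuousOn (barnesKernel τ w) (Ioi 0) := by
  unfold barnesKernel
  refine ContinuousOn.div (by fun_prop) (by fun_prop) fun t ht => ?_
  exact mul_ne_zero (one_sub_cexp_neg_mul_ne_zero one_pos ht)
    (one_sub_cexp_neg_mul_ne_zero hτ ht)

theorem barnesPrincipal_continuousOn (τ : ℝ) (w : ℂ) :
    ContinuousOn (barnesPrincipal τ w) (Ioi 0) := by
  unfold barnesPrincipal
  have h : ContinuousOn (fun t : ℝ => (t : ℂ)) (Ioi 0) := by fun_prop
  have h0 : ∀ t ∈ Ioi (0 : ℝ), (t : ℂ) ≠ 0 := fun t ht => by exact_mod_cast (ne_of_gt ht)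
  exact (Continuous.continuousOn (by fun_prop)).mul
    (((continuousOn_const.div (h.pow 2) fun t ht => pow_ne_zero 2 (h0 t ht)).add
      (continuousOn_const.div h h0)).add continuousOn_const)

theorem barnesRemainder_continuousOn {τ : ℝ} (hτ : 0 < τ) (w : ℂ) :
    ContinuousOn (barnesRemainder τ w) (Ioi 0) :=
  (barnesKernel_continuousOn hτ w).sub (barnesPrincipal_continuousOn τ w)

theorem cexp_mul_isBigO_atTop {w : ℂ} {a : ℝ} (h : a ≤ w.re) :
    (fun t : ℝ => Complex.exp (-w * t)) =O[atTop] fun t : ℝ => Real.exp (-a * t) := by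
  refine IsBigO.of_norm_eventuallyLE ?_
  filter_upwards [eventually_ge_atTop 0] with t ht
  rw [Complex.norm_exp]
  refine Real.exp_le_exp.2 ?_
  simp
  nlinarith

theorem one_sub_cexp_inv_isBigO_atTop {a : ℝ} (ha : 0 < a) :
    (fun t : ℝ => (1 - Complex.exp (-(a : ℂ) * t))⁻¹) =O[atTop] fun _ => (1 : ℝ) := by
  refine Tendsto.isBigO_one (c := ((1 : ℂ) - 0)⁻¹) ℝ ?_
  refine (Tendsto.sub tendsto_const_nhds ?_).inv₀ (by simp)
  rw [tendsto_zero_iff_norm_tendsto_zero]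
  have : Tendsto (fun t : ℝ => Real.exp (-(a * t))) atTop (𝓝 0) :=
    Real.tendsto_exp_neg_atTop_nhds_zero.comp (tendsto_id.const_mul_atTop ha)
  refine this.congr fun t => ?_
  rw [Complex.norm_exp]
  simp

theorem barnesKernel_isBigO_atTop {τ : ℝ} (hτ : 0 < τ) {w : ℂ} {a : ℝ} (h : a ≤ w.re) :
    barnesKernel τ w =O[atTop] fun t : ℝ => Real.exp (-a * t) := by
  have := (cexp_mul_isBigO_atTop h).mul
    ((one_sub_cexp_inv_isBigO_atTop one_pos).mul (one_sub_cexp_inv_isBigO_atTop hτ))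
  simp only [mul_one] at this
  refine this.congr_left fun t => ?_
  rw [barnesKernel, div_eq_mul_inv, mul_inv]

theorem barnesPrincipal_isBigO_atTop (τ : ℝ) (w : ℂ) {a : ℝ} (h : a ≤ 1) :
    barnesPrincipal τ w =O[atTop] fun t : ℝ => Real.exp (-a * t) := by
  have hinv : Tendsto (fun t : ℝ => ((t : ℂ))⁻¹) atTop (𝓝 0) := by
    rw [tendsto_zero_iff_norm_tendsto_zero]
    refine tendsto_inv_atTop_zero.congr' ?_
    filter_upwards [eventually_gt_atTop 0] with t ht
    simp [abs_of_pos ht]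
  have h1 : Tendsto (fun t : ℝ => (1 / (τ : ℂ) * (t : ℂ)⁻¹ ^ 2 + barnesCoeff₁ τ w * (t : ℂ)⁻¹ +
      barnesCoeff₂ τ w)) atTop (𝓝 (1 / τ * 0 ^ 2 + barnesCoeff₁ τ w * 0 + barnesCoeff₂ τ w)) :=
    (((hinv.pow 2).const_mul _).add (hinv.const_mul _)).add tendsto_const_nhds
  have := (cexp_mul_isBigO_atTop (w := 1) (by simpa using h)).mul (h1.isBigO_one ℝ)
  simp only [mul_one] at this
  refine this.congr_left fun t => ?_
  simp only [barnesPrincipal]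
  ring_nf

theorem barnesRemainder_isBigO_atTop {τ : ℝ} (hτ : 0 < τ) (w : ℂ) :
    barnesRemainder τ w =O[atTop] fun t : ℝ => Real.exp (-(min w.re 1) * t) :=
  (barnesKernel_isBigO_atTop hτ (min_le_left _ _)).sub
    (barnesPrincipal_isBigO_atTop τ w (min_le_right _ _))

theorem mellinConvergent_barnesRemainder {τ : ℝ} (hτ : 0 < τ) {w s : ℂ} (hw : 0 < w.re)
    (hs : -1 < s.re) : MellinConvergent (barnesRemainder τ w) s :=
  mellinConvergent_of_isBigO_rpow_exp (lt_min hw one_pos)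
    ((barnesRemainder_continuousOn hτ w).locallyIntegrableOn measurableSet_Ioi)
    (barnesRemainder_isBigO_atTop hτ w) (barnesRemainder_isBigO_zero hτ w) hs

theorem differentiableAt_mellin_barnesRemainder {τ : ℝ} (hτ : 0 < τ) {w s : ℂ} (hw : 0 < w.re)
    (hs : -1 < s.re) : DifferentiableAt ℂ (mellin (barnesRemainder τ w)) s :=
  mellin_differentiableAt_of_isBigO_rpow_exp (lt_min hw one_pos)
    ((barnesRemainder_continuousOn hτ w).locallyIntegrableOn measurableSet_Ioi)
    (barnesRemainder_isBigO_atTop hτ w) (barnesRemainder_isBigO_zero hτ w) hs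

theorem hasMellin_cexp_neg {s : ℂ} (hs : 0 < s.re) :
    HasMellin (fun t : ℝ => Complex.exp (-t)) s (Complex.Gamma s) := by
  refine ⟨?_, ?_⟩
  · have := Complex.GammaIntegral_convergent hs
    refine this.congr_fun (fun t _ => ?_) measurableSet_Ioi
    simp [mul_comm]
  · rw [Complex.Gamma_eq_integral hs, Complex.GammaIntegral, mellin]
    congr 1 with t
    simp [mul_comm]

theorem hasMellin_barnesPrincipal (τ : ℝ) (w : ℂ) {s : ℂ} (hs : 2 < s.re) :
    HasMellin (barnesPrincipal τ w) s (1 / τ * Complex.Gamma (s - 2) +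
      barnesCoeff₁ τ w * Complex.Gamma (s - 1) + barnesCoeff₂ τ w * Complex.Gamma s) := by
  have hcp : ∀ (c : ℂ) (n : ℕ), 0 < (s - n).re →
      HasMellin (fun t : ℝ => c • ((t : ℂ) ^ (-(n : ℂ)) • Complex.exp (-t))) s
        (c * Complex.Gamma (s - n)) := by
    intro c n hn
    have h := hasMellin_cexp_neg hn
    have h1 : MellinConvergent (fun t : ℝ => (t : ℂ) ^ (-(n : ℂ)) • Complex.exp (-t)) s :=
      MellinConvergent.cpow_smul.2 (by rw [← sub_eq_add_neg]; exact h.1)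
    refine ⟨h1.const_smul c, ?_⟩
    rw [mellin_const_smul, mellin_cpow_smul, ← sub_eq_add_neg, h.2, smul_eq_mul]
  have h2 := hcp (1 / τ) 2 (by simp; linarith)
  have h1 := hcp (barnesCoeff₁ τ w) 1 (by simp; linarith)
  have h0 := hcp (barnesCoeff₂ τ w) 0 (by simp; linarith)
  have h21 := hasMellin_add h2.1 h1.1
  have h210 := hasMellin_add h21.1 h0.1
  rw [h21.2, h2.2, h1.2, h0.2] at h210
  convert h210 using 1
  · ext t
    simp only [barnesPrincipal, smul_eq_mul, Complex.cpow_neg, Complex.cpow_natCast]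
    simp
    ring
  · simp

theorem hasMellin_barnesKernel {τ : ℝ} (hτ : 0 < τ) {w s : ℂ} (hw : 0 < w.re) (hs : 2 < s.re) :
    HasMellin (barnesKernel τ w) s (mellin (barnesRemainder τ w) s +
      (1 / τ * Complex.Gamma (s - 2) + barnesCoeff₁ τ w * Complex.Gamma (s - 1) +
        barnesCoeff₂ τ w * Complex.Gamma s)) := by
  have hp := hasMellin_barnesPrincipal τ w hs
  have := hasMellin_add (mellinConvergent_barnesRemainder hτ hw (s := s) (by linarith)) hp.1
  rw [hp.2] at this
  simpa only [barnesRemainder, sub_add_cancel] using this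

/-- The continuation of `ζ₂(·, w | τ)` to `Re s > -1`. -/
noncomputable def barnesContinuation (τ : ℝ) (w s : ℂ) : ℂ :=
  (Complex.Gamma s)⁻¹ * mellin (barnesRemainder τ w) s + 1 / τ / ((s - 1) * (s - 2)) +
    barnesCoeff₁ τ w / (s - 1) + barnesCoeff₂ τ w

/-- For `Re s > 2` the principal part contributes `Γ(s-2)`, `Γ(s-1)` and `Γ(s)`; divided by `Γ(s)`
these are rational functions with poles at `1` and `2` only. -/
theorem isBarnesZeta₂Continuation_barnesContinuation {τ : ℝ} (hτ : 0 < τ) {w : ℂ}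
    (hw : 0 < w.re) : IsBarnesZeta₂Continuation 1 τ w (barnesContinuation τ w) := by
  constructor
  · rintro s ⟨hs, hs12⟩
    have hs1 : s - 1 ≠ 0 := sub_ne_zero.2 fun h => hs12 (by simp [h])
    have hs2 : s - 2 ≠ 0 := sub_ne_zero.2 fun h => hs12 (by simp [h])
    have h1 := differentiableAt_mellin_barnesRemainder hτ hw hs
    have h2 := Complex.differentiable_one_div_Gamma s
    unfold barnesContinuation
    refine DifferentiableAt.differentiableWithinAt ?_
    exact (((h2.mul h1).add (by fun_prop (disch := simp [hs1, hs2]))).add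
      (by fun_prop (disch := exact hs1))).add (by fun_prop)
  · intro s hs
    have h := (hasMellin_barnesKernel hτ hw hs).2
    have e : barnesZeta₂ 1 τ s w = (Complex.Gamma s)⁻¹ * mellin (barnesKernel τ w) s := rfl
    have hs1 : s - 1 ≠ 0 := fun h => by
      have := congrArg Complex.re h; simp at this; linarith
    have hs2 : s - 2 ≠ 0 := fun h => by
      have := congrArg Complex.re h; simp at this; linarith
    have hG : Complex.Gamma (s - 2) ≠ 0 := Complex.Gamma_ne_zero_of_re_pos (by simp; linarith)
    have g1 : Complex.Gamma (s - 1) = (s - 2) * Complex.Gamma (s - 2) := by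
      rw [← Complex.Gamma_add_one _ hs2]; ring_nf
    have g0 : Complex.Gamma s = (s - 1) * Complex.Gamma (s - 1) := by
      rw [← Complex.Gamma_add_one _ hs1]; ring_nf
    rw [e, h, barnesContinuation, mul_add, add_assoc, add_assoc]
    congr 1
    rw [g0, g1]
    field_simp
    ring

/-- Uniqueness of the continuation near `0`. -/
theorem eventuallyEq_zero_of_eq_of_two_lt_re {f g : ℂ → ℂ}
    (hf : DifferentiableOn ℂ f ({s : ℂ | -1 < s.re} \ {1, 2}))
    (hg : DifferentiableOn ℂ g ({s : ℂ | -1 < s.re} \ {1, 2}))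
    (h : ∀ s : ℂ, 2 < s.re → f s = g s) : f =ᶠ[𝓝 0] g := by
  -- A quarter-plane above the real axis joined to the unit disc is visibly connected, avoids `1`
  -- and `2`, contains `0`, and meets `Re s > 2`.
  let A : Set ℂ := {s | -1 < s.re} ∩ {s | 0 < s.im}
  have hA : Convex ℝ A := (convex_halfSpace_re_gt _).inter (convex_halfSpace_im_gt _)
  have hAo : IsOpen A := (isOpen_lt continuous_const Complex.continuous_re).inter
    (isOpen_lt continuous_const Complex.continuous_im)
  let V : Set ℂ := A ∪ Metric.ball 0 1
  have hVo : IsOpen V := hAo.union Metric.isOpen_ball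
  have hV : IsPreconnected V := by
    refine IsPreconnected.union (Complex.I / 2) ⟨?_, ?_⟩ ?_ hA.isPreconnected
      (convex_ball (0 : ℂ) 1).isPreconnected
    · simp
    · simp
    · simp; norm_num
  have hsub : V ⊆ {s : ℂ | -1 < s.re} \ {1, 2} := by
    rintro s (⟨h1, h2⟩ | hs)
    · refine ⟨h1, ?_⟩
      rintro (rfl | rfl) <;> simp at h2
    · have hs' : ‖s‖ < 1 := by simpa using hs
      have := (abs_le.1 (Complex.abs_re_le_norm s)).1
      refine ⟨by show -1 < s.re; linarith, ?_⟩
      rintro (rfl | rfl) <;> norm_num at hs'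
  have key := ((hf.mono hsub).analyticOnNhd hVo).eqOn_of_preconnected_of_eventuallyEq
    ((hg.mono hsub).analyticOnNhd hVo) hV (z₀ := 3 + Complex.I)
    (Or.inl ⟨by simp; norm_num, by simp⟩) (by
      have : {s : ℂ | 2 < s.re} ∈ 𝓝 (3 + Complex.I) :=
        (isOpen_lt continuous_const Complex.continuous_re).mem_nhds (by simp; norm_num)
      filter_upwards [this] with s hs using h s hs)
  filter_upwards [hVo.mem_nhds (x := 0) (Or.inr (by simp))] with s hs using key hs

theorem hasDerivAt_barnesContinuation {τ : ℝ} (hτ : 0 < τ) {w : ℂ} (hw : 0 < w.re) :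
    HasDerivAt (barnesContinuation τ w)
      (mellin (barnesRemainder τ w) 0 + 3 / 4 / τ - barnesCoeff₁ τ w) 0 := by
  have hm := (differentiableAt_mellin_barnesRemainder hτ hw (s := 0) (by simp)).hasDerivAt
  -- `1/Γ(s) = s/Γ(s+1)` vanishes at `0` with derivative `1`, so only the value at `0` of the Mellin
  -- transform survives in the product rule.
  have hG : HasDerivAt (fun s : ℂ => (Complex.Gamma s)⁻¹) 1 0 := by
    have h1 := (Complex.differentiable_one_div_Gamma (0 + 1)).hasDerivAt.comp_add_const 0 1
    have h2 := (hasDerivAt_id (0 : ℂ)).mul h1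
    simp only [id, zero_add, Complex.Gamma_one, inv_one, mul_one, zero_mul, add_zero] at h2
    refine h2.congr_of_eventuallyEq (Eventually.of_forall fun s => ?_)
    simpa using Complex.one_div_Gamma_eq_self_mul_one_div_Gamma_add_one s
  have hr : HasDerivAt (fun s : ℂ => 1 / (τ : ℂ) / ((s - 1) * (s - 2))) (3 / 4 / τ) 0 := by
    have h1 : HasDerivAt (fun s : ℂ => (s - 1) * (s - 2)) (1 * (0 - 2) + (0 - 1) * 1) 0 :=
      ((hasDerivAt_id (0 : ℂ)).sub_const 1).mul ((hasDerivAt_id (0 : ℂ)).sub_const 2)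
    refine ((hasDerivAt_const (0 : ℂ) (1 / (τ : ℂ))).div h1 (by norm_num)).congr_deriv ?_
    norm_num
    try ring
  have hr1 : HasDerivAt (fun s : ℂ => barnesCoeff₁ τ w / (s - 1)) (-barnesCoeff₁ τ w) 0 := by
    refine ((hasDerivAt_const (0 : ℂ) (barnesCoeff₁ τ w)).div
      ((hasDerivAt_id (0 : ℂ)).sub_const 1) (by norm_num)).congr_deriv ?_
    norm_num
  refine ((((hG.mul hm).add hr).add hr1).add_const (barnesCoeff₂ τ w)).congr_deriv ?_
  simp [Complex.Gamma_zero]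
  ring

/-- The choice made by `Classical.epsilon` does not matter: any two continuations agree near `0`. -/
theorem barnesLogGamma₂_eq_deriv {τ : ℝ} (hτ : 0 < τ) {w : ℂ} (hw : 0 < w.re) :
    barnesLogGamma₂ 1 τ w = deriv (barnesContinuation τ w) 0 := by
  have h := isBarnesZeta₂Continuation_barnesContinuation hτ hw
  have he := Classical.epsilon_spec (p := IsBarnesZeta₂Continuation 1 τ w) ⟨_, h⟩
  exact (eventuallyEq_zero_of_eq_of_two_lt_re he.1 h.1
    fun s hs => (he.2 s hs).trans (h.2 s hs).symm).deriv_eq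

theorem barnesLogGamma₂_eq {τ : ℝ} (hτ : 0 < τ) {w : ℂ} (hw : 0 < w.re) :
    barnesLogGamma₂ 1 τ w = mellin (barnesRemainder τ w) 0 + 3 / 4 / τ - barnesCoeff₁ τ w := by
  rw [barnesLogGamma₂_eq_deriv hτ hw, (hasDerivAt_barnesContinuation hτ hw).deriv]

/-- All three principal terms contribute, since `Γ(s-2)/Γ(s)` and `Γ(s-1)/Γ(s)` do not vanish at
`0`. -/
theorem barnesContinuation_zero (τ : ℝ) (w : ℂ) :
    barnesContinuation τ w 0 = 1 / (2 * τ) - barnesCoeff₁ τ w + barnesCoeff₂ τ w := by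
  simp [barnesContinuation, Complex.Gamma_zero]
  ring

/-! ### Duplication and shift relations for `L₂` -/

theorem hasDerivAt_barnesContinuation_logGamma {τ : ℝ} (hτ : 0 < τ) {w : ℂ} (hw : 0 < w.re) :
    HasDerivAt (barnesContinuation τ w) (barnesLogGamma₂ 1 τ w) 0 := by
  rw [barnesLogGamma₂_eq hτ hw]
  exact hasDerivAt_barnesContinuation hτ hw

theorem differentiableOn_barnesContinuation {τ : ℝ} (hτ : 0 < τ) {w : ℂ} (hw : 0 < w.re) :
    DifferentiableOn ℂ (barnesContinuation τ w) ({s : ℂ | -1 < s.re} \ {1, 2}) :=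
  (isBarnesZeta₂Continuation_barnesContinuation hτ hw).1

theorem barnesContinuation_eq_mellin {τ : ℝ} (hτ : 0 < τ) {w s : ℂ} (hw : 0 < w.re)
    (hs : 2 < s.re) : barnesContinuation τ w s = (Complex.Gamma s)⁻¹ * mellin (barnesKernel τ w) s :=
  (isBarnesZeta₂Continuation_barnesContinuation hτ hw).2 s hs

/-- With `x = e^{-t}` and `y = e^{-τt}` this is `1/((1-x)(1-y)) = (1+x)(1+y)/((1-x²)(1-y²))`, the
numerator expanded. -/
theorem barnesKernel_two_mul {τ : ℝ} (hτ : 0 < τ) (w : ℂ) {t : ℝ} (ht : 0 < t) :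
    barnesKernel τ (2 * w) t = barnesKernel τ w (2 * t) + barnesKernel τ (w + 1 / 2) (2 * t) +
      barnesKernel τ (w + τ / 2) (2 * t) + barnesKernel τ (w + (1 + τ) / 2) (2 * t) := by
  have h1 := one_sub_cexp_neg_mul_ne_zero one_pos ht
  have h2 := one_sub_cexp_neg_mul_ne_zero hτ ht
  have h3 := one_sub_cexp_neg_mul_ne_zero one_pos (mul_pos two_pos ht)
  have h4 := one_sub_cexp_neg_mul_ne_zero hτ (mul_pos two_pos ht)
  simp only [barnesKernel]
  have e1 : Complex.exp (-((1 : ℝ) : ℂ) * ((2 * t : ℝ) : ℂ)) =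
      Complex.exp (-((1 : ℝ) : ℂ) * t) ^ 2 := by
    rw [← Complex.exp_nat_mul]; push_cast; ring_nf
  have e2 : Complex.exp (-(τ : ℂ) * ((2 * t : ℝ) : ℂ)) = Complex.exp (-(τ : ℂ) * t) ^ 2 := by
    rw [← Complex.exp_nat_mul]; push_cast; ring_nf
  have e3 : Complex.exp (-w * ((2 * t : ℝ) : ℂ)) = Complex.exp (-(2 * w) * t) := by
    push_cast; ring_nf
  have e4 : Complex.exp (-(w + 1 / 2) * ((2 * t : ℝ) : ℂ)) =
      Complex.exp (-(2 * w) * t) * Complex.exp (-((1 : ℝ) : ℂ) * t) := by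
    rw [← Complex.exp_add]; push_cast; ring_nf
  have e5 : Complex.exp (-(w + τ / 2) * ((2 * t : ℝ) : ℂ)) =
      Complex.exp (-(2 * w) * t) * Complex.exp (-(τ : ℂ) * t) := by
    rw [← Complex.exp_add]; push_cast; ring_nf
  have e6 : Complex.exp (-(w + (1 + τ) / 2) * ((2 * t : ℝ) : ℂ)) =
      Complex.exp (-(2 * w) * t) *
        (Complex.exp (-((1 : ℝ) : ℂ) * t) * Complex.exp (-(τ : ℂ) * t)) := by
    rw [← Complex.exp_add, ← Complex.exp_add]; push_cast; ring_nf
  rw [e1] at h3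
  rw [e2] at h4
  rw [e1, e2, e3, e4, e5, e6]
  generalize Complex.exp (-((1 : ℝ) : ℂ) * t) = x at *
  generalize Complex.exp (-(τ : ℂ) * t) = y at *
  rw [← add_div, ← add_div, ← add_div,
    div_eq_div_iff (mul_ne_zero h1 h2) (mul_ne_zero h3 h4)]
  ring

theorem barnesContinuation_two_mul {τ : ℝ} (hτ : 0 < τ) {w s : ℂ} (hw : 0 < w.re)
    (hs : 2 < s.re) :
    barnesContinuation τ (2 * w) s = (2 : ℂ) ^ (-s) * (barnesContinuation τ w s +
      barnesContinuation τ (w + 1 / 2) s + barnesContinuation τ (w + τ / 2) s +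
      barnesContinuation τ (w + (1 + τ) / 2) s) := by
  have w1 : 0 < (w + 1 / 2).re := by
    rw [show (1 / 2 : ℂ) = ((1 / 2 : ℝ) : ℂ) by push_cast; rfl]
    rw [Complex.add_re, Complex.ofReal_re]; positivity
  have w2 : 0 < (w + τ / 2).re := by
    rw [show (τ / 2 : ℂ) = ((τ / 2 : ℝ) : ℂ) by push_cast; rfl]
    rw [Complex.add_re, Complex.ofReal_re]; positivity
  have w3 : 0 < (w + (1 + τ) / 2).re := by
    rw [show ((1 + τ) / 2 : ℂ) = (((1 + τ) / 2 : ℝ) : ℂ) by push_cast; rfl]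
    rw [Complex.add_re, Complex.ofReal_re]; positivity
  have w4 : 0 < (2 * w).re := by simpa using hw
  rw [barnesContinuation_eq_mellin hτ hw hs, barnesContinuation_eq_mellin hτ w1 hs,
    barnesContinuation_eq_mellin hτ w2 hs, barnesContinuation_eq_mellin hτ w3 hs,
    barnesContinuation_eq_mellin hτ w4 hs]
  have h12 := hasMellin_add (hasMellin_barnesKernel hτ hw hs).1 (hasMellin_barnesKernel hτ w1 hs).1
  have h123 := hasMellin_add h12.1 (hasMellin_barnesKernel hτ w2 hs).1
  have h1234 := hasMellin_add h123.1 (hasMellin_barnesKernel hτ w3 hs).1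
  rw [← mul_add, ← mul_add, ← mul_add, ← h12.2, ← h123.2, ← h1234.2, mul_left_comm]
  congr 1
  have := mellin_comp_mul_left (fun t => barnesKernel τ w t + barnesKernel τ (w + 1 / 2) t +
      barnesKernel τ (w + τ / 2) t + barnesKernel τ (w + (1 + τ) / 2) t) s two_pos
  rw [smul_eq_mul, Complex.ofReal_ofNat] at this
  rw [← this]
  refine setIntegral_congr_fun measurableSet_Ioi fun t ht => ?_
  simp only [barnesKernel_two_mul hτ w (mem_Ioi.1 ht)]

/-- Differentiate the duplication of the zeta function at `s = 0`. The factor `2^{-s}` contributes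
`-log 2` times the value of `ζ₂(s, 2w)` at `0`, which is quadratic in `w`. -/
theorem barnesLogGamma₂_two_mul {τ : ℝ} (hτ : 0 < τ) {w : ℂ} (hw : 0 < w.re) :
    barnesLogGamma₂ 1 τ (2 * w) = -Real.log 2 * (1 / (2 * τ) - barnesCoeff₁ τ (2 * w) +
      barnesCoeff₂ τ (2 * w)) + (barnesLogGamma₂ 1 τ w + barnesLogGamma₂ 1 τ (w + 1 / 2) +
      barnesLogGamma₂ 1 τ (w + τ / 2) + barnesLogGamma₂ 1 τ (w + (1 + τ) / 2)) := by
  have w1 : 0 < (w + 1 / 2).re := by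
    rw [show (1 / 2 : ℂ) = ((1 / 2 : ℝ) : ℂ) by push_cast; rfl]
    rw [Complex.add_re, Complex.ofReal_re]; positivity
  have w2 : 0 < (w + τ / 2).re := by
    rw [show (τ / 2 : ℂ) = ((τ / 2 : ℝ) : ℂ) by push_cast; rfl]
    rw [Complex.add_re, Complex.ofReal_re]; positivity
  have w3 : 0 < (w + (1 + τ) / 2).re := by
    rw [show ((1 + τ) / 2 : ℂ) = (((1 + τ) / 2 : ℝ) : ℂ) by push_cast; rfl]
    rw [Complex.add_re, Complex.ofReal_re]; positivity
  have w4 : 0 < (2 * w).re := by simpa using hw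
  have hd := ((hasDerivAt_barnesContinuation_logGamma hτ hw).add
    (hasDerivAt_barnesContinuation_logGamma hτ w1)).add
    (hasDerivAt_barnesContinuation_logGamma hτ w2) |>.add
    (hasDerivAt_barnesContinuation_logGamma hτ w3)
  have h2 : HasDerivAt (fun s : ℂ => (2 : ℂ) ^ (-s)) (-Real.log 2) 0 := by
    refine ((hasDerivAt_id (0 : ℂ)).neg.const_cpow (c := 2) (Or.inl two_ne_zero)).congr_deriv ?_
    simp
  have hev := eventuallyEq_zero_of_eq_of_two_lt_re (differentiableOn_barnesContinuation hτ w4)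
    (g := fun s => (2 : ℂ) ^ (-s) * (barnesContinuation τ w s +
      barnesContinuation τ (w + 1 / 2) s + barnesContinuation τ (w + τ / 2) s +
      barnesContinuation τ (w + (1 + τ) / 2) s))
    (DifferentiableOn.mul (fun s _ => (DifferentiableAt.const_cpow (by fun_prop)
      (Or.inl two_ne_zero)).differentiableWithinAt)
      ((((differentiableOn_barnesContinuation hτ hw).add
      (differentiableOn_barnesContinuation hτ w1)).add
      (differentiableOn_barnesContinuation hτ w2)).add
      (differentiableOn_barnesContinuation hτ w3)))
    (fun s hs => barnesContinuation_two_mul hτ hw hs)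
  have h0 := hev.eq_of_nhds
  have hD := (h2.mul hd).congr_of_eventuallyEq hev
  rw [(hasDerivAt_barnesContinuation_logGamma hτ w4).unique hD]
  simp only [neg_zero, Complex.cpow_zero, one_mul] at h0 ⊢
  rw [← barnesContinuation_zero, h0]
  simp only [Pi.add_apply]

theorem barnesKernel_second_diff {τ : ℝ} (hτ : 0 < τ) (w : ℂ) {t : ℝ} (ht : 0 < t) :
    barnesKernel τ w t - barnesKernel τ (w + 1) t - barnesKernel τ (w + τ) t +
      barnesKernel τ (w + 1 + τ) t = Complex.exp (-w * t) := by
  have h1 := one_sub_cexp_neg_mul_ne_zero one_pos ht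
  have h2 := one_sub_cexp_neg_mul_ne_zero hτ ht
  simp only [barnesKernel]
  have e4 : Complex.exp (-(w + 1) * t) =
      Complex.exp (-w * t) * Complex.exp (-((1 : ℝ) : ℂ) * t) := by
    rw [← Complex.exp_add]; push_cast; ring_nf
  have e5 : Complex.exp (-(w + τ) * t) =
      Complex.exp (-w * t) * Complex.exp (-(τ : ℂ) * t) := by
    rw [← Complex.exp_add]; ring_nf
  have e6 : Complex.exp (-(w + 1 + τ) * t) = Complex.exp (-w * t) *
        (Complex.exp (-((1 : ℝ) : ℂ) * t) * Complex.exp (-(τ : ℂ) * t)) := by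
    rw [← Complex.exp_add, ← Complex.exp_add]; push_cast; ring_nf
  rw [e4, e5, e6]
  generalize Complex.exp (-((1 : ℝ) : ℂ) * t) = x at *
  generalize Complex.exp (-(τ : ℂ) * t) = y at *
  field_simp
  ring

/-- The second difference of the kernel is `e^{-xt}`, so that of the zeta function is `x^{-s}`, with
derivative `-log x` at `0`. Positive real `x` suffices for Bohr–Mollerup. -/
theorem barnesLogGamma₂_second_diff {τ : ℝ} (hτ : 0 < τ) {x : ℝ} (hx : 0 < x) :
    barnesLogGamma₂ 1 τ x - barnesLogGamma₂ 1 τ (x + 1) - barnesLogGamma₂ 1 τ (x + τ) +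
      barnesLogGamma₂ 1 τ (x + 1 + τ) = -Complex.log x := by
  have hw : 0 < (x : ℂ).re := by simpa using hx
  have w1 : 0 < ((x : ℂ) + 1).re := by simp; linarith
  have w2 : 0 < ((x : ℂ) + τ).re := by simp; linarith
  have w3 : 0 < ((x : ℂ) + 1 + τ).re := by simp; linarith
  have hw0 : (x : ℂ) ≠ 0 := by exact_mod_cast hx.ne'
  have harg : Complex.arg x ≠ Real.pi := by
    rw [Complex.arg_ofReal_of_nonneg hx.le]
    exact Real.pi_pos.ne
  have hd := (((hasDerivAt_barnesContinuation_logGamma hτ hw).sub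
    (hasDerivAt_barnesContinuation_logGamma hτ w1)).sub
    (hasDerivAt_barnesContinuation_logGamma hτ w2)).add
    (hasDerivAt_barnesContinuation_logGamma hτ w3)
  have hinv : (1 / (x : ℂ)) ≠ 0 := by simpa using hw0
  have h2 : HasDerivAt (fun s : ℂ => (1 / (x : ℂ)) ^ s) (-Complex.log x) 0 := by
    refine ((hasDerivAt_id (0 : ℂ)).const_cpow (c := 1 / (x : ℂ)) (Or.inl hinv)).congr_deriv ?_
    simp [Complex.log_inv (x : ℂ) harg]
  have hev := eventuallyEq_zero_of_eq_of_two_lt_re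
    ((((differentiableOn_barnesContinuation hτ hw).sub
      (differentiableOn_barnesContinuation hτ w1)).sub
      (differentiableOn_barnesContinuation hτ w2)).add
      (differentiableOn_barnesContinuation hτ w3))
    (g := fun s => (1 / (x : ℂ)) ^ s)
    (fun s _ => (DifferentiableAt.const_cpow (by fun_prop)
      (Or.inl hinv)).differentiableWithinAt)
    (fun s hs => by
      have h12 := hasMellin_sub (hasMellin_barnesKernel hτ hw hs).1
        (hasMellin_barnesKernel hτ w1 hs).1
      have h123 := hasMellin_sub h12.1 (hasMellin_barnesKernel hτ w2 hs).1
      have h1234 := hasMellin_add h123.1 (hasMellin_barnesKernel hτ w3 hs).1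
      simp only [Pi.add_apply, Pi.sub_apply]
      rw [barnesContinuation_eq_mellin hτ hw hs, barnesContinuation_eq_mellin hτ w1 hs,
        barnesContinuation_eq_mellin hτ w2 hs, barnesContinuation_eq_mellin hτ w3 hs,
        ← mul_sub, ← mul_sub, ← mul_add, ← h12.2, ← h123.2, ← h1234.2]
      have h := Complex.integral_cpow_mul_exp_neg_mul_Ioi (a := s) (r := x) (by linarith) hx
      have hG : Complex.Gamma s ≠ 0 := Complex.Gamma_ne_zero_of_re_pos (by linarith)
      rw [inv_mul_eq_iff_eq_mul₀ hG, mul_comm, ← h]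
      refine setIntegral_congr_fun measurableSet_Ioi fun t ht => ?_
      simp only [barnesKernel_second_diff hτ x (mem_Ioi.1 ht), smul_eq_mul, neg_mul])
  exact (hd.unique (h2.congr_of_eventuallyEq hev))

/-! ### The difference `L₂(w) - L₂(w + 1)` -/

/-- A logarithm of `Γ₂(w)/Γ₂(w+1)`, to be identified modulo `2πi` with `log Γ(w/τ)` plus an affine
function of `w`. -/
noncomputable def barnesLogDiff (τ : ℝ) (w : ℂ) : ℂ :=
  barnesLogGamma₂ 1 τ w - barnesLogGamma₂ 1 τ (w + 1)

theorem barnesLogDiff_add {τ : ℝ} (hτ : 0 < τ) {x : ℝ} (hx : 0 < x) :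
    barnesLogDiff τ (x + τ) = barnesLogDiff τ x + Complex.log x := by
  have := barnesLogGamma₂_second_diff hτ hx
  simp only [barnesLogDiff]
  rw [add_right_comm (x : ℂ) (τ : ℂ) 1]
  linear_combination -this

/-- Subtracting the duplication at `w + 1/2` from that at `w` cancels four terms and leaves two
differences: Legendre duplication for step `τ`. -/
theorem barnesLogDiff_two_mul {τ : ℝ} (hτ : 0 < τ) {w : ℂ} (hw : 0 < w.re) :
    barnesLogDiff τ (2 * w) = -Real.log 2 * (1 / 2 - 2 * w / τ) +
      (barnesLogDiff τ w + barnesLogDiff τ (w + τ / 2)) := by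
  have hτ' : (τ : ℂ) ≠ 0 := by exact_mod_cast hτ.ne'
  have w1 : 0 < (w + 1 / 2).re := by
    rw [show (1 / 2 : ℂ) = ((1 / 2 : ℝ) : ℂ) by push_cast; rfl]
    rw [Complex.add_re, Complex.ofReal_re]; positivity
  have h1 := barnesLogGamma₂_two_mul hτ hw
  have h2 := barnesLogGamma₂_two_mul hτ w1
  rw [show w + 1 / 2 + 1 / 2 = w + 1 by ring, show w + 1 / 2 + (τ : ℂ) / 2 = w + (1 + τ) / 2 by ring,
    show w + 1 / 2 + (1 + (τ : ℂ)) / 2 = w + τ / 2 + 1 by ring,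
    show 2 * (w + 1 / 2) = 2 * w + 1 by ring] at h2
  simp only [barnesLogDiff]
  rw [h1, h2]
  simp only [barnesCoeff₁, barnesCoeff₂]
  field_simp
  ring

/-- The difference in `w` cancels `1 - e^{-t}` from the denominator, leaving the gamma-type kernel
`1/(1 - e^{-τt})`. -/
noncomputable def barnesDiffKernel (τ : ℝ) (w : ℂ) (t : ℝ) : ℂ :=
  (t : ℂ)⁻¹ * (Complex.exp (-w * t) / (1 - Complex.exp (-(τ : ℂ) * t)) -
    Complex.exp (-t) * (1 / (τ * t) + (1 - w) / τ + 1 / 2))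

theorem barnesRemainder_sub {τ : ℝ} (hτ : 0 < τ) (w : ℂ) {t : ℝ} (ht : 0 < t) :
    (t : ℂ) ^ ((0 : ℂ) - 1) • (barnesRemainder τ w t - barnesRemainder τ (w + 1) t) =
      barnesDiffKernel τ w t := by
  have h1 := one_sub_cexp_neg_mul_ne_zero one_pos ht
  have h2 := one_sub_cexp_neg_mul_ne_zero hτ ht
  have hτ' : (τ : ℂ) ≠ 0 := by exact_mod_cast hτ.ne'
  have ht' : (t : ℂ) ≠ 0 := by exact_mod_cast ht.ne'
  have e4 : Complex.exp (-(w + 1) * t) =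
      Complex.exp (-w * t) * Complex.exp (-((1 : ℝ) : ℂ) * t) := by
    rw [← Complex.exp_add]; push_cast; ring_nf
  simp only [barnesRemainder, barnesKernel, barnesPrincipal, barnesDiffKernel, barnesCoeff₁,
    barnesCoeff₂, e4]
  rw [show (t : ℂ) ^ ((0 : ℂ) - 1) = (t : ℂ)⁻¹ by rw [zero_sub, Complex.cpow_neg_one],
    smul_eq_mul]
  congr 1
  generalize Complex.exp (-((1 : ℝ) : ℂ) * t) = x at *
  generalize Complex.exp (-(τ : ℂ) * t) = y at *
  field_simp
  ring

theorem integrableOn_barnesDiffKernel {τ : ℝ} (hτ : 0 < τ) {w : ℂ} (hw : 0 < w.re) :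
    IntegrableOn (barnesDiffKernel τ w) (Ioi 0) := by
  have h := hasMellin_sub (mellinConvergent_barnesRemainder hτ hw (s := 0) (by simp))
    (mellinConvergent_barnesRemainder hτ (w := w + 1) (by simp; linarith) (s := 0) (by simp))
  exact h.1.congr_fun (fun t ht => barnesRemainder_sub hτ w ht) measurableSet_Ioi

theorem barnesLogDiff_eq_integral {τ : ℝ} (hτ : 0 < τ) {w : ℂ} (hw : 0 < w.re) :
    barnesLogDiff τ w = (∫ t in Ioi (0 : ℝ), barnesDiffKernel τ w t) - 1 / τ := by
  have hw1 : 0 < (w + 1).re := by simp; linarith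
  have h := hasMellin_sub (mellinConvergent_barnesRemainder hτ hw (s := 0) (by simp))
    (mellinConvergent_barnesRemainder hτ hw1 (s := 0) (by simp))
  have h2 : ∫ t in Ioi (0 : ℝ), barnesDiffKernel τ w t =
      mellin (barnesRemainder τ w) 0 - mellin (barnesRemainder τ (w + 1)) 0 := by
    rw [← h.2]
    exact (setIntegral_congr_fun measurableSet_Ioi
      fun t ht => barnesRemainder_sub hτ w ht).symm
  rw [h2, barnesLogDiff, barnesLogGamma₂_eq hτ hw, barnesLogGamma₂_eq hτ hw1]
  simp only [barnesCoeff₁]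
  ring

/-! ### Identification with the gamma function -/

noncomputable def barnesLogDiffReal (τ x : ℝ) : ℝ :=
  (∫ t in Ioi (0 : ℝ), t⁻¹ * (Real.exp (-x * t) / (1 - Real.exp (-τ * t)) -
    Real.exp (-t) * (1 / (τ * t) + (1 - x) / τ + 1 / 2))) - 1 / τ

theorem barnesDiffKernel_ofReal (τ x t : ℝ) : barnesDiffKernel τ x t =
    ((t⁻¹ * (Real.exp (-x * t) / (1 - Real.exp (-τ * t)) -
      Real.exp (-t) * (1 / (τ * t) + (1 - x) / τ + 1 / 2)) : ℝ) : ℂ) := by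
  simp only [barnesDiffKernel]
  push_cast
  rfl

theorem barnesLogDiff_ofReal {τ : ℝ} (hτ : 0 < τ) {x : ℝ} (hx : 0 < x) :
    barnesLogDiff τ x = barnesLogDiffReal τ x := by
  rw [barnesLogDiff_eq_integral hτ (by simpa using hx)]
  simp only [barnesDiffKernel_ofReal]
  rw [integral_complex_ofReal, barnesLogDiffReal]
  push_cast
  rfl

theorem one_sub_exp_neg_pos {a t : ℝ} (ha : 0 < a) (ht : 0 < t) : 0 < 1 - Real.exp (-a * t) := by
  have : Real.exp (-a * t) < Real.exp 0 := Real.exp_lt_exp.2 (by nlinarith [mul_pos ha ht])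
  rw [Real.exp_zero] at this
  linarith

/-- The integrand is convex in `x` for each `t`: `e^{-xt}` is convex with a positive coefficient,
and the subtracted term is affine in `x`. -/
theorem convexOn_barnesLogDiffReal {τ : ℝ} (hτ : 0 < τ) :
    ConvexOn ℝ (Ioi 0) (barnesLogDiffReal τ) := by
  have hint : ∀ x : ℝ, 0 < x → IntegrableOn (fun t : ℝ =>
      t⁻¹ * (Real.exp (-x * t) / (1 - Real.exp (-τ * t)) -
      Real.exp (-t) * (1 / (τ * t) + (1 - x) / τ + 1 / 2))) (Ioi 0) := by
    intro x hx
    have h := integrableOn_barnesDiffKernel hτ (w := (x : ℂ)) (by simpa using hx)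
    have h2 := h.re
    refine IntegrableOn.congr_fun h2 (fun t _ => ?_) measurableSet_Ioi
    rw [barnesDiffKernel_ofReal]
    exact Complex.ofReal_re _
  refine ⟨convex_Ioi 0, fun x hx y hy a b ha hb hab => ?_⟩
  have hx : 0 < x := hx
  have hy : 0 < y := hy
  have hxy : 0 < a * x + b * y := by
    rcases ha.eq_or_lt with rfl | ha'
    · rw [zero_add] at hab; subst hab; simpa using hy
    · have := mul_pos ha' hx
      have := mul_nonneg hb hy.le
      linarith
  simp only [smul_eq_mul, barnesLogDiffReal]
  have key := setIntegral_mono_on (hint _ hxy) (((hint x hx).const_mul a).add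
    ((hint y hy).const_mul b)) measurableSet_Ioi (fun t (ht : 0 < t) => by
      have h1 := one_sub_exp_neg_pos hτ ht
      have h2 := convexOn_exp.2 (mem_univ (-x * t)) (mem_univ (-y * t)) ha hb hab
      simp only [smul_eq_mul] at h2
      rw [show a * (-x * t) + b * (-y * t) = -(a * x + b * y) * t by ring] at h2
      have h3 : Real.exp (-(a * x + b * y) * t) / (1 - Real.exp (-τ * t)) ≤
          a * (Real.exp (-x * t) / (1 - Real.exp (-τ * t))) +
            b * (Real.exp (-y * t) / (1 - Real.exp (-τ * t))) := by
        rw [← mul_div_assoc, ← mul_div_assoc, ← add_div]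
        gcongr
      have hb' : b = 1 - a := by linarith
      have h4 := mul_le_mul_of_nonneg_left h3 (inv_nonneg.2 ht.le)
      simp only [Pi.add_apply]
      subst hb'
      have e : t⁻¹ * (Real.exp (-t) * (1 / (τ * t) + (1 - (a * x + (1 - a) * y)) / τ + 1 / 2)) =
        a * (t⁻¹ * (Real.exp (-t) * (1 / (τ * t) + (1 - x) / τ + 1 / 2))) +
        (1 - a) * (t⁻¹ * (Real.exp (-t) * (1 / (τ * t) + (1 - y) / τ + 1 / 2))) := by ring
      linarith)
  simp only [Pi.add_apply] at key
  rw [integral_add ((hint x hx).const_mul a) ((hint y hy).const_mul b), integral_const_mul,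
    integral_const_mul] at key
  have : b * (1 / τ) = 1 / τ - a * (1 / τ) := by rw [eq_sub_of_add_eq' hab]; ring
  linarith

theorem barnesLogDiffReal_add {τ : ℝ} (hτ : 0 < τ) {x : ℝ} (hx : 0 < x) :
    barnesLogDiffReal τ (x + τ) = barnesLogDiffReal τ x + Real.log x := by
  have h := barnesLogDiff_add hτ hx
  rw [← Complex.ofReal_add, barnesLogDiff_ofReal hτ hx, barnesLogDiff_ofReal hτ (by positivity),
    ← Complex.ofReal_log hx.le] at h
  exact_mod_cast h

/-- At `w = τ/2` the points `2w` and `w + τ/2` coincide, so duplication determines the remaining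
value. -/
theorem barnesLogDiffReal_half {τ : ℝ} (hτ : 0 < τ) :
    barnesLogDiffReal τ (τ / 2) = -(Real.log 2 / 2) := by
  have h := barnesLogDiff_two_mul hτ (w := ((τ / 2 : ℝ) : ℂ)) (by simpa using hτ)
  have hτ' : (τ : ℂ) ≠ 0 := by exact_mod_cast hτ.ne'
  rw [show (2 : ℂ) * ((τ / 2 : ℝ) : ℂ) = (τ : ℂ) by push_cast; ring,
    show ((τ / 2 : ℝ) : ℂ) + (τ : ℂ) / 2 = (τ : ℂ) by push_cast; ring,
    barnesLogDiff_ofReal hτ hτ, barnesLogDiff_ofReal hτ (half_pos hτ), div_self hτ'] at h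
  have h2 : ((barnesLogDiffReal τ (τ / 2) : ℝ) : ℂ) = ((-(Real.log 2 / 2) : ℝ) : ℂ) := by
    push_cast
    linear_combination -h
  exact_mod_cast h2

theorem exp_barnesLogDiffReal {τ : ℝ} (hτ : 0 < τ) {x : ℝ} (hx : 0 < x) :
    Real.exp (barnesLogDiffReal τ x) =
      Real.Gamma (x / τ) * Real.exp ((x / τ - 1 / 2) * Real.log τ - Real.log (2 * Real.pi) / 2) := by
  set c := barnesLogDiffReal τ τ - Real.log τ with hc
  let g : ℝ → ℝ := fun y => barnesLogDiffReal τ (τ * y) - y * Real.log τ - c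
  have hg : EqOn (fun y => Real.exp (g y)) Real.Gamma (Ioi 0) := by
    -- Bohr–Mollerup: rescaling by `τ` and subtracting `y log τ` turns the shift by `τ` into the
    -- functional equation of `Γ`; `c` normalizes the value at `1`.
    refine Real.eq_Gamma_of_log_convex ?_ ?_ ?_ ?_
    · have : Real.log ∘ (fun y => Real.exp (g y)) = g := by ext y; simp
      rw [this]
      refine ⟨convex_Ioi 0, fun x hx y hy a b ha hb hab => ?_⟩
      have h := (convexOn_barnesLogDiffReal hτ).2 (mem_Ioi.2 (mul_pos hτ hx))
        (mem_Ioi.2 (mul_pos hτ hy)) ha hb hab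
      simp only [smul_eq_mul, g] at h ⊢
      rw [show a * (τ * x) + b * (τ * y) = τ * (a * x + b * y) by ring] at h
      have : c = a * c + b * c := by rw [← add_mul, hab, one_mul]
      linarith
    · intro y hy
      simp only [g]
      rw [mul_add, mul_one, barnesLogDiffReal_add hτ (by positivity),
        Real.log_mul hτ.ne' hy.ne']
      conv_rhs => rw [← Real.exp_log hy, ← Real.exp_add, Real.exp_log hy]
      congr 1
      ring
    · intro y _; positivity
    · simp [g, hc]
  -- The constant comes from `y = 1/2`, where `Γ(1/2) = √π` and the left side is known from
  -- duplication.
  have hc' : Real.exp c = Real.exp (-(Real.log τ / 2) - Real.log (2 * Real.pi) / 2) := by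
    have h := hg (mem_Ioi.2 (by norm_num : (0 : ℝ) < 1 / 2))
    simp only [g, Real.Gamma_one_half_eq] at h
    rw [mul_one_div, barnesLogDiffReal_half hτ, Real.sqrt_eq_rpow,
      Real.rpow_def_of_pos Real.pi_pos, Real.exp_eq_exp] at h
    rw [Real.exp_eq_exp, Real.log_mul two_ne_zero Real.pi_ne_zero]
    linarith
  have h := hg (mem_Ioi.2 (div_pos hx hτ))
  simp only [g] at h
  rw [mul_div_cancel₀ _ hτ.ne'] at h
  rw [← h, ← Real.exp_add]
  rw [Real.exp_eq_exp] at hc' ⊢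
  linarith

/-! ### Extension of the gamma identity to the complex half-plane -/

theorem norm_cexp_sub_cexp_le {z w : ℂ} (hz : z.re ≤ 0) (hw : w.re ≤ 0) :
    ‖Complex.exp z - Complex.exp w‖ ≤ ‖z - w‖ := by
  have hconv : Convex ℝ {w : ℂ | w.re ≤ 0} := convex_halfSpace_re_le 0
  have := hconv.norm_image_sub_le_of_norm_hasDerivWithin_le (f := Complex.exp)
    (f' := Complex.exp) (C := 1) (x := w) (y := z)
    (fun w _ => (Complex.hasDerivAt_exp w).hasDerivWithinAt)
    (fun w hw => by rw [Complex.norm_exp]; exact Real.exp_le_one_iff.2 hw) hw hz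
  simpa using this

theorem inv_one_sub_exp_neg_le {x : ℝ} (hx : 0 < x) : (1 - Real.exp (-x))⁻¹ ≤ 1 + 1 / x := by
  have h0 : 0 < 1 - Real.exp (-x) := by simpa using one_sub_exp_neg_pos one_pos hx
  have h1 : (1 + x) * Real.exp (-x) ≤ 1 := by
    rw [Real.exp_neg, ← div_eq_mul_inv, div_le_one (Real.exp_pos x)]
    linarith [Real.add_one_le_exp x]
  rw [inv_le_iff_one_le_mul₀ h0, ← sub_nonneg]
  have e : (1 + 1 / x) * (1 - Real.exp (-x)) - 1 = (1 - (1 + x) * Real.exp (-x)) / x := by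
    field_simp
    ring
  rw [e]
  exact div_nonneg (by linarith) hx.le

theorem one_div_le_inv_one_sub_exp_neg {x : ℝ} (hx : 0 < x) : 1 / x ≤ (1 - Real.exp (-x))⁻¹ := by
  have h0 : 0 < 1 - Real.exp (-x) := by simpa using one_sub_exp_neg_pos one_pos hx
  rw [one_div]
  exact inv_anti₀ h0 (by linarith [Real.add_one_le_exp (-x)])

/-- Both terms blow up like `1/(τt)`. Split into `e^{-wt}` times `1/(1-e^{-x}) - 1/x ∈ [0, 1]`, with
`x = τt`, and `(e^{-wt} - e^{-t})/(τt)`, whose numerator is `O(t)` uniformly after extracting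
`e^{-at}`. -/
theorem norm_barnesDiffKernel_deriv_le {τ : ℝ} (hτ : 0 < τ) {w : ℂ} {a t : ℝ} (ht : 0 < t)
    (haw : a ≤ w.re) (ha1 : a ≤ 1) :
    ‖Complex.exp (-w * t) / (1 - Complex.exp (-(τ : ℂ) * t)) - Complex.exp (-t) / (τ * t)‖ ≤
      (1 + ‖w - 1‖ / τ) * Real.exp (-a * t) := by
  have hτ' : (τ : ℂ) ≠ 0 := by exact_mod_cast hτ.ne'
  have ht' : (t : ℂ) ≠ 0 := by exact_mod_cast ht.ne'
  have hτt : 0 < τ * t := by positivity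
  have e : Complex.exp (-w * t) / (1 - Complex.exp (-(τ : ℂ) * t)) - Complex.exp (-t) / (τ * t) =
      Complex.exp (-w * t) * (((1 - Real.exp (-(τ * t)))⁻¹ - 1 / (τ * t) : ℝ) : ℂ) +
      (Complex.exp (-(a : ℂ) * t) * (Complex.exp (-(w - a) * t) - Complex.exp (-(1 - a) * t))) /
        (τ * t) := by
    rw [mul_sub, ← Complex.exp_add, ← Complex.exp_add]
    push_cast
    ring_nf
  have hexp : ‖Complex.exp (-w * t)‖ ≤ Real.exp (-a * t) := by
    rw [Complex.norm_exp]
    refine Real.exp_le_exp.2 ?_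
    simp; nlinarith
  have hexpa : ‖Complex.exp (-(a : ℂ) * t)‖ = Real.exp (-a * t) := by
    rw [Complex.norm_exp]; simp
  have hd : ‖Complex.exp (-(w - a) * t) - Complex.exp (-(1 - a) * t)‖ ≤ ‖w - 1‖ * t := by
    refine (norm_cexp_sub_cexp_le ?_ ?_).trans_eq ?_
    · simp; nlinarith
    · simp; nlinarith
    · rw [show -(w - (a : ℂ)) * t - -(1 - a) * t = -((w - 1) * t) by ring, norm_neg, norm_mul,
        Complex.norm_real, Real.norm_of_nonneg ht.le]
  have hr : ‖(((1 - Real.exp (-(τ * t)))⁻¹ - 1 / (τ * t) : ℝ) : ℂ)‖ ≤ 1 := by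
    rw [Complex.norm_real, Real.norm_eq_abs, abs_le]
    constructor
    · linarith [one_div_le_inv_one_sub_exp_neg hτt]
    · linarith [inv_one_sub_exp_neg_le hτt]
  rw [e]
  refine (norm_add_le _ _).trans ?_
  rw [norm_mul, norm_div, norm_mul (Complex.exp (-(a : ℂ) * t)), hexpa,
    norm_mul (τ : ℂ) (t : ℂ), Complex.norm_real τ, Complex.norm_real t,
    Real.norm_of_nonneg hτ.le, Real.norm_of_nonneg ht.le]
  calc _ ≤ Real.exp (-a * t) * 1 + Real.exp (-a * t) * (‖w - 1‖ * t) / (τ * t) := by gcongr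
    _ = _ := by field_simp

theorem hasDerivAt_barnesDiffKernel {τ : ℝ} (hτ : 0 < τ) (w : ℂ) {t : ℝ} (ht : 0 < t) :
    HasDerivAt (fun w => barnesDiffKernel τ w t)
      (-(Complex.exp (-w * t) / (1 - Complex.exp (-(τ : ℂ) * t)) -
        Complex.exp (-t) / (τ * t))) w := by
  have hτ' : (τ : ℂ) ≠ 0 := by exact_mod_cast hτ.ne'
  have ht' : (t : ℂ) ≠ 0 := by exact_mod_cast ht.ne'
  have h1 : HasDerivAt (fun w : ℂ => Complex.exp (-w * t)) (Complex.exp (-w * t) * (-1 * t)) w :=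
    ((hasDerivAt_id w).neg.mul_const (t : ℂ)).cexp
  have h2 : HasDerivAt (fun w : ℂ => 1 / ((τ : ℂ) * t) + (1 - w) / τ + 1 / 2) (-1 / τ) w :=
    ((((hasDerivAt_id w).const_sub 1).div_const (τ : ℂ)).const_add _).add_const _
  refine (((h1.div_const _).sub (h2.const_mul _)).const_mul _).congr_deriv ?_
  have h3 := one_sub_cexp_neg_mul_ne_zero hτ ht
  field_simp
  ring

theorem differentiableAt_barnesLogDiff {τ : ℝ} (hτ : 0 < τ) {w : ℂ} (hw : 0 < w.re) :
    DifferentiableAt ℂ (barnesLogDiff τ) w := by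
  have hmem : {z : ℂ | 0 < z.re} ∈ 𝓝 w :=
    (isOpen_lt continuous_const Complex.continuous_re).mem_nhds hw
  have hev : barnesLogDiff τ =ᶠ[𝓝 w]
      fun w => (∫ t in Ioi (0 : ℝ), barnesDiffKernel τ w t) - 1 / τ := by
    filter_upwards [hmem] with z hz using barnesLogDiff_eq_integral hτ hz
  refine DifferentiableAt.congr_of_eventuallyEq ?_ hev
  refine DifferentiableAt.sub_const ?_ _
  set a := min (w.re / 2) 1
  have ha : 0 < a := lt_min (by linarith) one_pos
  have hball : ∀ z ∈ Metric.ball w (w.re / 2), w.re / 2 ≤ z.re := by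
    intro z hz
    have h1 := (abs_le.1 (Complex.abs_re_le_norm (z - w))).1
    have h2 : ‖z - w‖ < w.re / 2 := by simpa [dist_eq_norm] using hz
    simp at h1
    linarith
  refine (hasDerivAt_integral_of_dominated_loc_of_deriv_le
    (μ := volume.restrict (Ioi (0 : ℝ))) (F := fun w t => barnesDiffKernel τ w t)
    (F' := fun w t => -(Complex.exp (-w * t) / (1 - Complex.exp (-(τ : ℂ) * t)) -
        Complex.exp (-t) / (τ * t)))
    (bound := fun t => (1 + (‖w - 1‖ + w.re / 2) / τ) * Real.exp (-a * t))
    (Metric.ball_mem_nhds w (half_pos hw)) ?_ (integrableOn_barnesDiffKernel hτ hw) ?_ ?_ ?_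
    ?_).2.differentiableAt
  · filter_upwards [hmem] with z hz using (integrableOn_barnesDiffKernel hτ hz).1
  · refine ContinuousOn.aestronglyMeasurable ?_ measurableSet_Ioi
    refine (((ContinuousOn.div (by fun_prop) (by fun_prop) fun t ht =>
      one_sub_cexp_neg_mul_ne_zero hτ ht).sub (ContinuousOn.div (by fun_prop) (by fun_prop)
      fun t ht => ?_))).neg
    exact_mod_cast (mul_pos hτ ht).ne'
  · filter_upwards [ae_restrict_mem measurableSet_Ioi] with t (ht : 0 < t) z hz
    rw [norm_neg]
    refine (norm_barnesDiffKernel_deriv_le hτ ht ((min_le_left _ _).trans (hball z hz))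
      (min_le_right _ _)).trans ?_
    have h2 : ‖z - w‖ < w.re / 2 := by simpa [dist_eq_norm] using hz
    have h3 : ‖z - 1‖ ≤ ‖w - 1‖ + w.re / 2 := by
      calc ‖z - 1‖ = ‖(z - w) + (w - 1)‖ := by ring_nf
        _ ≤ ‖z - w‖ + ‖w - 1‖ := norm_add_le _ _
        _ ≤ _ := by linarith
    gcongr
  · exact (exp_neg_integrableOn_Ioi 0 ha).const_mul _
  · filter_upwards [ae_restrict_mem measurableSet_Ioi] with t ht z _
    exact hasDerivAt_barnesDiffKernel hτ z ht

theorem exp_barnesLogDiff {τ : ℝ} (hτ : 0 < τ) {w : ℂ} (hw : 0 < w.re) :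
    Complex.exp (barnesLogDiff τ w) = Complex.Gamma (w / τ) *
      Complex.exp ((w / τ - 1 / 2) * Real.log τ - Real.log (2 * Real.pi) / 2) := by
  have hτ' : (τ : ℂ) ≠ 0 := by exact_mod_cast hτ.ne'
  let U : Set ℂ := {z | 0 < z.re}
  have hU : IsOpen U := isOpen_lt continuous_const Complex.continuous_re
  have h1 : DifferentiableOn ℂ (fun w => Complex.exp (barnesLogDiff τ w)) U := fun z hz =>
    (differentiableAt_barnesLogDiff hτ hz).cexp.differentiableWithinAt
  have h2 : DifferentiableOn ℂ (fun w => Complex.Gamma (w / τ) *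
      Complex.exp ((w / τ - 1 / 2) * Real.log τ - Real.log (2 * Real.pi) / 2)) U := by
    intro z hz
    refine DifferentiableAt.differentiableWithinAt (DifferentiableAt.mul ?_ (by fun_prop))
    refine DifferentiableAt.comp z (Complex.differentiableAt_Gamma _ fun m hm => ?_) (by fun_prop)
    have h3 : 0 < (z / (τ : ℂ)).re := by
      rw [Complex.div_ofReal_re]; exact div_pos hz hτ
    rw [hm] at h3
    simp at h3
    linarith [(Nat.cast_nonneg m : (0 : ℝ) ≤ m)]
  refine (h1.analyticOnNhd hU).eqOn_of_preconnected_of_frequently_eq (h2.analyticOnNhd hU)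
    (convex_halfSpace_re_gt 0).isPreconnected (z₀ := 1) (by simp [U]) ?_ hw
  -- Real points accumulating at `1` suffice for the identity theorem.
  have hlim : Tendsto (fun n : ℕ => ((1 + 1 / ((n : ℝ) + 1) : ℝ) : ℂ)) atTop (𝓝[≠] 1) := by
    refine tendsto_nhdsWithin_iff.2 ⟨?_, Eventually.of_forall fun n => ?_⟩
    · have := (tendsto_one_div_add_atTop_nhds_zero_nat (𝕜 := ℝ)).const_add 1
      have h := (Complex.continuous_ofReal.tendsto _).comp this
      rw [add_zero, Complex.ofReal_one] at h
      exact h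
    · have : (0 : ℝ) < 1 / ((n : ℝ) + 1) := by positivity
      intro h
      have h' : (1 + 1 / ((n : ℝ) + 1) : ℝ) = 1 :=
        Complex.ofReal_injective ((mem_singleton_iff.1 h).trans Complex.ofReal_one.symm)
      linarith
  refine hlim.frequently (Frequently.of_forall fun n => ?_)
  have hx : (0 : ℝ) < 1 + 1 / ((n : ℝ) + 1) := by positivity
  generalize (1 + 1 / ((n : ℝ) + 1) : ℝ) = x at hx
  rw [barnesLogDiff_ofReal hτ hx, ← Complex.ofReal_exp, exp_barnesLogDiffReal hτ hx]
  push_cast [Complex.Gamma_ofReal]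
  rw [← Complex.ofReal_div, Complex.Gamma_ofReal]

theorem doubleGamma_ne_zero (τ : ℝ) (w : ℂ) : doubleGamma τ w ≠ 0 := Complex.exp_ne_zero _

theorem doubleGamma_div_add_one {τ : ℝ} (hτ : 0 < τ) {w : ℂ} (hw : 0 < w.re) :
    doubleGamma τ w / doubleGamma τ (w + 1) = Complex.Gamma (w / τ) *
      Complex.exp ((w / τ - 1 / 2) * Real.log τ - Real.log (2 * Real.pi) / 2) := by
  rw [← exp_barnesLogDiff hτ hw, barnesLogDiff, Complex.exp_sub]
  rfl

/-! ### The Lévy density of `-log β_{2,2}` -/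

noncomputable def barnesLevyDensity (τ b₀ b₁ b₂ t : ℝ) : ℝ :=
  Real.exp (-b₀ * t) * (1 - Real.exp (-b₁ * t)) * (1 - Real.exp (-b₂ * t)) /
    ((1 - Real.exp (-t)) * (1 - Real.exp (-τ * t))) / t

theorem one_sub_exp_neg_mul_nonneg {b t : ℝ} (hb : 0 ≤ b) (ht : 0 < t) :
    0 ≤ 1 - Real.exp (-b * t) := by
  have : Real.exp (-b * t) ≤ 1 := Real.exp_le_one_iff.2 (by nlinarith [mul_nonneg hb ht.le])
  linarith

theorem barnesLevyDensity_nonneg {τ b₀ b₁ b₂ t : ℝ} (hτ : 0 < τ) (h1 : 0 ≤ b₁) (h2 : 0 ≤ b₂)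
    (ht : 0 < t) : 0 ≤ barnesLevyDensity τ b₀ b₁ b₂ t := by
  have h3 := one_sub_exp_neg_mul_nonneg h1 ht
  have h4 := one_sub_exp_neg_mul_nonneg h2 ht
  have h5 : 0 < 1 - Real.exp (-t) := by simpa using one_sub_exp_neg_pos one_pos ht
  have h6 := one_sub_exp_neg_pos hτ ht
  unfold barnesLevyDensity
  positivity

theorem one_sub_exp_neg_div_le {a b t : ℝ} (ha : 0 < a) (hb : 0 ≤ b) (ht : 0 < t) :
    (1 - Real.exp (-b * t)) / (1 - Real.exp (-a * t)) ≤ 1 + b / a := by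
  have h1 := one_sub_exp_neg_mul_nonneg hb ht
  have h2 : 1 - Real.exp (-b * t) ≤ b * t := by linarith [Real.add_one_le_exp (-b * t)]
  have h3 : 1 - Real.exp (-b * t) ≤ 1 := by linarith [Real.exp_pos (-b * t)]
  have h4 := inv_one_sub_exp_neg_le (mul_pos ha ht)
  rw [← neg_mul] at h4
  rw [div_eq_mul_inv]
  refine (mul_le_mul_of_nonneg_left h4 h1).trans ?_
  rw [mul_add, mul_one]
  refine add_le_add h3 ((mul_le_mul_of_nonneg_right h2 (by positivity)).trans_eq ?_)
  field_simp

/-- Each numerator factor is paired with a denominator factor, and the quotients stay bounded. The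
decay `e^{-b₀t}` that remains is what permits tilting up to `c < b₀`, hence all moments with `Re q >
-b₀`. -/
theorem mul_barnesLevyDensity_le {τ b₀ b₁ b₂ t : ℝ} (hτ : 0 < τ) (h1 : 0 ≤ b₁) (h2 : 0 ≤ b₂)
    (ht : 0 < t) : t * barnesLevyDensity τ b₀ b₁ b₂ t ≤
      (1 + b₁) * (1 + b₂ / τ) * Real.exp (-b₀ * t) := by
  have h3 := one_sub_exp_neg_div_le one_pos h1 ht
  have h4 := one_sub_exp_neg_div_le hτ h2 ht
  have h5 := one_sub_exp_neg_mul_nonneg h1 ht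
  have h6 := one_sub_exp_neg_mul_nonneg h2 ht
  have h7 : 0 < 1 - Real.exp (-1 * t) := one_sub_exp_neg_pos one_pos ht
  have h8 := one_sub_exp_neg_pos hτ ht
  rw [div_one] at h3
  have e : t * barnesLevyDensity τ b₀ b₁ b₂ t =
      ((1 - Real.exp (-b₁ * t)) / (1 - Real.exp (-1 * t))) *
      ((1 - Real.exp (-b₂ * t)) / (1 - Real.exp (-τ * t))) * Real.exp (-b₀ * t) := by
    rw [neg_one_mul] at h7 ⊢
    unfold barnesLevyDensity
    field_simp
  rw [e]
  gcongr

theorem barnesLevyDensity_continuousOn {τ : ℝ} (hτ : 0 < τ) (b₀ b₁ b₂ : ℝ) :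
    ContinuousOn (barnesLevyDensity τ b₀ b₁ b₂) (Ioi 0) := by
  unfold barnesLevyDensity
  refine ContinuousOn.div (ContinuousOn.div (by fun_prop) (by fun_prop) fun t ht => ?_)
    (by fun_prop) fun t ht => ne_of_gt ht
  have h5 : 0 < 1 - Real.exp (-t) := by simpa using one_sub_exp_neg_pos one_pos ht
  exact mul_ne_zero h5.ne' (one_sub_exp_neg_pos hτ ht).ne'

theorem integrableOn_mul_barnesLevyDensity {τ b₀ b₁ b₂ c : ℝ} (hτ : 0 < τ) (h1 : 0 ≤ b₁)
    (h2 : 0 ≤ b₂) (hc : c < b₀) :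
    IntegrableOn (fun t => t * (Real.exp (c * t) * barnesLevyDensity τ b₀ b₁ b₂ t)) (Ioi 0) := by
  refine Integrable.mono ((exp_neg_integrableOn_Ioi 0 (sub_pos.2 hc)).const_mul
    ((1 + b₁) * (1 + b₂ / τ))) ?_ ?_
  · refine ContinuousOn.aestronglyMeasurable ?_ measurableSet_Ioi
    exact continuousOn_id.mul ((by fun_prop : Continuous fun t => Real.exp (c * t)).continuousOn.mul
      (barnesLevyDensity_continuousOn hτ b₀ b₁ b₂))
  · filter_upwards [ae_restrict_mem measurableSet_Ioi] with t (ht : 0 < t)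
    have h := mul_barnesLevyDensity_le (b₀ := b₀) hτ h1 h2 ht
    have h0 := barnesLevyDensity_nonneg (b₀ := b₀) hτ h1 h2 ht
    rw [Real.norm_of_nonneg (by positivity), Real.norm_of_nonneg (by positivity),
      show -(b₀ - c) * t = c * t + -b₀ * t by ring, Real.exp_add]
    calc _ = Real.exp (c * t) * (t * barnesLevyDensity τ b₀ b₁ b₂ t) := by ring
      _ ≤ Real.exp (c * t) * ((1 + b₁) * (1 + b₂ / τ) * Real.exp (-b₀ * t)) := by gcongr
      _ = _ := by ring

/-- The eight values of `L₂` form a third mixed difference in `q`, `b₁`, `b₂`. It kills the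
principal part, which is quadratic in `w`, and factors on the exponential kernel into `(e^{-qt} -
1)` times the Lévy density. -/
theorem barnesEta₂₂_eq_exp {τ b₀ b₁ b₂ : ℝ} (hτ : 0 < τ) (h0 : 0 < b₀) (h1 : 0 ≤ b₁)
    (h2 : 0 ≤ b₂) {q : ℂ} (hq : -b₀ < q.re) :
    barnesEta₂₂ τ b₀ b₁ b₂ q = Complex.exp (∫ t in Ioi (0 : ℝ),
      (Complex.exp (-q * t) - 1) * barnesLevyDensity τ b₀ b₁ b₂ t) := by
  have r1 : 0 < (q + b₀).re := by simp; linarith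
  have r2 : 0 < (b₀ : ℂ).re := by simpa using h0
  have r3 : 0 < ((b₀ : ℂ) + b₁).re := by simp; linarith
  have r4 : 0 < (q + b₀ + b₁).re := by simp; linarith
  have r5 : 0 < ((b₀ : ℂ) + b₂).re := by simp; linarith
  have r6 : 0 < (q + b₀ + b₂).re := by simp; linarith
  have r7 : 0 < (q + b₀ + b₁ + b₂).re := by simp; linarith
  have r8 : 0 < ((b₀ : ℂ) + b₁ + b₂).re := by simp; linarith
  have hm : ∀ {w : ℂ}, 0 < w.re → MellinConvergent (barnesRemainder τ w) 0 := fun hw =>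
    mellinConvergent_barnesRemainder hτ hw (by simp)
  have m2 := hasMellin_sub (hm r1) (hm r2)
  have m3 := hasMellin_add m2.1 (hm r3)
  have m4 := hasMellin_sub m3.1 (hm r4)
  have m5 := hasMellin_add m4.1 (hm r5)
  have m6 := hasMellin_sub m5.1 (hm r6)
  have m7 := hasMellin_add m6.1 (hm r7)
  have m8 := hasMellin_sub m7.1 (hm r8)
  have key : ∫ t in Ioi (0 : ℝ), (Complex.exp (-q * t) - 1) * barnesLevyDensity τ b₀ b₁ b₂ t =
      mellin (barnesRemainder τ (q + b₀)) 0 - mellin (barnesRemainder τ b₀) 0 +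
      mellin (barnesRemainder τ (b₀ + b₁)) 0 - mellin (barnesRemainder τ (q + b₀ + b₁)) 0 +
      mellin (barnesRemainder τ (b₀ + b₂)) 0 - mellin (barnesRemainder τ (q + b₀ + b₂)) 0 +
      mellin (barnesRemainder τ (q + b₀ + b₁ + b₂)) 0 -
      mellin (barnesRemainder τ (b₀ + b₁ + b₂)) 0 := by
    rw [← m2.2, ← m3.2, ← m4.2, ← m5.2, ← m6.2, ← m7.2, ← m8.2]
    refine setIntegral_congr_fun measurableSet_Ioi fun t (ht : 0 < t) => ?_
    have n1 := one_sub_cexp_neg_mul_ne_zero one_pos ht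
    have n2 := one_sub_cexp_neg_mul_ne_zero hτ ht
    have hτ' : (τ : ℂ) ≠ 0 := by exact_mod_cast hτ.ne'
    have ht' : (t : ℂ) ≠ 0 := by exact_mod_cast ht.ne'
    rw [show (t : ℂ) ^ ((0 : ℂ) - 1) = (t : ℂ)⁻¹ by rw [zero_sub, Complex.cpow_neg_one],
      smul_eq_mul]
    have hP : barnesPrincipal τ (q + b₀) t - barnesPrincipal τ b₀ t +
      barnesPrincipal τ (b₀ + b₁) t - barnesPrincipal τ (q + b₀ + b₁) t +
      barnesPrincipal τ (b₀ + b₂) t - barnesPrincipal τ (q + b₀ + b₂) t +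
      barnesPrincipal τ (q + b₀ + b₁ + b₂) t - barnesPrincipal τ (b₀ + b₁ + b₂) t = 0 := by
      simp only [barnesPrincipal, barnesCoeff₁, barnesCoeff₂]
      ring
    have hK : (t : ℂ)⁻¹ * (barnesKernel τ (q + b₀) t - barnesKernel τ b₀ t +
      barnesKernel τ (b₀ + b₁) t - barnesKernel τ (q + b₀ + b₁) t +
      barnesKernel τ (b₀ + b₂) t - barnesKernel τ (q + b₀ + b₂) t +
      barnesKernel τ (q + b₀ + b₁ + b₂) t - barnesKernel τ (b₀ + b₁ + b₂) t) =
      (Complex.exp (-q * t) - 1) * barnesLevyDensity τ b₀ b₁ b₂ t := by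
      simp only [barnesKernel, barnesLevyDensity, neg_add, add_mul, Complex.exp_add]
      push_cast
      have n1' : 1 - Complex.exp (-(t : ℂ)) ≠ 0 := by simpa using n1
      simp only [neg_mul, one_mul] at n1' n2 ⊢
      field_simp
      ring
    rw [← hK]
    simp only [barnesRemainder]
    linear_combination (t : ℂ)⁻¹ * hP
  have hL : barnesEta₂₂ τ b₀ b₁ b₂ q = Complex.exp (
      barnesLogGamma₂ 1 τ (q + b₀) - barnesLogGamma₂ 1 τ b₀ +
      (barnesLogGamma₂ 1 τ (b₀ + b₁) - barnesLogGamma₂ 1 τ (q + b₀ + b₁)) +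
      (barnesLogGamma₂ 1 τ (b₀ + b₂) - barnesLogGamma₂ 1 τ (q + b₀ + b₂)) +
      (barnesLogGamma₂ 1 τ (q + b₀ + b₁ + b₂) - barnesLogGamma₂ 1 τ (b₀ + b₁ + b₂))) := by
    simp only [Complex.exp_add, Complex.exp_sub]
    rfl
  rw [hL, key, barnesLogGamma₂_eq hτ r1, barnesLogGamma₂_eq hτ r2, barnesLogGamma₂_eq hτ r3,
    barnesLogGamma₂_eq hτ r4, barnesLogGamma₂_eq hτ r5, barnesLogGamma₂_eq hτ r6,
    barnesLogGamma₂_eq hτ r7, barnesLogGamma₂_eq hτ r8]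
  congr 1
  simp only [barnesCoeff₁]
  ring

theorem exists_isBarnesBeta₂₂ {τ b₀ b₁ b₂ : ℝ} (hτ : 0 < τ) (h0 : 0 < b₀) (h1 : 0 ≤ b₁)
    (h2 : 0 ≤ b₂) : ∃ μ, IsBarnesBeta₂₂ τ b₀ b₁ b₂ μ := by
  obtain ⟨ν, hν, hneg, hmom⟩ := exists_law_of_levyDensity h0
    (fun c hc => integrableOn_mul_barnesLevyDensity hτ h1 h2 hc)
    (fun t ht => barnesLevyDensity_nonneg hτ h1 h2 ht)
  have hmeas : Measurable fun x : ℝ => Real.exp (-x) := by fun_prop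
  refine ⟨ν.map fun x => Real.exp (-x), Measure.isProbabilityMeasure_map hmeas.aemeasurable, ?_,
    fun q hq => ?_⟩
  · rw [Measure.map_apply hmeas measurableSet_Ioc.compl]
    convert hneg using 2
    ext x
    simp [Real.exp_pos]
  · have hpow : ∀ x : ℝ, ((Real.exp (-x) : ℝ) : ℂ) ^ q = Complex.exp (-q * x) := by
      intro x
      rw [Complex.cpow_def_of_ne_zero (by exact_mod_cast (Real.exp_pos _).ne'),
        ← Complex.ofReal_log (Real.exp_pos _).le, Real.log_exp]
      push_cast
      ring_nf
    have hm : Measurable fun x : ℝ => (x : ℂ) ^ q := by fun_prop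
    obtain ⟨hi, he⟩ := hmom q hq
    constructor
    · rw [integrable_map_measure hm.aestronglyMeasurable hmeas.aemeasurable]
      exact hi.congr (ae_of_all _ fun x => (hpow x).symm)
    · rw [integral_map hmeas.aemeasurable hm.aestronglyMeasurable, barnesEta₂₂_eq_exp hτ h0 h1 h2 hq,
        ← he]
      simp only [hpow]

/-! ### Mellin transforms of laws on `(0, ∞)` -/

theorem IsLawOnPos.ae_pos {μ : Measure ℝ} (h : IsLawOnPos μ) : ∀ᵐ x ∂μ, 0 < x := by
  rw [ae_iff]
  convert h.2 using 2
  ext x; simp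

theorem isLawOnPos_of_ae_pos {μ : Measure ℝ} [hμ : IsProbabilityMeasure μ]
    (h : ∀ᵐ x ∂μ, 0 < x) : IsLawOnPos μ := by
  refine ⟨hμ, ?_⟩
  rw [ae_iff] at h
  convert h using 2
  ext x; simp

theorem IsLawOnPos.map {μ : Measure ℝ} (h : IsLawOnPos μ) {f : ℝ → ℝ} (hf : Measurable f)
    (hpos : ∀ x, 0 < x → 0 < f x) : IsLawOnPos (μ.map f) := by
  have := h.1
  have : IsProbabilityMeasure (μ.map f) := Measure.isProbabilityMeasure_map hf.aemeasurable
  refine isLawOnPos_of_ae_pos ?_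
  rw [ae_map_iff hf.aemeasurable measurableSet_Ioi]
  filter_upwards [h.ae_pos] with x hx using hpos x hx

theorem IsLawOnPos.invLaw {μ : Measure ℝ} (h : IsLawOnPos μ) : IsLawOnPos (invLaw μ) :=
  h.map measurable_inv fun _ hx => inv_pos.2 hx

theorem ae_prod_pos {μ ν : Measure ℝ} (hμ : IsLawOnPos μ) (hν : IsLawOnPos ν) :
    ∀ᵐ p ∂(μ.prod ν), 0 < p.1 ∧ 0 < p.2 := by
  have := hμ.1
  have := hν.1
  have h1 := (Measure.quasiMeasurePreserving_fst (μ := μ) (ν := ν)).ae hμ.ae_pos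
  have h2 := (Measure.quasiMeasurePreserving_snd (μ := μ) (ν := ν)).ae hν.ae_pos
  filter_upwards [h1, h2] with x hx hy using ⟨hx, hy⟩

theorem IsLawOnPos.mconv {μ ν : Measure ℝ} (hμ : IsLawOnPos μ) (hν : IsLawOnPos ν) :
    IsLawOnPos (μ.mconv ν) := by
  have := hμ.1
  have := hν.1
  refine isLawOnPos_of_ae_pos ?_
  rw [Measure.mconv, ae_map_iff (by fun_prop) measurableSet_Ioi]
  filter_upwards [ae_prod_pos hμ hν] with p hp using mul_pos hp.1 hp.2

theorem measurable_ofReal_cpow (q : ℂ) : Measurable fun x : ℝ => (x : ℂ) ^ q := by fun_prop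

theorem HasComplexMoment.mconv {μ ν : Measure ℝ} (hμ : IsLawOnPos μ) (hν : IsLawOnPos ν)
    {q a b : ℂ} (ha : HasComplexMoment μ q a) (hb : HasComplexMoment ν q b) :
    HasComplexMoment (μ.mconv ν) q (a * b) := by
  have := hμ.1
  have := hν.1
  have hae : (fun p : ℝ × ℝ => (p.1 : ℂ) ^ q * (p.2 : ℂ) ^ q) =ᵐ[μ.prod ν]
      fun p => ((p.1 * p.2 : ℝ) : ℂ) ^ q := by
    filter_upwards [ae_prod_pos hμ hν] with p hp
    rw [Complex.ofReal_mul, Complex.mul_cpow_ofReal_nonneg hp.1.le hp.2.le]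
  constructor
  · rw [Measure.mconv, integrable_map_measure (measurable_ofReal_cpow q).aestronglyMeasurable
      (by fun_prop)]
    exact (ha.1.mul_prod hb.1).congr hae
  · rw [Measure.mconv, integral_map (by fun_prop) (measurable_ofReal_cpow q).aestronglyMeasurable,
      ← integral_congr_ae hae, integral_prod_mul (fun x : ℝ => (x : ℂ) ^ q)
      (fun x : ℝ => (x : ℂ) ^ q), ha.2, hb.2]

theorem HasComplexMoment.invLaw {μ : Measure ℝ} (hμ : IsLawOnPos μ) {q a : ℂ}
    (h : HasComplexMoment μ (-q) a) : HasComplexMoment (invLaw μ) q a := by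
  have hae : (fun x : ℝ => (x : ℂ) ^ (-q)) =ᵐ[μ] fun x => ((x⁻¹ : ℝ) : ℂ) ^ q := by
    filter_upwards [hμ.ae_pos] with x hx
    rw [Complex.ofReal_inv, Complex.inv_cpow, Complex.cpow_neg]
    rw [Complex.arg_ofReal_of_nonneg hx.le]
    exact Real.pi_pos.ne
  constructor
  · rw [_root_.invLaw, integrable_map_measure (measurable_ofReal_cpow q).aestronglyMeasurable
      measurable_inv.aemeasurable]
    exact h.1.congr hae
  · rw [_root_.invLaw, integral_map measurable_inv.aemeasurable
      (measurable_ofReal_cpow q).aestronglyMeasurable, ← integral_congr_ae hae, h.2]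

theorem HasComplexMoment.map_const_mul {μ : Measure ℝ} (hμ : IsLawOnPos μ) {q a : ℂ} {c : ℝ}
    (hc : 0 < c) (h : HasComplexMoment μ q a) :
    HasComplexMoment (μ.map fun x => c * x) q ((c : ℂ) ^ q * a) := by
  have hae : (fun x : ℝ => (c : ℂ) ^ q * (x : ℂ) ^ q) =ᵐ[μ] fun x => ((c * x : ℝ) : ℂ) ^ q := by
    filter_upwards [hμ.ae_pos] with x hx
    rw [Complex.ofReal_mul, Complex.mul_cpow_ofReal_nonneg hc.le hx.le]
  constructor
  · rw [integrable_map_measure (measurable_ofReal_cpow q).aestronglyMeasurable (by fun_prop)]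
    exact (h.1.const_mul _).congr hae
  · rw [integral_map (by fun_prop) (measurable_ofReal_cpow q).aestronglyMeasurable,
      ← integral_congr_ae hae, integral_const_mul, h.2]

theorem ofReal_exp_cpow (x : ℝ) (q : ℂ) : ((Real.exp x : ℝ) : ℂ) ^ q = Complex.exp (q * x) := by
  rw [Complex.cpow_def_of_ne_zero (by exact_mod_cast (Real.exp_pos _).ne'),
    ← Complex.ofReal_log (Real.exp_pos _).le, Real.log_exp, mul_comm]

theorem ofReal_cpow_eq_exp {x : ℝ} (hx : 0 < x) (q : ℂ) :
    (x : ℂ) ^ q = Complex.exp (q * Real.log x) := by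
  rw [← ofReal_exp_cpow, Real.exp_log hx]

theorem isLawOnPos_lognormalLaw (τ : ℝ) : IsLawOnPos (lognormalLaw τ) := by
  have : IsProbabilityMeasure (lognormalLaw τ) :=
    Measure.isProbabilityMeasure_map Real.measurable_exp.aemeasurable
  refine isLawOnPos_of_ae_pos ?_
  rw [lognormalLaw, ae_map_iff Real.measurable_exp.aemeasurable measurableSet_Ioi]
  exact ae_of_all _ fun x => Real.exp_pos x

theorem integrable_cexp_mul_gaussianReal (v : NNReal) (q : ℂ) :
    Integrable (fun x : ℝ => Complex.exp (q * x)) (gaussianReal 0 v) := by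
  have h := integrable_exp_mul_gaussianReal (μ := 0) (v := v) q.re
  refine h.mono (by fun_prop) (ae_of_all _ fun x => ?_)
  rw [Complex.norm_exp, Real.norm_of_nonneg (Real.exp_nonneg _)]
  simp

theorem integral_cexp_mul_gaussianReal (v : NNReal) (q : ℂ) :
    ∫ x : ℝ, Complex.exp (q * x) ∂(gaussianReal 0 v) = Complex.exp (v * q ^ 2 / 2) := by
  have h := complexMGF_id_gaussianReal (μ := 0) (v := v) q
  simpa [complexMGF] using h

theorem hasComplexMoment_lognormalLaw {τ : ℝ} (hτ : 0 < τ) (q : ℂ) :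
    HasComplexMoment (lognormalLaw τ) q (Complex.exp (2 * Real.log 2 / τ * q ^ 2)) := by
  constructor
  · rw [lognormalLaw, integrable_map_measure (measurable_ofReal_cpow q).aestronglyMeasurable
      Real.measurable_exp.aemeasurable]
    exact (integrable_cexp_mul_gaussianReal _ q).congr
      (ae_of_all _ fun x => (ofReal_exp_cpow x q).symm)
  · rw [lognormalLaw, integral_map Real.measurable_exp.aemeasurable
      (measurable_ofReal_cpow q).aestronglyMeasurable]
    simp only [ofReal_exp_cpow]
    rw [integral_cexp_mul_gaussianReal]
    have : (0 : ℝ) ≤ 4 * Real.log 2 / τ := by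
      have := Real.log_nonneg one_le_two
      positivity
    have h : (((4 * Real.log 2 / τ).toNNReal : ℝ) : ℂ) = 4 * Real.log 2 / τ := by
      rw [Real.coe_toNNReal _ this]; push_cast; rfl
    rw [h]
    congr 1
    ring

/-- The substitution `t = y^{-τ}` turns the integral into Euler's integral for `Γ`. At `q = 0` it
also gives the total mass. -/
theorem hasComplexMoment_frechetLaw {τ : ℝ} (hτ : 0 < τ) {q : ℂ} (hq : q.re < τ) :
    HasComplexMoment (frechetLaw τ) q (Complex.Gamma (1 - q / τ)) := by
  have hτ' : (τ : ℂ) ≠ 0 := by exact_mod_cast hτ.ne'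
  have hs : (q - τ) / ((-τ : ℝ) : ℂ) = 1 - q / τ := by
    push_cast
    field_simp
    ring
  have hre : 0 < (1 - q / (τ : ℂ)).re := by
    rw [Complex.sub_re, Complex.div_ofReal_re, Complex.one_re, sub_pos, div_lt_one hτ]
    exact hq
  have hG := hasMellin_cexp_neg hre
  have h1 : MellinConvergent (fun t : ℝ => Complex.exp (-((t ^ (-τ) : ℝ) : ℂ))) (q - τ) := by
    have := (MellinConvergent.comp_rpow (f := fun t : ℝ => Complex.exp (-(t : ℂ)))
      (s := q - τ) (a := -τ) (by linarith)).2 (by rw [hs]; exact hG.1)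
    exact this
  have h2 : mellin (fun t : ℝ => Complex.exp (-((t ^ (-τ) : ℝ) : ℂ))) (q - τ) =
      τ⁻¹ * Complex.Gamma (1 - q / τ) := by
    have := mellin_comp_rpow (fun t : ℝ => Complex.exp (-(t : ℂ))) (q - τ) (-τ)
    rw [this, hs, hG.2, abs_neg, abs_of_pos hτ, Complex.real_smul]
  have hmeas : Measurable fun y : ℝ => ENNReal.ofReal (τ * y ^ (-1 - τ) * Real.exp (-y ^ (-τ))) := by
    fun_prop
  have hEq : EqOn (fun y : ℝ => (τ : ℂ) * ((y : ℂ) ^ (q - τ - 1) •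
      Complex.exp (-((y ^ (-τ) : ℝ) : ℂ))))
      (fun y : ℝ => (ENNReal.ofReal (τ * y ^ (-1 - τ) * Real.exp (-y ^ (-τ)))).toReal •
        (y : ℂ) ^ q) (Ioi 0) := by
    intro y (hy : 0 < y)
    have hy' : (y : ℂ) ≠ 0 := by exact_mod_cast hy.ne'
    simp only
    rw [ENNReal.toReal_ofReal (by positivity), Complex.real_smul, smul_eq_mul]
    push_cast
    rw [Complex.ofReal_cpow hy.le (-1 - τ), show q - τ - 1 = ((-1 - τ : ℝ) : ℂ) + q by
      push_cast; ring, Complex.cpow_add _ _ hy']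
    ring
  constructor
  · rw [frechetLaw, integrable_withDensity_iff_integrable_smul' hmeas (by simp)]
    have := h1.const_mul (τ : ℂ)
    exact IntegrableOn.congr_fun this hEq measurableSet_Ioi
  · rw [frechetLaw, integral_withDensity_eq_integral_toReal_smul hmeas (by simp),
      ← setIntegral_congr_fun measurableSet_Ioi hEq, integral_const_mul]
    change (τ : ℂ) * mellin _ (q - τ) = _
    rw [h2]
    push_cast
    field_simp

theorem isLawOnPos_frechetLaw {τ : ℝ} (hτ : 0 < τ) : IsLawOnPos (frechetLaw τ) := by
  have h := hasComplexMoment_frechetLaw hτ (q := 0) (by simpa using hτ)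
  have hae : ∀ᵐ x ∂(frechetLaw τ), 0 < x :=
    (withDensity_absolutelyContinuous _ _).ae_le (ae_restrict_mem measurableSet_Ioi)
  have hfin : IsFiniteMeasure (frechetLaw τ) := by
    have := h.1
    simp only [Complex.cpow_zero] at this
    exact (integrable_const_iff_isFiniteMeasure (one_ne_zero)).1 this
  have : IsProbabilityMeasure (frechetLaw τ) := by
    have h2 := h.2
    simp only [Complex.cpow_zero, integral_const, zero_div, sub_zero, Complex.Gamma_one] at h2
    refine ⟨?_⟩
    have h3 : (frechetLaw τ).real univ = 1 := by
      have : (((frechetLaw τ).real univ : ℝ) : ℂ) = 1 := by simpa using h2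
      exact_mod_cast this
    rw [Measure.real, ENNReal.toReal_eq_one_iff] at h3
    exact h3
  exact isLawOnPos_of_ae_pos hae

theorem IsBarnesBeta₂₂.isLawOnPos {τ b₀ b₁ b₂ : ℝ} {μ : Measure ℝ}
    (h : IsBarnesBeta₂₂ τ b₀ b₁ b₂ μ) : IsLawOnPos μ :=
  ⟨h.1, measure_mono_null (fun x hx => by
    simp only [mem_Iic, mem_compl_iff, mem_Ioc, not_and] at hx ⊢
    intro h; linarith) h.2.1⟩

/-! ### Factorization of the Mellin transform -/

theorem doubleGamma_two_mul {τ : ℝ} (hτ : 0 < τ) {w : ℂ} (hw : 0 < w.re) :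
    doubleGamma τ (2 * w) = Complex.exp (-Real.log 2 * (1 / (2 * τ) - barnesCoeff₁ τ (2 * w) +
      barnesCoeff₂ τ (2 * w))) * (doubleGamma τ w * doubleGamma τ (w + 1 / 2) *
      doubleGamma τ (w + τ / 2) * doubleGamma τ (w + (1 + τ) / 2)) := by
  simp only [doubleGamma, barnesGamma₂]
  rw [barnesLogGamma₂_two_mul hτ hw, Complex.exp_add, Complex.exp_add, Complex.exp_add,
    Complex.exp_add]

/-- In either order of `x₁`, `x₂`, the middle parameters are the midpoint and the last is the
maximum, so the result is symmetric. -/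
theorem barnesEta₂₂_min (τ x₁ x₂ : ℝ) (p : ℂ) :
    barnesEta₂₂ τ (min x₁ x₂) (|x₂ - x₁| / 2) (|x₂ - x₁| / 2) p =
      doubleGamma τ (p + x₁) / doubleGamma τ x₁ * (doubleGamma τ (p + x₂) / doubleGamma τ x₂) *
      (doubleGamma τ ((x₁ + x₂) / 2) / doubleGamma τ (p + (x₁ + x₂) / 2)) ^ 2 := by
  have hG := doubleGamma_ne_zero τ
  rcases le_total x₁ x₂ with h | h
  · rw [min_eq_left h, abs_of_nonneg (sub_nonneg.2 h)]
    simp only [barnesEta₂₂]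
    push_cast
    rw [show p + (x₁ : ℂ) + (x₂ - x₁) / 2 = p + (x₁ + x₂) / 2 by ring,
      show (x₁ : ℂ) + (x₂ - x₁) / 2 = (x₁ + x₂) / 2 by ring,
      show p + ((x₁ : ℂ) + x₂) / 2 + (x₂ - x₁) / 2 = p + x₂ by ring,
      show ((x₁ : ℂ) + x₂) / 2 + (x₂ - x₁) / 2 = x₂ by ring]
    ring
  · rw [min_eq_right h, abs_of_nonpos (sub_nonpos.2 h)]
    simp only [barnesEta₂₂]
    push_cast
    rw [show p + (x₂ : ℂ) + -(x₂ - x₁) / 2 = p + (x₁ + x₂) / 2 by ring,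
      show (x₂ : ℂ) + -(x₂ - x₁) / 2 = (x₁ + x₂) / 2 by ring,
      show p + ((x₁ : ℂ) + x₂) / 2 + -(x₂ - x₁) / 2 = p + x₁ by ring,
      show ((x₁ : ℂ) + x₂) / 2 + -(x₂ - x₁) / 2 = x₁ by ring]
    ring

theorem selbergConst_pos {τ : ℝ} (hτ : 1 < τ) (lam₁ lam₂ : ℝ) : 0 < selbergConst τ lam₁ lam₂ := by
  have h1 : 0 < 1 - 1 / τ := by
    rw [sub_pos, div_lt_one (by linarith)]; exact hτ
  have := Real.Gamma_pos_of_pos h1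
  have := Real.pi_pos
  unfold selbergConst
  positivity

theorem log_selbergConst {τ : ℝ} (hτ : 1 < τ) (lam₁ lam₂ : ℝ) :
    Real.log (selbergConst τ lam₁ lam₂) = Real.log (2 * Real.pi) -
      (3 * (1 + τ) + 2 * τ * (lam₁ + lam₂)) / τ * Real.log 2 -
      Real.log (Real.Gamma (1 - 1 / τ)) := by
  have h1 : 0 < 1 - 1 / τ := by
    rw [sub_pos, div_lt_one (by linarith)]; exact hτ
  have h2 := Real.Gamma_pos_of_pos h1
  have h3 := Real.pi_pos
  unfold selbergConst
  rw [Real.log_div (by positivity) h2.ne', Real.log_mul (by positivity) (by positivity),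
    Real.log_rpow two_pos]
  ring

/-- Write `m = (x₁+x₂)/2`. In the product of the three beta transforms the denominators reduce to
`Γ₂` at `m-q`, `m-q+1/2`, `m-q+τ/2` and `m-q+(1+τ)/2`, which duplication assembles into `Γ₂(2m-2q)`.
The Fréchet factor `Γ(1-q/τ)` lowers `Γ₂(1+τ-q)` to `Γ₂(τ-q)` by the shift. -/
theorem selbergMellin_eq {τ lam₁ lam₂ : ℝ} (hτ : 1 < τ) (h₁ : -1 / τ < lam₁)
    (h₂ : -1 / τ < lam₂) {x₁ x₂ : ℝ} (hx₁ : x₁ = 1 + τ * (1 + lam₁))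
    (hx₂ : x₂ = 1 + τ * (1 + lam₂)) {q : ℂ} (hq : q.re < τ) :
    selbergMellin τ lam₁ lam₂ q = (selbergConst τ lam₁ lam₂ : ℂ) ^ q *
      (Complex.exp (2 * Real.log 2 / τ * q ^ 2) *
      (barnesEta₂₂ τ (min x₁ x₂) (|x₂ - x₁| / 2) (|x₂ - x₁| / 2) (-q) *
      (barnesEta₂₂ τ ((x₁ + x₂) / 2) (1 / 2) (τ / 2) (-q) *
      (barnesEta₂₂ τ (1 + τ) ((x₁ + x₂ - 1 - τ) / 2) ((x₁ + x₂ - 1 - τ) / 2) (-q) *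
      Complex.Gamma (1 - q / τ))))) := by
  have hτ0 : 0 < τ := by linarith
  have hτ' : (τ : ℂ) ≠ 0 := by exact_mod_cast hτ0.ne'
  have hl1 : -1 < τ * lam₁ := by
    rw [div_lt_iff₀ hτ0] at h₁; linarith
  have hl2 : -1 < τ * lam₂ := by
    rw [div_lt_iff₀ hτ0] at h₂; linarith
  have hG := doubleGamma_ne_zero τ
  have hΓ : 0 < Real.Gamma (1 - 1 / τ) := Real.Gamma_pos_of_pos (by
    rw [sub_pos, div_lt_one hτ0]; exact hτ)
  have hX : 0 < (((x₁ : ℂ) + x₂) / 2).re := by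
    rw [show ((x₁ : ℂ) + x₂) / 2 = (((x₁ + x₂) / 2 : ℝ) : ℂ) by push_cast; rfl, Complex.ofReal_re,
      hx₁, hx₂]
    linarith
  have hXq : 0 < (-q + ((x₁ : ℂ) + x₂) / 2).re := by
    rw [show ((x₁ : ℂ) + x₂) / 2 = (((x₁ + x₂) / 2 : ℝ) : ℂ) by push_cast; rfl, Complex.add_re,
      Complex.ofReal_re, hx₁, hx₂, Complex.neg_re]
    linarith
  have dX := doubleGamma_two_mul hτ0 hX
  have dXq := doubleGamma_two_mul hτ0 hXq
  have sτ := doubleGamma_div_add_one hτ0 (w := τ) (by simpa using hτ0)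
  have sτq := doubleGamma_div_add_one hτ0 (w := -q + τ) (by simp; linarith)
  rw [div_self hτ', Complex.Gamma_one, one_mul, div_eq_iff (hG _)] at sτ
  rw [div_eq_iff (hG _), show (-q + (τ : ℂ)) / τ = 1 - q / τ by field_simp; ring] at sτq
  -- Balance of the elementary factors. The exponent in the duplication formula is quadratic in `q`:
  -- its `q²` term forces the lognormal factor, while the terms linear in `q` fix the constant
  -- `selbergConst`.
  have hT : (τ : ℂ) ^ (q / τ) * ((2 * Real.pi : ℝ) : ℂ) ^ q * (Real.Gamma (1 - 1 / τ) : ℂ) ^ (-q) *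
      Complex.exp ((1 - q / τ - 1 / 2) * Real.log τ - Real.log (2 * Real.pi) / 2) *
      Complex.exp (-Real.log 2 * (1 / (2 * τ) - barnesCoeff₁ τ (2 * (((x₁ : ℂ) + x₂) / 2)) +
      barnesCoeff₂ τ (2 * (((x₁ : ℂ) + x₂) / 2)))) =
      (selbergConst τ lam₁ lam₂ : ℂ) ^ q * Complex.exp (2 * Real.log 2 / τ * q ^ 2) *
      Complex.exp ((1 - 1 / 2) * Real.log τ - Real.log (2 * Real.pi) / 2) *
      Complex.exp (-Real.log 2 * (1 / (2 * τ) - barnesCoeff₁ τ (2 * (-q + ((x₁ : ℂ) + x₂) / 2)) +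
      barnesCoeff₂ τ (2 * (-q + ((x₁ : ℂ) + x₂) / 2)))) := by
    rw [ofReal_cpow_eq_exp hτ0, ofReal_cpow_eq_exp (by positivity), ofReal_cpow_eq_exp hΓ,
      ofReal_cpow_eq_exp (selbergConst_pos hτ _ _), log_selbergConst hτ]
    simp only [← Complex.exp_add]
    congr 1
    rw [hx₁, hx₂]
    simp only [barnesCoeff₁, barnesCoeff₂]
    push_cast
    field_simp
    ring
  rw [barnesEta₂₂_min]
  simp only [selbergMellin, barnesEta₂₂]
  rw [show 1 - q + (τ : ℂ) * (1 + lam₁) = -q + x₁ by rw [hx₁]; push_cast; ring,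
    show 1 - q + (τ : ℂ) * (1 + lam₂) = -q + x₂ by rw [hx₂]; push_cast; ring,
    show 1 + (τ : ℂ) * (1 + lam₁) = x₁ by rw [hx₁]; push_cast; ring,
    show 1 + (τ : ℂ) * (1 + lam₂) = x₂ by rw [hx₂]; push_cast; ring,
    show 2 - q + (τ : ℂ) * (2 + lam₁ + lam₂) = -q + (x₁ + x₂) by rw [hx₁, hx₂]; push_cast; ring,
    show 2 - 2 * q + (τ : ℂ) * (2 + lam₁ + lam₂) = 2 * (-q + (x₁ + x₂) / 2) by
      rw [hx₁, hx₂]; push_cast; ring]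
  push_cast
  rw [show -q + ((x₁ : ℂ) + x₂) / 2 + 1 / 2 + τ / 2 = -q + (x₁ + x₂) / 2 + (1 + τ) / 2 by ring,
    show ((x₁ : ℂ) + x₂) / 2 + 1 / 2 + τ / 2 = (x₁ + x₂) / 2 + (1 + τ) / 2 by ring,
    show -q + (1 + (τ : ℂ)) + ((x₁ : ℂ) + x₂ - 1 - τ) / 2 + ((x₁ : ℂ) + x₂ - 1 - τ) / 2 =
      -q + (x₁ + x₂) by ring,
    show (1 + (τ : ℂ)) + ((x₁ : ℂ) + x₂ - 1 - τ) / 2 + ((x₁ : ℂ) + x₂ - 1 - τ) / 2 =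
      2 * ((x₁ + x₂) / 2) by ring,
    show -q + (1 + (τ : ℂ)) + ((x₁ : ℂ) + x₂ - 1 - τ) / 2 = -q + (x₁ + x₂) / 2 + (1 + τ) / 2 by
      ring,
    show (1 + (τ : ℂ)) + ((x₁ : ℂ) + x₂ - 1 - τ) / 2 = (x₁ + x₂) / 2 + (1 + τ) / 2 by ring,
    show -q + (1 + (τ : ℂ)) = -q + τ + 1 by ring, show (1 + (τ : ℂ)) = τ + 1 by ring]
  rw [show (1 + (τ : ℂ)) = τ + 1 by ring] at dX dXq
  push_cast at hT
  rw [dX, dXq, sτ, sτq]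
  have e1 := Complex.exp_ne_zero ((1 - 1 / 2) * (Real.log τ : ℂ) - Real.log (2 * Real.pi) / 2)
  have e2 := Complex.exp_ne_zero (-(Real.log 2 : ℂ) * (1 / (2 * τ) -
    barnesCoeff₁ τ (2 * (((x₁ : ℂ) + x₂) / 2)) + barnesCoeff₂ τ (2 * (((x₁ : ℂ) + x₂) / 2))))
  have e3 := Complex.exp_ne_zero (-(Real.log 2 : ℂ) * (1 / (2 * τ) -
    barnesCoeff₁ τ (2 * (-q + ((x₁ : ℂ) + x₂) / 2)) +
    barnesCoeff₂ τ (2 * (-q + ((x₁ : ℂ) + x₂) / 2))))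
  have e4 := Complex.exp_ne_zero ((1 - q / τ - 1 / 2) * (Real.log τ : ℂ) -
    Real.log (2 * Real.pi) / 2)
  generalize Complex.exp ((1 - 1 / 2) * (Real.log τ : ℂ) - Real.log (2 * Real.pi) / 2) = A at *
  generalize Complex.exp (-(Real.log 2 : ℂ) * (1 / (2 * τ) -
    barnesCoeff₁ τ (2 * (((x₁ : ℂ) + x₂) / 2)) +
    barnesCoeff₂ τ (2 * (((x₁ : ℂ) + x₂) / 2)))) = B at *
  generalize Complex.exp (-(Real.log 2 : ℂ) * (1 / (2 * τ) -
    barnesCoeff₁ τ (2 * (-q + ((x₁ : ℂ) + x₂) / 2)) +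
    barnesCoeff₂ τ (2 * (-q + ((x₁ : ℂ) + x₂) / 2)))) = C at *
  generalize Complex.exp ((1 - q / τ - 1 / 2) * (Real.log τ : ℂ) - Real.log (2 * Real.pi) / 2) =
    D at *
  generalize (selbergConst τ lam₁ lam₂ : ℂ) ^ q = c at *
  generalize (τ : ℂ) ^ (q / τ) * (2 * (Real.pi : ℂ)) ^ q * (Real.Gamma (1 - 1 / τ) : ℂ) ^ (-q) =
    T at *
  have f1 := hG x₁
  have f2 := hG x₂
  have f3 := hG (-q + (x₁ + x₂) / 2)
  have f4 := hG (-q + (x₁ + x₂) / 2 + 1 / 2)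
  have f5 := hG (-q + (x₁ + x₂) / 2 + τ / 2)
  have f6 := hG (-q + (x₁ + x₂) / 2 + (τ + 1) / 2)
  have f7 := hG ((x₁ + x₂) / 2)
  have f8 := hG ((x₁ + x₂) / 2 + 1 / 2)
  have f9 := hG ((x₁ + x₂) / 2 + τ / 2)
  have f10 := hG ((x₁ + x₂) / 2 + (τ + 1) / 2)
  have f11 := hG (τ + 1)
  generalize doubleGamma τ x₁ = g1 at *
  generalize doubleGamma τ x₂ = g2 at *
  generalize doubleGamma τ (-q + (x₁ + x₂) / 2) = g3 at *
  generalize doubleGamma τ (-q + (x₁ + x₂) / 2 + 1 / 2) = g4 at *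
  generalize doubleGamma τ (-q + (x₁ + x₂) / 2 + τ / 2) = g5 at *
  generalize doubleGamma τ (-q + (x₁ + x₂) / 2 + (τ + 1) / 2) = g6 at *
  generalize doubleGamma τ ((x₁ + x₂) / 2) = g7 at *
  generalize doubleGamma τ ((x₁ + x₂) / 2 + 1 / 2) = g8 at *
  generalize doubleGamma τ ((x₁ + x₂) / 2 + τ / 2) = g9 at *
  generalize doubleGamma τ ((x₁ + x₂) / 2 + (τ + 1) / 2) = g10 at *
  generalize doubleGamma τ (τ + 1) = g11 at *
  have hT' : T = c * Complex.exp (2 * Real.log 2 / τ * q ^ 2) * A * C / (D * B) := by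
    rw [eq_div_iff (mul_ne_zero e4 e2)]
    linear_combination hT
  rw [hT']
  field_simp

/-! ### Existence and uniqueness -/

theorem charFun_map_log {M : Measure ℝ} (hM : IsLawOnPos M) (u : ℝ) :
    charFun (M.map Real.log) u = ∫ x : ℝ, (x : ℂ) ^ (u * Complex.I) ∂M := by
  rw [charFun_apply_real, integral_map Real.measurable_log.aemeasurable (by fun_prop)]
  refine integral_congr_ae ?_
  filter_upwards [hM.ae_pos] with x hx
  rw [ofReal_cpow_eq_exp hx]
  ring_nf

theorem IsLawOnPos.map_exp_map_log {M : Measure ℝ} (hM : IsLawOnPos M) :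
    (M.map Real.log).map Real.exp = M := by
  rw [Measure.map_map Real.measurable_exp Real.measurable_log]
  conv_rhs => rw [← Measure.map_id (μ := M)]
  refine Measure.map_congr ?_
  filter_upwards [hM.ae_pos] with x hx
  simp [Real.exp_log hx]

theorem IsLawOnPos.ext_of_charFun_log {M M' : Measure ℝ} (hM : IsLawOnPos M) (hM' : IsLawOnPos M')
    (h : ∀ u, charFun (M.map Real.log) u = charFun (M'.map Real.log) u) : M = M' := by
  have := hM.1
  have := hM'.1
  have : IsProbabilityMeasure (M.map Real.log) :=
    Measure.isProbabilityMeasure_map Real.measurable_log.aemeasurable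
  have : IsProbabilityMeasure (M'.map Real.log) :=
    Measure.isProbabilityMeasure_map Real.measurable_log.aemeasurable
  rw [← hM.map_exp_map_log, ← hM'.map_exp_map_log, Measure.ext_of_charFun (funext h)]

theorem IsSelbergLaw.charFun_map_log {τ lam₁ lam₂ : ℝ} {M : Measure ℝ} (hτ : 0 < τ)
    (hM : IsSelbergLaw τ lam₁ lam₂ M) (u : ℝ) :
    charFun (M.map Real.log) u = selbergMellin τ lam₁ lam₂ (u * Complex.I) := by
  rw [_root_.charFun_map_log hM.1, (hM.2 _ (by simpa using hτ)).2]

theorem IsSelbergLaw.unique {τ lam₁ lam₂ : ℝ} {M M' : Measure ℝ} (hτ : 0 < τ)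
    (hM : IsSelbergLaw τ lam₁ lam₂ M) (hM' : IsSelbergLaw τ lam₁ lam₂ M') : M = M' :=
  hM.1.ext_of_charFun_log hM'.1 fun u => by
    rw [hM.charFun_map_log hτ, hM'.charFun_map_log hτ]

theorem isSelbergLaw_map_mconv {τ lam₁ lam₂ : ℝ} (hτ : 1 < τ) (h₁ : -1 / τ < lam₁)
    (h₂ : -1 / τ < lam₂) {x₁ x₂ : ℝ} (hx₁ : x₁ = 1 + τ * (1 + lam₁))
    (hx₂ : x₂ = 1 + τ * (1 + lam₂)) {B₁ B₂ B₃ : Measure ℝ}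
    (hB₁ : IsBarnesBeta₂₂ τ (min x₁ x₂) (|x₂ - x₁| / 2) (|x₂ - x₁| / 2) B₁)
    (hB₂ : IsBarnesBeta₂₂ τ ((x₁ + x₂) / 2) (1 / 2) (τ / 2) B₂)
    (hB₃ : IsBarnesBeta₂₂ τ (1 + τ) ((x₁ + x₂ - 1 - τ) / 2) ((x₁ + x₂ - 1 - τ) / 2) B₃) :
    IsSelbergLaw τ lam₁ lam₂
      ((Measure.mconv (lognormalLaw τ) (Measure.mconv (invLaw B₁)
        (Measure.mconv (invLaw B₂) (Measure.mconv (invLaw B₃) (frechetLaw τ))))).map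
        (fun y => selbergConst τ lam₁ lam₂ * y)) := by
  have hτ0 : 0 < τ := by linarith
  have hl1 : -1 < τ * lam₁ := by
    rw [div_lt_iff₀ hτ0] at h₁; linarith
  have hl2 : -1 < τ * lam₂ := by
    rw [div_lt_iff₀ hτ0] at h₂; linarith
  have hc := selbergConst_pos hτ lam₁ lam₂
  have p0 := isLawOnPos_lognormalLaw τ
  have p1 := hB₁.isLawOnPos.invLaw
  have p2 := hB₂.isLawOnPos.invLaw
  have p3 := hB₃.isLawOnPos.invLaw
  have p4 := isLawOnPos_frechetLaw hτ0
  have p34 := p3.mconv p4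
  have p234 := p2.mconv p34
  have p1234 := p1.mconv p234
  refine ⟨(p0.mconv p1234).map (by fun_prop) fun x hx => mul_pos hc hx, fun q hq => ?_⟩
  rw [selbergMellin_eq hτ h₁ h₂ hx₁ hx₂ hq]
  -- `λᵢ > -1/τ` means `xᵢ > τ`, so every beta moment exists for `Re q < τ`; the bound on `q` comes
  -- from the Fréchet factor.
  have hb1 : -(min x₁ x₂) < (-q).re := by
    rw [Complex.neg_re, neg_lt_neg_iff]
    refine hq.trans (lt_min ?_ ?_)
    · rw [hx₁]; linarith
    · rw [hx₂]; linarith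
  have hb2 : -((x₁ + x₂) / 2) < (-q).re := by
    rw [Complex.neg_re, neg_lt_neg_iff, hx₁, hx₂]
    linarith
  have hb3 : -(1 + τ) < (-q).re := by
    rw [Complex.neg_re, neg_lt_neg_iff]
    linarith
  have m0 := hasComplexMoment_lognormalLaw hτ0 q
  have m1 := (hB₁.2.2 _ hb1).invLaw hB₁.isLawOnPos
  have m2 := (hB₂.2.2 _ hb2).invLaw hB₂.isLawOnPos
  have m3 := (hB₃.2.2 _ hb3).invLaw hB₃.isLawOnPos
  have m4 := hasComplexMoment_frechetLaw hτ0 hq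
  exact (m0.mconv p0 p1234 (m1.mconv p1 p234 (m2.mconv p2 p34 (m3.mconv p3 p4 m4)))).map_const_mul
    (p0.mconv p1234) hc

theorem exists_barnesBeta_triple {τ lam₁ lam₂ : ℝ} (hτ : 1 < τ) (h₁ : -1 / τ < lam₁)
    (h₂ : -1 / τ < lam₂) {x₁ x₂ : ℝ} (hx₁ : x₁ = 1 + τ * (1 + lam₁))
    (hx₂ : x₂ = 1 + τ * (1 + lam₂)) : ∃ B₁ B₂ B₃ : Measure ℝ,
      IsBarnesBeta₂₂ τ (min x₁ x₂) (|x₂ - x₁| / 2) (|x₂ - x₁| / 2) B₁ ∧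
      IsBarnesBeta₂₂ τ ((x₁ + x₂) / 2) (1 / 2) (τ / 2) B₂ ∧
      IsBarnesBeta₂₂ τ (1 + τ) ((x₁ + x₂ - 1 - τ) / 2) ((x₁ + x₂ - 1 - τ) / 2) B₃ := by
  have hτ0 : 0 < τ := by linarith
  have hl1 : -1 < τ * lam₁ := by
    rw [div_lt_iff₀ hτ0] at h₁; linarith
  have hl2 : -1 < τ * lam₂ := by
    rw [div_lt_iff₀ hτ0] at h₂; linarith
  have g1 : τ < x₁ := by rw [hx₁]; linarith
  have g2 : τ < x₂ := by rw [hx₂]; linarith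
  obtain ⟨B₁, hB₁⟩ := exists_isBarnesBeta₂₂ hτ0 (b₀ := min x₁ x₂) (b₁ := |x₂ - x₁| / 2)
    (b₂ := |x₂ - x₁| / 2) (lt_min (by linarith) (by linarith)) (by positivity) (by positivity)
  obtain ⟨B₂, hB₂⟩ := exists_isBarnesBeta₂₂ hτ0 (b₀ := (x₁ + x₂) / 2) (b₁ := 1 / 2)
    (b₂ := τ / 2) (by linarith) (by positivity) (by positivity)
  obtain ⟨B₃, hB₃⟩ := exists_isBarnesBeta₂₂ hτ0 (b₀ := 1 + τ) (b₁ := (x₁ + x₂ - 1 - τ) / 2)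
    (b₂ := (x₁ + x₂ - 1 - τ) / 2) (by linarith) (by linarith) (by linarith)
  exact ⟨B₁, B₂, B₃, hB₁, hB₂, hB₃⟩

/-! ### Integer moments -/

noncomputable def barnesShift (τ : ℝ) (w : ℂ) : ℂ := Complex.Gamma (w / τ) *
  Complex.exp ((w / τ - 1 / 2) * Real.log τ - Real.log (2 * Real.pi) / 2)

theorem doubleGamma_div_add_nat {τ : ℝ} (hτ : 0 < τ) {w v : ℂ} (hw : 0 < w.re) (n : ℕ)
    (hv : v = w + n) :
    doubleGamma τ w / doubleGamma τ v = ∏ k ∈ Finset.range n, barnesShift τ (w + k) := by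
  have hG := doubleGamma_ne_zero τ
  induction n generalizing v with
  | zero => simp [hv, div_self (hG w)]
  | succ n ih =>
    have h1 : 0 < (w + n).re := by
      simp only [Complex.add_re, Complex.natCast_re]; positivity
    have h := doubleGamma_div_add_one hτ h1
    rw [Finset.prod_range_succ, ← ih rfl, barnesShift, ← h, div_mul_div_cancel₀ (hG _), hv]
    push_cast
    rw [add_assoc]

/-- The same telescoping read downwards from the larger argument, matching the order of factors in
Selberg's product. -/
theorem doubleGamma_div_add_nat' {τ : ℝ} (hτ : 0 < τ) {w v : ℂ} (hw : 0 < w.re) (n : ℕ)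
    (hv : v = w + n) :
    doubleGamma τ w / doubleGamma τ v = ∏ k ∈ Finset.range n, barnesShift τ (v - 1 - k) := by
  rw [doubleGamma_div_add_nat hτ hw n hv, ← Finset.prod_range_reflect]
  refine Finset.prod_congr rfl fun k hk => ?_
  have hk' : k + 1 ≤ n := Finset.mem_range.1 hk
  rw [hv, Nat.sub_sub, add_comm 1 k, Nat.cast_sub hk']
  push_cast
  ring_nf

theorem prod_exp_arith (a b : ℂ) (n : ℕ) :
    ∏ k ∈ Finset.range n, Complex.exp (a + b * k) =
      Complex.exp (n * a + b * (n * (n - 1) / 2)) := by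
  induction n with
  | zero => simp
  | succ n ih =>
    rw [Finset.prod_range_succ, ih, ← Complex.exp_add]
    push_cast
    ring_nf

/-- All four ratios telescope in exactly `l` unit shifts: three step `l` down from their values at
`q = 0`, and the last pair is `l` apart because of the `2q`. The gamma values are Selberg's factors.
-/
theorem selbergMellin_natCast {τ lam₁ lam₂ : ℝ} (hτ : 1 < τ) (h₁ : -1 / τ < lam₁)
    (h₂ : -1 / τ < lam₂) {l : ℕ} (hl : (l : ℝ) < τ) :
    selbergMellin τ lam₁ lam₂ l = selbergPosMoment τ lam₁ lam₂ l := by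
  have hτ0 : 0 < τ := by linarith
  have hτ' : (τ : ℂ) ≠ 0 := by exact_mod_cast hτ0.ne'
  have hl1 : -1 < τ * lam₁ := by
    rw [div_lt_iff₀ hτ0] at h₁; linarith
  have hl2 : -1 < τ * lam₂ := by
    rw [div_lt_iff₀ hτ0] at h₂; linarith
  have hΓ : 0 < Real.Gamma (1 - 1 / τ) := Real.Gamma_pos_of_pos (by
    rw [sub_pos, div_lt_one hτ0]; exact hτ)
  have d1 := doubleGamma_div_add_nat' hτ0 (w := 1 - l + τ * (1 + lam₁))
    (v := 1 + τ * (1 + lam₁)) (by simp; linarith) l (by ring)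
  have d2 := doubleGamma_div_add_nat' hτ0 (w := 1 - l + τ * (1 + lam₂))
    (v := 1 + τ * (1 + lam₂)) (by simp; linarith) l (by ring)
  have d3 := doubleGamma_div_add_nat' hτ0 (w := -l + τ) (v := τ) (by simp; linarith) l (by ring)
  have d4 := doubleGamma_div_add_nat' hτ0 (w := 2 - 2 * l + τ * (2 + lam₁ + lam₂))
    (v := 2 - l + τ * (2 + lam₁ + lam₂)) (by simp; linarith) l (by ring)
  have hprod : ∏ k ∈ Finset.range l, (barnesShift τ (1 + τ * (1 + lam₁) - 1 - k) *
      barnesShift τ (1 + τ * (1 + lam₂) - 1 - k) * barnesShift τ (τ - 1 - k) /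
      barnesShift τ (2 - l + τ * (2 + lam₁ + lam₂) - 1 - k)) =
      (∏ k ∈ Finset.range l, Complex.Gamma (1 - (k + 1) / τ) * (Complex.Gamma (1 + lam₁ - k / τ) *
        Complex.Gamma (1 + lam₂ - k / τ) / Complex.Gamma (2 + lam₁ + lam₂ - (l + k - 1) / τ))) *
      ∏ k ∈ Finset.range l, Complex.exp (((l - 2) / τ * Real.log τ - Real.log (2 * Real.pi)) +
        (-2 * Real.log τ / τ) * k) := by
    rw [← Finset.prod_mul_distrib]
    refine Finset.prod_congr rfl fun k _ => ?_
    simp only [barnesShift]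
    rw [show (1 + (τ : ℂ) * (1 + lam₁) - 1 - k) / τ = 1 + lam₁ - k / τ by field_simp; ring,
      show (1 + (τ : ℂ) * (1 + lam₂) - 1 - k) / τ = 1 + lam₂ - k / τ by field_simp; ring,
      show ((τ : ℂ) - 1 - k) / τ = 1 - (k + 1) / τ by field_simp; ring,
      show (2 - l + (τ : ℂ) * (2 + lam₁ + lam₂) - 1 - k) / τ =
        2 + lam₁ + lam₂ - (l + k - 1) / τ by field_simp; ring]
    rw [show ((l - 2) / (τ : ℂ) * Real.log τ - Real.log (2 * Real.pi)) +
        (-2 * Real.log τ / τ) * k =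
        ((1 + (lam₁ : ℂ) - k / τ - 1 / 2) * Real.log τ - Real.log (2 * Real.pi) / 2) +
        ((1 + (lam₂ : ℂ) - k / τ - 1 / 2) * Real.log τ - Real.log (2 * Real.pi) / 2) +
        ((1 - (k + 1) / (τ : ℂ) - 1 / 2) * Real.log τ - Real.log (2 * Real.pi) / 2) -
        ((2 + lam₁ + lam₂ - (l + k - 1) / τ - 1 / 2) * Real.log τ - Real.log (2 * Real.pi) / 2) by
      ring]
    have hexp (a b c d : ℂ) : Complex.exp (a + b + c - d) =
        Complex.exp a * Complex.exp b * Complex.exp c / Complex.exp d := by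
      rw [Complex.exp_sub, Complex.exp_add, Complex.exp_add]
    rw [hexp]
    ring
  have hmell : selbergMellin τ lam₁ lam₂ l =
      ((τ : ℂ) ^ ((l : ℂ) / τ) * ((2 * Real.pi : ℝ) : ℂ) ^ (l : ℂ)) *
      (Real.Gamma (1 - 1 / τ) : ℂ) ^ (-(l : ℂ)) *
      ∏ k ∈ Finset.range l, (barnesShift τ (1 + τ * (1 + lam₁) - 1 - k) *
      barnesShift τ (1 + τ * (1 + lam₂) - 1 - k) * barnesShift τ (τ - 1 - k) /
      barnesShift τ (2 - l + τ * (2 + lam₁ + lam₂) - 1 - k)) := by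
    rw [Finset.prod_div_distrib, Finset.prod_mul_distrib, Finset.prod_mul_distrib, ← d1, ← d2, ← d3,
      ← d4, div_eq_mul_inv _ (doubleGamma τ _ / doubleGamma τ _), inv_div]
    simp only [selbergMellin]
    ring
  have hpos : ((selbergPosMoment τ lam₁ lam₂ l : ℝ) : ℂ) =
      (Real.Gamma (1 - 1 / τ) : ℂ) ^ (-(l : ℂ)) * ∏ k ∈ Finset.range l,
        Complex.Gamma (1 - (k + 1) / τ) * (Complex.Gamma (1 + lam₁ - k / τ) *
        Complex.Gamma (1 + lam₂ - k / τ) / Complex.Gamma (2 + lam₁ + lam₂ - (l + k - 1) / τ)) := by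
    rw [Complex.cpow_neg, Complex.cpow_natCast, ← inv_pow]
    conv_rhs => rw [← Finset.card_range l, ← Finset.prod_const, Finset.card_range l]
    rw [← Finset.prod_mul_distrib, selbergPosMoment, Complex.ofReal_prod]
    refine Finset.prod_congr rfl fun k _ => ?_
    simp only [Complex.ofReal_mul, Complex.ofReal_div, ← Complex.Gamma_ofReal]
    push_cast
    ring
  rw [hmell, hprod, hpos, prod_exp_arith, ofReal_cpow_eq_exp hτ0, ofReal_cpow_eq_exp (by positivity),
    ← Complex.exp_add]
  -- The powers of `τ` and `2π` from the shifts cancel the prefactor `τ^{l/τ} (2π)^l`.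
  have e : Complex.exp ((l : ℂ) / τ * Real.log τ + l * Real.log (2 * Real.pi)) *
      Complex.exp (l * ((l - 2) / τ * Real.log τ - Real.log (2 * Real.pi)) +
        (-2 * Real.log τ / τ) * (l * (l - 1) / 2)) = 1 := by
    rw [← Complex.exp_add]
    convert Complex.exp_zero using 2
    ring
  generalize (∏ k ∈ Finset.range l, Complex.Gamma (1 - (k + 1) / τ) *
    (Complex.Gamma (1 + lam₁ - k / τ) * Complex.Gamma (1 + lam₂ - k / τ) /
      Complex.Gamma (2 + lam₁ + lam₂ - (l + k - 1) / τ))) = P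
  linear_combination (Real.Gamma (1 - 1 / τ) : ℂ) ^ (-(l : ℂ)) * P * e

theorem selbergMellin_neg_natCast {τ lam₁ lam₂ : ℝ} (hτ : 1 < τ) (h₁ : -1 / τ < lam₁)
    (h₂ : -1 / τ < lam₂) (l : ℕ) :
    selbergMellin τ lam₁ lam₂ (-l) = selbergNegMoment τ lam₁ lam₂ l := by
  have hτ0 : 0 < τ := by linarith
  have hτ' : (τ : ℂ) ≠ 0 := by exact_mod_cast hτ0.ne'
  have hl1 : -1 < τ * lam₁ := by
    rw [div_lt_iff₀ hτ0] at h₁; linarith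
  have hl2 : -1 < τ * lam₂ := by
    rw [div_lt_iff₀ hτ0] at h₂; linarith
  have hl0 : (0 : ℝ) ≤ l := Nat.cast_nonneg l
  have d1 := doubleGamma_div_add_nat hτ0 (w := 1 + τ * (1 + lam₁))
    (v := 1 - (-l) + τ * (1 + lam₁)) (by simp; linarith) l (by ring)
  have d2 := doubleGamma_div_add_nat hτ0 (w := 1 + τ * (1 + lam₂))
    (v := 1 - (-l) + τ * (1 + lam₂)) (by simp; linarith) l (by ring)
  have d3 := doubleGamma_div_add_nat hτ0 (w := τ) (v := -(-l) + τ) (by simpa using hτ0) l (by ring)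
  have d4 := doubleGamma_div_add_nat hτ0 (w := 2 - (-l) + τ * (2 + lam₁ + lam₂))
    (v := 2 - 2 * (-l) + τ * (2 + lam₁ + lam₂)) (by simp; linarith) l (by ring)
  have hprod : ∏ k ∈ Finset.range l, (barnesShift τ (2 - (-l) + τ * (2 + lam₁ + lam₂) + k) /
      (barnesShift τ (1 + τ * (1 + lam₁) + k) *
      barnesShift τ (1 + τ * (1 + lam₂) + k) * barnesShift τ (τ + k))) =
      (∏ k ∈ Finset.range l, Complex.Gamma (2 + lam₁ + lam₂ + (l + 2 + k) / τ) /
        (Complex.Gamma (1 + lam₁ + (k + 1) / τ) * Complex.Gamma (1 + lam₂ + (k + 1) / τ) *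
          Complex.Gamma (1 + k / τ))) *
      ∏ k ∈ Finset.range l, Complex.exp ((l / τ * Real.log τ + Real.log (2 * Real.pi)) +
        (-2 * Real.log τ / τ) * k) := by
    rw [← Finset.prod_mul_distrib]
    refine Finset.prod_congr rfl fun k _ => ?_
    simp only [barnesShift]
    rw [show (1 + (τ : ℂ) * (1 + lam₁) + k) / τ = 1 + lam₁ + (k + 1) / τ by field_simp; ring,
      show (1 + (τ : ℂ) * (1 + lam₂) + k) / τ = 1 + lam₂ + (k + 1) / τ by field_simp; ring,
      show ((τ : ℂ) + k) / τ = 1 + k / τ by field_simp,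
      show (2 - (-l) + (τ : ℂ) * (2 + lam₁ + lam₂) + k) / τ =
        2 + lam₁ + lam₂ + (l + 2 + k) / τ by field_simp; ring]
    rw [show (l / (τ : ℂ) * Real.log τ + Real.log (2 * Real.pi)) +
        (-2 * Real.log τ / τ) * k =
        ((2 + lam₁ + lam₂ + (l + 2 + k) / τ - 1 / 2) * Real.log τ - Real.log (2 * Real.pi) / 2) -
        (((1 + (lam₁ : ℂ) + (k + 1) / τ - 1 / 2) * Real.log τ - Real.log (2 * Real.pi) / 2) +
        ((1 + (lam₂ : ℂ) + (k + 1) / τ - 1 / 2) * Real.log τ - Real.log (2 * Real.pi) / 2) +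
        ((1 + k / (τ : ℂ) - 1 / 2) * Real.log τ - Real.log (2 * Real.pi) / 2)) by
      ring]
    have hexp (a b c d : ℂ) : Complex.exp (d - (a + b + c)) =
        Complex.exp d / (Complex.exp a * Complex.exp b * Complex.exp c) := by
      rw [Complex.exp_sub, Complex.exp_add, Complex.exp_add]
    rw [hexp, div_mul_div_comm]
    congr 1
    ring
  have hmell : selbergMellin τ lam₁ lam₂ (-l) =
      ((τ : ℂ) ^ (-(l : ℂ) / τ) * ((2 * Real.pi : ℝ) : ℂ) ^ (-(l : ℂ))) *
      (Real.Gamma (1 - 1 / τ) : ℂ) ^ l *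
      ∏ k ∈ Finset.range l, (barnesShift τ (2 - (-l) + τ * (2 + lam₁ + lam₂) + k) /
      (barnesShift τ (1 + τ * (1 + lam₁) + k) *
      barnesShift τ (1 + τ * (1 + lam₂) + k) * barnesShift τ (τ + k))) := by
    rw [Finset.prod_div_distrib, Finset.prod_mul_distrib, Finset.prod_mul_distrib, ← d1, ← d2, ← d3,
      ← d4, div_eq_mul_inv _ (doubleGamma τ _ / doubleGamma τ _ * _ * _), mul_inv, mul_inv, inv_div,
      inv_div, inv_div]
    simp only [selbergMellin]
    rw [neg_neg, Complex.cpow_natCast]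
    ring
  have hneg : ((selbergNegMoment τ lam₁ lam₂ l : ℝ) : ℂ) =
      (Real.Gamma (1 - 1 / τ) : ℂ) ^ l * ∏ k ∈ Finset.range l,
        Complex.Gamma (2 + lam₁ + lam₂ + (l + 2 + k) / τ) /
        (Complex.Gamma (1 + lam₁ + (k + 1) / τ) * Complex.Gamma (1 + lam₂ + (k + 1) / τ) *
          Complex.Gamma (1 + k / τ)) := by
    conv_rhs => rw [← Finset.card_range l, ← Finset.prod_const, Finset.card_range l]
    rw [← Finset.prod_mul_distrib, selbergNegMoment, Complex.ofReal_prod]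
    refine Finset.prod_congr rfl fun k _ => ?_
    simp only [Complex.ofReal_mul, Complex.ofReal_div, ← Complex.Gamma_ofReal]
    push_cast
    ring
  rw [hmell, hprod, hneg, prod_exp_arith, ofReal_cpow_eq_exp hτ0, ofReal_cpow_eq_exp (by positivity),
    ← Complex.exp_add]
  have e : Complex.exp (-(l : ℂ) / τ * Real.log τ + -l * Real.log (2 * Real.pi)) *
      Complex.exp (l * (l / τ * Real.log τ + Real.log (2 * Real.pi)) +
        (-2 * Real.log τ / τ) * (l * (l - 1) / 2)) = 1 := by
    rw [← Complex.exp_add]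
    convert Complex.exp_zero using 2
    ring
  generalize (∏ k ∈ Finset.range l, Complex.Gamma (2 + lam₁ + lam₂ + (l + 2 + k) / τ) /
        (Complex.Gamma (1 + lam₁ + (k + 1) / τ) * Complex.Gamma (1 + lam₂ + (k + 1) / τ) *
          Complex.Gamma (1 + k / τ))) = P
  linear_combination (Real.Gamma (1 - 1 / τ) : ℂ) ^ l * P * e

theorem integrable_and_integral_of_ofReal {μ : Measure ℝ} {f : ℝ → ℝ} {c : ℝ}
    (hi : Integrable (fun x => (f x : ℂ)) μ) (he : ∫ x, (f x : ℂ) ∂μ = c) :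
    Integrable f μ ∧ ∫ x, f x ∂μ = c := by
  refine ⟨by simpa using hi.re, ?_⟩
  rw [integral_complex_ofReal] at he
  exact_mod_cast he

theorem HasComplexMoment.natCast {μ : Measure ℝ} {l : ℕ} {c : ℝ} (h : HasComplexMoment μ l c) :
    Integrable (fun x : ℝ => x ^ l) μ ∧ ∫ x : ℝ, x ^ l ∂μ = c := by
  refine integrable_and_integral_of_ofReal ?_ ?_
  · simpa using h.1
  · simpa using h.2

theorem HasComplexMoment.neg_natCast {μ : Measure ℝ} {l : ℕ} {c : ℝ}
    (h : HasComplexMoment μ (-l) c) :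
    Integrable (fun x : ℝ => (x ^ l)⁻¹) μ ∧ ∫ x : ℝ, (x ^ l)⁻¹ ∂μ = c := by
  refine integrable_and_integral_of_ofReal ?_ ?_
  · simpa [Complex.cpow_neg] using h.1
  · simpa [Complex.cpow_neg] using h.2

/-! ### Infinite divisibility -/

/-- `φ` has a Lévy–Khintchine representation with jumps of positive size only, with square
integrable Lévy density, and without truncation. -/
def HasLevyKhintchine (φ : ℝ → ℂ) : Prop :=
  ∃ (a : ℝ) (v : NNReal) (k : ℝ → ℝ), IntegrableOn (fun t => t ^ 2 * k t) (Ioi 0) ∧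
    (∀ t, 0 < t → 0 ≤ k t) ∧ ∀ u : ℝ, φ u =
      Complex.exp (u * a * Complex.I - v * u ^ 2 / 2 + ∫ t in Ioi (0 : ℝ),
        (Complex.exp (u * t * Complex.I) - 1 - u * t * Complex.I) * k t)

theorem HasLevyKhintchine.mul {φ ψ : ℝ → ℂ} (hφ : HasLevyKhintchine φ)
    (hψ : HasLevyKhintchine ψ) : HasLevyKhintchine fun u => φ u * ψ u := by
  obtain ⟨a, v, k, hk, hk0, h⟩ := hφ
  obtain ⟨b, w, m, hm, hm0, h'⟩ := hψ
  refine ⟨a + b, v + w, fun t => k t + m t, ?_, fun t ht => add_nonneg (hk0 t ht) (hm0 t ht),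
    fun u => ?_⟩
  · simp only [mul_add]
    exact hk.add hm
  · beta_reduce
    rw [h, h', ← Complex.exp_add]
    congr 1
    simp only [Complex.ofReal_add, mul_add]
    rw [integral_add (integrableOn_cexp_sub_one_sub_mul hk u)
      (integrableOn_cexp_sub_one_sub_mul hm u)]
    push_cast
    ring

theorem charFun_iterate_conv (ν : Measure ℝ) [IsProbabilityMeasure ν] (n : ℕ) :
    IsProbabilityMeasure ((fun ρ : Measure ℝ => Measure.conv ν ρ)^[n] (Measure.dirac 0)) ∧
    ∀ u, charFun ((fun ρ : Measure ℝ => Measure.conv ν ρ)^[n] (Measure.dirac 0)) u =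
      charFun ν u ^ n := by
  induction n with
  | zero => exact ⟨by simp only [Function.iterate_zero, id]; infer_instance, by simp⟩
  | succ n ih =>
    obtain ⟨h1, h2⟩ := ih
    simp only [Function.iterate_succ_apply']
    exact ⟨inferInstance, fun u => by rw [charFun_conv, h2, pow_succ']⟩

/-- Dividing drift, variance and Lévy density by `n` gives the `n`-th convolution root. -/
theorem HasLevyKhintchine.isInfinitelyDivisible {μ : Measure ℝ} [IsProbabilityMeasure μ]
    (h : HasLevyKhintchine (charFun μ)) : IsInfinitelyDivisible μ := by
  obtain ⟨a, v, k, hk, hk0, h⟩ := h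
  intro n hn
  have hn' : (n : ℂ) ≠ 0 := by exact_mod_cast hn.ne'
  obtain ⟨ν, hν, hνu⟩ := exists_charFun_eq_levyKhintchine (k := fun t => k t / n)
    (by simp only [← mul_div_assoc]; exact hk.div_const (n : ℝ))
    (fun t ht => div_nonneg (hk0 t ht) n.cast_nonneg) (a / n) (v / n)
  obtain ⟨hp, hc⟩ := charFun_iterate_conv ν n
  refine ⟨ν, hν, Measure.ext_of_charFun (funext fun u => ?_)⟩
  rw [h, hc, hνu, ← Complex.exp_nat_mul]
  congr 1
  push_cast
  simp only [← mul_div_assoc]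
  rw [integral_div]
  field_simp

theorem hasLevyKhintchine_cpow {c : ℝ} (hc : 0 < c) :
    HasLevyKhintchine fun u => (c : ℂ) ^ (u * Complex.I) := by
  refine ⟨Real.log c, 0, 0, by simp, by simp, fun u => ?_⟩
  beta_reduce
  rw [ofReal_cpow_eq_exp hc]
  simp
  ring_nf

theorem hasLevyKhintchine_gaussian (v : NNReal) :
    HasLevyKhintchine fun u => Complex.exp (v * (u * Complex.I) ^ 2 / 2) := by
  refine ⟨0, v, 0, by simp, by simp, fun u => ?_⟩
  simp [mul_pow]
  ring_nf

theorem hasLevyKhintchine_barnesEta₂₂ {τ b₀ b₁ b₂ : ℝ} (hτ : 0 < τ) (h0 : 0 < b₀) (h1 : 0 ≤ b₁)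
    (h2 : 0 ≤ b₂) :
    HasLevyKhintchine fun u => barnesEta₂₂ τ b₀ b₁ b₂ (-(u * Complex.I)) := by
  have hk : IntegrableOn (fun t => t * barnesLevyDensity τ b₀ b₁ b₂ t) (Ioi 0) := by
    simpa using integrableOn_mul_barnesLevyDensity (c := 0) hτ h1 h2 h0
  have hk2 : IntegrableOn (fun t => t ^ 2 * barnesLevyDensity τ b₀ b₁ b₂ t) (Ioi 0) := by
    have hb : b₀ / 2 < b₀ := by linarith
    refine Integrable.mono ((integrableOn_mul_barnesLevyDensity hτ h1 h2 hb).const_mul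
      (2 / b₀)) ?_ ?_
    · exact (((continuous_pow 2).continuousOn).mul
        (barnesLevyDensity_continuousOn hτ b₀ b₁ b₂)).aestronglyMeasurable measurableSet_Ioi
    · filter_upwards [ae_restrict_mem measurableSet_Ioi] with t ht
      have ht : 0 < t := ht
      have hn := barnesLevyDensity_nonneg hτ h1 h2 ht (b₀ := b₀)
      rw [Real.norm_of_nonneg (by positivity), Real.norm_of_nonneg (by positivity)]
      -- One power of `t` is absorbed by half of the available exponential decay.
      have : t ≤ 2 / b₀ * Real.exp (b₀ / 2 * t) := by
        rw [div_mul_eq_mul_div, le_div_iff₀ h0]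
        linarith [Real.add_one_le_exp (b₀ / 2 * t)]
      calc t ^ 2 * barnesLevyDensity τ b₀ b₁ b₂ t = t * (t * barnesLevyDensity τ b₀ b₁ b₂ t) := by
            ring
        _ ≤ (2 / b₀ * Real.exp (b₀ / 2 * t)) * (t * barnesLevyDensity τ b₀ b₁ b₂ t) := by gcongr
        _ = _ := by ring
  -- Here `t k(t)` is integrable, so adding and removing the compensator changes only the drift.
  refine ⟨∫ t in Ioi 0, t * barnesLevyDensity τ b₀ b₁ b₂ t, 0, barnesLevyDensity τ b₀ b₁ b₂, hk2,
    fun t ht => barnesLevyDensity_nonneg hτ h1 h2 ht, fun u => ?_⟩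
  beta_reduce
  rw [barnesEta₂₂_eq_exp hτ h0 h1 h2 (by simpa using h0)]
  congr 1
  have hkc : IntegrableOn (fun t => (u : ℂ) * Complex.I *
      ((t * barnesLevyDensity τ b₀ b₁ b₂ t : ℝ) : ℂ)) (Ioi 0) := hk.ofReal.const_mul _
  rw [show (u : ℂ) * (∫ t in Ioi 0, t * barnesLevyDensity τ b₀ b₁ b₂ t : ℝ) * Complex.I =
      ∫ t in Ioi (0 : ℝ), (u : ℂ) * Complex.I * ((t * barnesLevyDensity τ b₀ b₁ b₂ t : ℝ) : ℂ) by
    rw [integral_const_mul, integral_complex_ofReal]; ring]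
  rw [NNReal.coe_zero, Complex.ofReal_zero, zero_mul, zero_div, sub_zero,
    ← integral_add hkc (integrableOn_cexp_sub_one_sub_mul hk2 u)]
  refine integral_congr_ae (ae_of_all _ fun t => ?_)
  simp only [neg_neg]
  push_cast
  ring_nf

theorem mul_exp_neg_div_le {x : ℝ} (hx : 0 < x) :
    x * (Real.exp (-x) / (1 - Real.exp (-x))) ≤ 2 * Real.exp (-x / 2) := by
  have h := inv_one_sub_exp_neg_le hx
  have e : Real.exp (-x) = Real.exp (-x / 2) * Real.exp (-x / 2) := by
    rw [← Real.exp_add]; ring_nf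
  have h2 : (1 + x) * Real.exp (-x / 2) ≤ 2 := by
    rw [neg_div, Real.exp_neg, ← div_eq_mul_inv, div_le_iff₀ (Real.exp_pos _)]
    linarith [Real.add_one_le_exp (x / 2)]
  calc x * (Real.exp (-x) / (1 - Real.exp (-x))) =
        x * Real.exp (-x) * (1 - Real.exp (-x))⁻¹ := by ring
    _ ≤ x * Real.exp (-x) * (1 + 1 / x) := by gcongr
    _ = ((1 + x) * Real.exp (-x / 2)) * Real.exp (-x / 2) := by
      rw [e]; field_simp; ring
    _ ≤ _ := by gcongr

/-- `Γ(1 - iu/τ)` is read off from the integral for `barnesLogDiff` at `τ - iu` minus that at `τ`.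
The density is of order `1/(τt²)` at `0`, so compensation is needed here. -/
theorem hasLevyKhintchine_Gamma {τ : ℝ} (hτ : 0 < τ) :
    HasLevyKhintchine fun u => Complex.Gamma (1 - u * Complex.I / τ) := by
  have hτ' : (τ : ℂ) ≠ 0 := by exact_mod_cast hτ.ne'
  let k : ℝ → ℝ := fun t => Real.exp (-τ * t) / (1 - Real.exp (-τ * t)) / t
  -- `t k(t)` with its `1/(τt)` singularity removed; its integral is the part of the drift left by
  -- compensation.
  let J : ℝ → ℝ := fun t => Real.exp (-τ * t) / (1 - Real.exp (-τ * t)) - Real.exp (-t) / (τ * t)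
  have hpos : ∀ t, 0 < t → 0 < 1 - Real.exp (-τ * t) := fun t ht => one_sub_exp_neg_pos hτ ht
  have hcont : ContinuousOn (fun t => Real.exp (-τ * t) / (1 - Real.exp (-τ * t))) (Ioi 0) :=
    (by fun_prop : Continuous fun t => Real.exp (-τ * t)).continuousOn.div
      (by fun_prop) fun t ht => (hpos t ht).ne'
  have hk0 : ∀ t, 0 < t → 0 ≤ k t := fun t ht =>
    div_nonneg (div_nonneg (Real.exp_nonneg _) (hpos t ht).le) ht.le
  have hk : IntegrableOn (fun t => t ^ 2 * k t) (Ioi 0) := by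
    refine Integrable.mono ((exp_neg_integrableOn_Ioi 0 (half_pos hτ)).const_mul (2 / τ)) ?_ ?_
    · refine ContinuousOn.aestronglyMeasurable ?_ measurableSet_Ioi
      exact (continuous_pow 2).continuousOn.mul (hcont.div continuousOn_id fun t ht => ne_of_gt ht)
    · filter_upwards [ae_restrict_mem measurableSet_Ioi] with t ht
      have ht : 0 < t := ht
      rw [Real.norm_of_nonneg (mul_nonneg (by positivity) (hk0 t ht)),
        Real.norm_of_nonneg (by positivity)]
      have h := mul_exp_neg_div_le (mul_pos hτ ht)
      simp only [k]
      rw [← neg_mul] at h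
      rw [show t ^ 2 * (Real.exp (-τ * t) / (1 - Real.exp (-τ * t)) / t) =
        τ * t * (Real.exp (-τ * t) / (1 - Real.exp (-τ * t))) / τ by field_simp,
        div_mul_eq_mul_div]
      refine div_le_div_of_nonneg_right (h.trans_eq ?_) hτ.le
      ring_nf
  have hJ : IntegrableOn J (Ioi 0) := by
    have hm : 0 < min τ 1 := lt_min hτ one_pos
    refine Integrable.mono ((exp_neg_integrableOn_Ioi 0 hm).const_mul
      (1 + ‖(τ : ℂ) - 1‖ / τ)) ?_ ?_
    · refine ContinuousOn.aestronglyMeasurable ?_ measurableSet_Ioi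
      refine hcont.sub (ContinuousOn.div (by fun_prop) (by fun_prop) fun t ht => ?_)
      exact (mul_pos hτ ht).ne'
    · filter_upwards [ae_restrict_mem measurableSet_Ioi] with t ht
      have h := norm_barnesDiffKernel_deriv_le hτ (w := τ) (a := min τ 1) ht (min_le_left _ _)
        (min_le_right _ _)
      rw [Real.norm_of_nonneg (by positivity : 0 ≤ (1 + ‖(τ : ℂ) - 1‖ / τ) * _)]
      refine le_trans (le_of_eq ?_) h
      rw [← Complex.norm_real]
      simp only [J]
      push_cast
      rfl
  refine ⟨Real.log τ / τ + ∫ t in Ioi 0, J t, 0, k, hk, hk0, fun u => ?_⟩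
  have hr : 0 < ((τ : ℂ) - u * Complex.I).re := by simpa using hτ
  have hr' : 0 < (τ : ℂ).re := by simpa using hτ
  have e1 := exp_barnesLogDiff hτ hr
  have e2 := exp_barnesLogDiff hτ hr'
  have hJc : IntegrableOn (fun t => u * Complex.I * (J t : ℂ)) (Ioi 0) := hJ.ofReal.const_mul _
  have e3 : barnesLogDiff τ (τ - u * Complex.I) - barnesLogDiff τ τ =
      u * Complex.I * (∫ t in Ioi 0, J t : ℝ) + ∫ t in Ioi (0 : ℝ),
        (Complex.exp (u * t * Complex.I) - 1 - u * t * Complex.I) * k t := by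
    rw [barnesLogDiff_eq_integral hτ hr, barnesLogDiff_eq_integral hτ hr', sub_sub_sub_cancel_right,
      ← integral_sub (integrableOn_barnesDiffKernel hτ hr) (integrableOn_barnesDiffKernel hτ hr'),
      ← integral_complex_ofReal, ← integral_const_mul, ← integral_add hJc
      (integrableOn_cexp_sub_one_sub_mul hk u)]
    refine setIntegral_congr_fun measurableSet_Ioi fun t ht => ?_
    have ht' : (t : ℂ) ≠ 0 := by exact_mod_cast (ne_of_gt ht : t ≠ 0)
    have hd : (1 : ℂ) - Complex.exp (-(τ : ℂ) * t) ≠ 0 := by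
      exact_mod_cast (hpos t ht).ne'
    have he : Complex.exp (-((τ : ℂ) - u * Complex.I) * t) =
        Complex.exp (-(τ : ℂ) * t) * Complex.exp (u * t * Complex.I) := by
      rw [← Complex.exp_add]; ring_nf
    simp only [barnesDiffKernel, J, k]
    push_cast
    rw [he]
    generalize Complex.exp (-(τ : ℂ) * t) = E at *
    generalize Complex.exp (u * t * Complex.I) = F
    generalize Complex.exp (-(t : ℂ)) = G
    field_simp
    ring
  rw [div_self hτ', Complex.Gamma_one, one_mul] at e2
  rw [sub_div, div_self hτ'] at e1
  have e4 := congrArg Complex.exp e3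
  rw [Complex.exp_sub, e1, e2, mul_div_assoc, ← Complex.exp_sub] at e4
  -- The power of `τ` in the shift formula is removed here and accounts for the drift `log τ / τ`.
  have e5 : Complex.Gamma (1 - u * Complex.I / τ) =
      (Complex.Gamma (1 - u * Complex.I / τ) *
        Complex.exp ((1 - u * Complex.I / τ - 1 / 2) * Real.log τ - Real.log (2 * Real.pi) / 2 -
          ((1 - 1 / 2) * Real.log τ - Real.log (2 * Real.pi) / 2))) *
        Complex.exp (u * Complex.I / τ * Real.log τ) := by
    rw [mul_assoc, ← Complex.exp_add]
    refine (mul_one _).symm.trans (congrArg _ ?_)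
    rw [← Complex.exp_zero]
    congr 1
    ring
  beta_reduce
  rw [e5, e4, ← Complex.exp_add]
  congr 1
  push_cast
  ring

/-! ### Multiplicative convolutions with a lognormal factor -/

theorem map_log_mconv {μ ν : Measure ℝ} (hμ : IsLawOnPos μ) (hν : IsLawOnPos ν) :
    (μ.mconv ν).map Real.log = (μ.map Real.log).conv (ν.map Real.log) := by
  have := hμ.1
  have := hν.1
  rw [Measure.mconv, Measure.conv, Measure.map_prod_map _ _ Real.measurable_log Real.measurable_log,
    Measure.map_map Real.measurable_log (by fun_prop),
    Measure.map_map (by fun_prop) (by fun_prop)]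
  refine Measure.map_congr ?_
  filter_upwards [ae_prod_pos hμ hν] with p hp
  simp [Real.log_mul hp.1.ne' hp.2.ne']

theorem mconv_map_const_mul (μ ν : Measure ℝ) [SFinite μ] [SFinite ν] (c : ℝ) :
    (μ.mconv ν).map (fun x => c * x) = μ.mconv (ν.map (fun x => c * x)) := by
  rw [← Measure.dirac_mconv, ← Measure.dirac_mconv, ← Measure.mconv_assoc,
    Measure.mconv_comm (Measure.dirac c) μ, Measure.mconv_assoc]

theorem invLaw_mconv (μ ν : Measure ℝ) [SFinite μ] [SFinite ν] :
    invLaw (μ.mconv ν) = (invLaw μ).mconv (invLaw ν) := by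
  rw [invLaw, invLaw, invLaw, Measure.mconv, Measure.mconv,
    Measure.map_prod_map _ _ measurable_inv measurable_inv,
    Measure.map_map measurable_inv (by fun_prop), Measure.map_map (by fun_prop) (by fun_prop)]
  congr 1
  ext p
  simp [mul_comm]

theorem invLaw_lognormalLaw (τ : ℝ) : invLaw (lognormalLaw τ) = lognormalLaw τ := by
  have h : (gaussianReal 0 (Real.toNNReal (4 * Real.log 2 / τ))).map (fun x => -x) =
      gaussianReal 0 (Real.toNNReal (4 * Real.log 2 / τ)) := by
    simpa using gaussianReal_map_neg (μ := 0) (v := Real.toNNReal (4 * Real.log 2 / τ))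
  conv_rhs => rw [lognormalLaw, ← h]
  rw [invLaw, lognormalLaw, Measure.map_map measurable_inv Real.measurable_exp,
    Measure.map_map Real.measurable_exp measurable_neg]
  congr 1
  ext x
  simp [Real.exp_neg]

theorem map_log_map_exp (μ : Measure ℝ) : (μ.map Real.exp).map Real.log = μ := by
  rw [Measure.map_map Real.measurable_log Real.measurable_exp]
  simp [Function.comp_def]

theorem lognormalLaw_mconv_map_log_absolutelyContinuous {τ : ℝ} (hτ : 0 < τ) {N : Measure ℝ}
    (hN : IsLawOnPos N) : ((lognormalLaw τ).mconv N).map Real.log ≪ volume := by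
  have := hN.1
  have : IsProbabilityMeasure (N.map Real.log) :=
    Measure.isProbabilityMeasure_map Real.measurable_log.aemeasurable
  have hv : Real.toNNReal (4 * Real.log 2 / τ) ≠ 0 := by
    have := Real.log_pos one_lt_two
    exact (Real.toNNReal_pos.2 (by positivity)).ne'
  rw [map_log_mconv (isLawOnPos_lognormalLaw τ) hN, lognormalLaw, map_log_map_exp,
    Measure.conv_comm]
  exact Measure.conv_absolutelyContinuous (gaussianReal_absolutelyContinuous _ hv)

/-- A perturbation of the Gaussian law which keeps its exponential moments of integer order. -/
noncomputable def sinGaussian (v : NNReal) : Measure ℝ :=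
  (gaussianReal 0 v).withDensity fun x => ENNReal.ofReal (1 + Real.sin (2 * Real.pi / v * x))

theorem integrable_and_integral_cexp_sinGaussian (v : NNReal) (q : ℂ) :
    Integrable (fun x : ℝ => Complex.exp (q * x)) (sinGaussian v) ∧
    ∫ x : ℝ, Complex.exp (q * x) ∂(sinGaussian v) = Complex.exp (v * q ^ 2 / 2) +
      (Complex.exp (v * (q + 2 * Real.pi / v * Complex.I) ^ 2 / 2) -
        Complex.exp (v * (q - 2 * Real.pi / v * Complex.I) ^ 2 / 2)) / (2 * Complex.I) := by
  have hm : Measurable fun x : ℝ => ENNReal.ofReal (1 + Real.sin (2 * Real.pi / v * x)) := by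
    fun_prop
  have hlt : ∀ᵐ x ∂(gaussianReal 0 v),
      ENNReal.ofReal (1 + Real.sin (2 * Real.pi / v * x)) < ⊤ :=
    ae_of_all _ fun x => ENNReal.ofReal_lt_top
  have hI : (2 * Complex.I : ℂ) ≠ 0 := by simp
  have key : (fun x : ℝ => (ENNReal.ofReal (1 + Real.sin (2 * Real.pi / v * x))).toReal •
      Complex.exp (q * x)) = fun x : ℝ => Complex.exp (q * x) +
        (Complex.exp ((q + 2 * Real.pi / v * Complex.I) * x) -
          Complex.exp ((q - 2 * Real.pi / v * Complex.I) * x)) / (2 * Complex.I) := by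
    funext x
    rw [ENNReal.toReal_ofReal (by linarith [Real.neg_one_le_sin (2 * Real.pi / v * x)]),
      Complex.real_smul, add_mul, sub_mul, Complex.exp_add, Complex.exp_sub]
    have h1 := Complex.two_sin ((2 * Real.pi / v * x : ℝ) : ℂ)
    have e1 : Complex.exp (2 * Real.pi / v * Complex.I * x) =
      Complex.exp (((2 * Real.pi / v * x : ℝ) : ℂ) * Complex.I) := by
      congr 1; push_cast; ring
    have e2 : (Complex.exp (2 * Real.pi / v * Complex.I * x))⁻¹ =
      Complex.exp (-((2 * Real.pi / v * x : ℝ) : ℂ) * Complex.I) := by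
      rw [← Complex.exp_neg]; congr 1; push_cast; ring
    rw [div_eq_mul_inv (Complex.exp (q * x)), e2, e1, Complex.ofReal_add, Complex.ofReal_sin,
      Complex.ofReal_one]
    generalize ((2 * Real.pi / v * x : ℝ) : ℂ) = y at h1 ⊢
    generalize Complex.exp (-y * Complex.I) = b at h1 ⊢
    generalize Complex.exp (y * Complex.I) = a at h1 ⊢
    rw [← sub_eq_iff_eq_add', eq_div_iff hI]
    linear_combination (Complex.exp (q * x) * Complex.I) * h1 +
      Complex.exp (q * x) * (b - a) * Complex.I_sq
  have i0 := integrable_cexp_mul_gaussianReal v q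
  have i1 := integrable_cexp_mul_gaussianReal v (q + 2 * Real.pi / v * Complex.I)
  have i2 := integrable_cexp_mul_gaussianReal v (q - 2 * Real.pi / v * Complex.I)
  have i3 : Integrable (fun x : ℝ => (Complex.exp ((q + 2 * Real.pi / v * Complex.I) * x) -
      Complex.exp ((q - 2 * Real.pi / v * Complex.I) * x)) / (2 * Complex.I)) (gaussianReal 0 v) :=
    (i1.sub i2).div_const _
  constructor
  · rw [sinGaussian, integrable_withDensity_iff_integrable_smul' hm hlt, key]
    exact i0.add i3
  · rw [sinGaussian, integral_withDensity_eq_integral_toReal_smul hm hlt, key,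
      integral_add i0 i3, integral_div, integral_sub i1 i2,
      integral_cexp_mul_gaussianReal, integral_cexp_mul_gaussianReal,
      integral_cexp_mul_gaussianReal]

/-- The frequency `2π/v` is chosen for this: the exponents at `l ± 2πi/v` differ by `4πil`, so the
sine contributes nothing at integers. -/
theorem integral_cexp_natCast_sinGaussian {v : NNReal} (hv : v ≠ 0) (l : ℕ) :
    ∫ x : ℝ, Complex.exp (l * x) ∂(sinGaussian v) = Complex.exp (v * (l : ℂ) ^ 2 / 2) := by
  have hv' : (v : ℂ) ≠ 0 := by exact_mod_cast hv
  rw [(integrable_and_integral_cexp_sinGaussian v l).2]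
  have e : Complex.exp (v * ((l : ℂ) + 2 * Real.pi / v * Complex.I) ^ 2 / 2) =
      Complex.exp (v * ((l : ℂ) - 2 * Real.pi / v * Complex.I) ^ 2 / 2) := by
    rw [Complex.exp_eq_exp_iff_exists_int]
    refine ⟨2 * l, ?_⟩
    push_cast
    field_simp
    ring
  rw [e, sub_self, zero_div, add_zero]

theorem isProbabilityMeasure_sinGaussian {v : NNReal} (hv : v ≠ 0) :
    IsProbabilityMeasure (sinGaussian v) := by
  obtain ⟨h1, -⟩ := integrable_and_integral_cexp_sinGaussian v 0
  have h2 := integral_cexp_natCast_sinGaussian hv 0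
  have hf : IsFiniteMeasure (sinGaussian v) := by
    simpa [integrable_const_iff, isFiniteMeasure_iff] using h1
  simp at h2
  rw [isProbabilityMeasure_iff_real]
  exact_mod_cast h2

theorem isLawOnPos_map_exp (μ : Measure ℝ) [IsProbabilityMeasure μ] :
    IsLawOnPos (μ.map Real.exp) := by
  have : IsProbabilityMeasure (μ.map Real.exp) :=
    Measure.isProbabilityMeasure_map Real.measurable_exp.aemeasurable
  refine isLawOnPos_of_ae_pos ?_
  rw [ae_map_iff Real.measurable_exp.aemeasurable measurableSet_Ioi]
  exact ae_of_all _ Real.exp_pos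

theorem lintegral_pow_mconv {μ ν : Measure ℝ} (hμ : IsLawOnPos μ) (hν : IsLawOnPos ν) (l : ℕ) :
    ∫⁻ x, ENNReal.ofReal (x ^ l) ∂(μ.mconv ν) =
      (∫⁻ x, ENNReal.ofReal (x ^ l) ∂μ) * ∫⁻ x, ENNReal.ofReal (x ^ l) ∂ν := by
  have := hν.1
  rw [Measure.lintegral_mconv (by fun_prop), ← lintegral_mul_const _ (by fun_prop)]
  refine lintegral_congr_ae ?_
  filter_upwards [hμ.ae_pos] with x hx
  rw [← lintegral_const_mul _ (by fun_prop)]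
  refine lintegral_congr fun y => ?_
  rw [mul_pow, ENNReal.ofReal_mul (by positivity)]

theorem lintegral_pow_map_exp {μ : Measure ℝ} {l : ℕ} {c : ℝ}
    (h1 : Integrable (fun x : ℝ => Complex.exp (l * x)) μ)
    (h2 : ∫ x : ℝ, Complex.exp (l * x) ∂μ = c) :
    ∫⁻ x, ENNReal.ofReal (x ^ l) ∂(μ.map Real.exp) = ENNReal.ofReal c := by
  have e : (fun x : ℝ => Complex.exp (l * x)) = fun x => ((Real.exp x ^ l : ℝ) : ℂ) := by
    funext x
    push_cast
    rw [Complex.exp_nat_mul]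
  rw [e] at h1 h2
  obtain ⟨h3, h4⟩ := integrable_and_integral_of_ofReal h1 h2
  rw [lintegral_map (by fun_prop) Real.measurable_exp,
    ← ofReal_integral_eq_lintegral_ofReal h3 (ae_of_all _ fun x => by positivity), h4]

/-- On the imaginary axis the two shifted exponents are real, and they differ unless `t = 0`. -/
theorem charFun_sinGaussian_ne {v : NNReal} (hv : v ≠ 0) {t : ℝ} (ht : t ≠ 0) :
    charFun (sinGaussian v) t ≠ charFun (gaussianReal 0 v) t := by
  have hv' : (v : ℝ) ≠ 0 := by exact_mod_cast hv
  have e : ∀ x : ℝ, (t : ℂ) * x * Complex.I = (t * Complex.I) * x := fun x => by ring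
  simp only [charFun_apply_real, e]
  rw [(integrable_and_integral_cexp_sinGaussian v _).2, integral_cexp_mul_gaussianReal, Ne,
    add_eq_left, div_eq_zero_iff, not_or]
  refine ⟨fun h => ?_, by simp⟩
  have h := sub_eq_zero.1 h
  have e1 : (v : ℂ) * (t * Complex.I + 2 * Real.pi / v * Complex.I) ^ 2 / 2 =
      ((-(v * (t + 2 * Real.pi / v) ^ 2 / 2) : ℝ) : ℂ) := by
    push_cast
    linear_combination (v : ℂ) * (t + 2 * Real.pi / v) ^ 2 / 2 * Complex.I_sq
  have e2 : (v : ℂ) * (t * Complex.I - 2 * Real.pi / v * Complex.I) ^ 2 / 2 =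
      ((-(v * (t - 2 * Real.pi / v) ^ 2 / 2) : ℝ) : ℂ) := by
    push_cast
    linear_combination (v : ℂ) * (t - 2 * Real.pi / v) ^ 2 / 2 * Complex.I_sq
  rw [e1, e2, ← Complex.ofReal_exp, ← Complex.ofReal_exp, Complex.ofReal_inj,
    Real.exp_eq_exp] at h
  have h3 : t * Real.pi = 0 := by
    field_simp at h
    refine (mul_eq_zero.1 (?_ : (v : ℝ) * (t * Real.pi) = 0)).resolve_left hv'
    linear_combination -h / 8
  exact (mul_ne_zero ht Real.pi_ne_zero) h3

/-- The sine perturbation of the lognormal factor keeps its integer moments. Moments of products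
multiply in `[0, ∞]`, so infinite moments of `N` do no harm. -/
theorem isStieltjesIndeterminate_lognormalLaw_mconv {τ : ℝ} (hτ : 0 < τ) {N : Measure ℝ}
    (hN : IsLawOnPos N) : IsStieltjesIndeterminate ((lognormalLaw τ).mconv N) := by
  have hv : Real.toNNReal (4 * Real.log 2 / τ) ≠ 0 := by
    have := Real.log_pos one_lt_two
    exact (Real.toNNReal_pos.2 (by positivity)).ne'
  rw [lognormalLaw]
  generalize Real.toNNReal (4 * Real.log 2 / τ) = v at hv
  have := hN.1
  have := isProbabilityMeasure_sinGaussian hv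
  have hL := isLawOnPos_map_exp (gaussianReal 0 v)
  have hL' := isLawOnPos_map_exp (sinGaussian v)
  refine ⟨((sinGaussian v).map Real.exp).mconv N, ?_, fun l => ?_, fun h => ?_⟩
  · exact measure_mono_null Iio_subset_Iic_self (hL'.mconv hN).2
  · have hc : Complex.exp (v * (l : ℂ) ^ 2 / 2) = (Real.exp (v * (l : ℝ) ^ 2 / 2) : ℝ) := by
      push_cast; rfl
    rw [lintegral_pow_mconv hL' hN, lintegral_pow_mconv hL hN,
      lintegral_pow_map_exp (integrable_and_integral_cexp_sinGaussian v l).1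
        ((integral_cexp_natCast_sinGaussian hv l).trans hc),
      lintegral_pow_map_exp (integrable_cexp_mul_gaussianReal v l)
        ((integral_cexp_mul_gaussianReal v l).trans hc)]
  · have : IsProbabilityMeasure (N.map Real.log) :=
      Measure.isProbabilityMeasure_map Real.measurable_log.aemeasurable
    have h := congrArg (Measure.map Real.log) h
    rw [map_log_mconv hL' hN, map_log_mconv hL hN, map_log_map_exp, map_log_map_exp] at h
    -- The characteristic function of `log N` may vanish somewhere, but not near `0`; cancelling it
    -- at one nonzero point is enough.
    have h0 : ∀ᶠ t in 𝓝[≠] (0 : ℝ), charFun (N.map Real.log) t ≠ 0 := by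
      have hc : Continuous (charFun (N.map Real.log)) := continuous_charFun
      exact (hc.continuousAt.eventually_ne (by simp)).filter_mono nhdsWithin_le_nhds
    obtain ⟨t, h1, ht⟩ := (h0.and self_mem_nhdsWithin).exists
    have h2 := congrFun (congrArg charFun h) t
    rw [charFun_conv, charFun_conv] at h2
    exact charFun_sinGaussian_ne hv ht (mul_right_cancel₀ h1 h2)

theorem IsSelbergLaw.hasLevyKhintchine {τ lam₁ lam₂ : ℝ} {M : Measure ℝ} (hτ : 1 < τ)
    (h₁ : -1 / τ < lam₁) (h₂ : -1 / τ < lam₂) (hM : IsSelbergLaw τ lam₁ lam₂ M) :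
    HasLevyKhintchine (charFun (M.map Real.log)) := by
  have hτ0 : 0 < τ := by linarith
  have hl1 : -1 < τ * lam₁ := by
    rw [div_lt_iff₀ hτ0] at h₁; linarith
  have hl2 : -1 < τ * lam₂ := by
    rw [div_lt_iff₀ hτ0] at h₂; linarith
  obtain ⟨x₁, hx₁⟩ : ∃ x, x = 1 + τ * (1 + lam₁) := ⟨_, rfl⟩
  obtain ⟨x₂, hx₂⟩ : ∃ x, x = 1 + τ * (1 + lam₂) := ⟨_, rfl⟩
  have g1 : τ < x₁ := by rw [hx₁]; linarith
  have g2 : τ < x₂ := by rw [hx₂]; linarith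
  have hlog := Real.log_pos one_lt_two
  have hb1 := hasLevyKhintchine_barnesEta₂₂ (τ := τ) (b₀ := min x₁ x₂) (b₁ := |x₂ - x₁| / 2)
    (b₂ := |x₂ - x₁| / 2) hτ0 (lt_min (by linarith) (by linarith)) (by positivity) (by positivity)
  have hb2 := hasLevyKhintchine_barnesEta₂₂ (τ := τ) (b₀ := (x₁ + x₂) / 2) (b₁ := 1 / 2)
    (b₂ := τ / 2) hτ0 (by linarith) (by positivity) (by positivity)
  have hb3 := hasLevyKhintchine_barnesEta₂₂ (τ := τ) (b₀ := 1 + τ) (b₁ := (x₁ + x₂ - 1 - τ) / 2)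
    (b₂ := (x₁ + x₂ - 1 - τ) / 2) hτ0 (by linarith) (by linarith) (by linarith)
  have h := (hasLevyKhintchine_cpow (selbergConst_pos hτ lam₁ lam₂)).mul
    ((hasLevyKhintchine_gaussian (Real.toNNReal (4 * Real.log 2 / τ))).mul
      (hb1.mul (hb2.mul (hb3.mul (hasLevyKhintchine_Gamma hτ0)))))
  convert h using 2 with u
  rw [hM.charFun_map_log hτ0, selbergMellin_eq hτ h₁ h₂ hx₁ hx₂ (by simpa using hτ0),
    Real.coe_toNNReal _ (by positivity)]
  congr 3
  push_cast
  ring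

/-! ### Determinacy of laws with moments of factorial growth -/

/-- Integrating the power series of `e^{|r|x}` term by term leaves a geometric series of ratio `|r|
A < 1`. -/
theorem integrable_exp_mul_of_lintegral_pow_le {P : Measure ℝ} (hP : IsLawOnPos P) {A : ℝ}
    (hA : 0 < A) (h : ∀ l : ℕ, ∫⁻ x, ENNReal.ofReal (x ^ l) ∂P ≤
      ENNReal.ofReal (A ^ l * l.factorial)) {r : ℝ} (hr : |r| < A⁻¹) :
    Integrable (fun x => Real.exp (r * x)) P := by
  have hrA : |r| * A < 1 := by
    rwa [← one_div, lt_div_iff₀ hA] at hr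
  have hsum : ∀ x : ℝ, HasSum (fun l : ℕ => (|r| * x) ^ l / l.factorial) (Real.exp (|r| * x)) :=
    fun x => by
      rw [Real.exp_eq_exp_ℝ]
      exact NormedSpace.expSeries_div_hasSum_exp _
  have hfin : ∫⁻ x, ENNReal.ofReal (Real.exp (|r| * x)) ∂P < ⊤ := by
    have e : ∫⁻ x, ENNReal.ofReal (Real.exp (|r| * x)) ∂P =
        ∫⁻ x, ∑' l : ℕ, ENNReal.ofReal (|r| ^ l / l.factorial) * ENNReal.ofReal (x ^ l) ∂P := by
      refine lintegral_congr_ae ?_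
      filter_upwards [hP.ae_pos] with x hx
      rw [← (hsum x).tsum_eq, ENNReal.ofReal_tsum_of_nonneg (fun n => by positivity)
        (hsum x).summable]
      refine tsum_congr fun l => ?_
      rw [← ENNReal.ofReal_mul (by positivity)]
      congr 1
      ring
    rw [e, lintegral_tsum fun l => by fun_prop]
    calc ∑' l : ℕ, ∫⁻ x, ENNReal.ofReal (|r| ^ l / l.factorial) * ENNReal.ofReal (x ^ l) ∂P ≤
          ∑' l : ℕ, ENNReal.ofReal ((|r| * A) ^ l) := by
          refine ENNReal.tsum_le_tsum fun l => ?_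
          rw [lintegral_const_mul _ (by fun_prop)]
          refine (mul_le_mul_right (h l) _).trans_eq ?_
          rw [← ENNReal.ofReal_mul (by positivity)]
          congr 1
          have : (l.factorial : ℝ) ≠ 0 := by positivity
          field_simp
          rw [mul_pow]
      _ = ENNReal.ofReal (∑' l : ℕ, (|r| * A) ^ l) :=
          (ENNReal.ofReal_tsum_of_nonneg (fun n => by positivity)
            (summable_geometric_of_lt_one (by positivity) hrA)).symm
      _ < ⊤ := ENNReal.ofReal_lt_top
  have hi : Integrable (fun x => Real.exp (|r| * x)) P :=
    (lintegral_ofReal_ne_top_iff_integrable (by fun_prop)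
      (ae_of_all _ fun x => Real.exp_nonneg _)).1 hfin.ne
  refine hi.mono (by fun_prop) ?_
  filter_upwards [hP.ae_pos] with x hx
  rw [Real.norm_of_nonneg (Real.exp_nonneg _), Real.norm_of_nonneg (Real.exp_nonneg _)]
  gcongr
  exact le_abs_self r

theorem IsLawOnPos.integral_pow_eq {P Q : Measure ℝ} (hP : IsLawOnPos P) (hQ : IsLawOnPos Q)
    {l : ℕ} (h : ∫⁻ x, ENNReal.ofReal (x ^ l) ∂P = ∫⁻ x, ENNReal.ofReal (x ^ l) ∂Q) :
    ∫ x, x ^ l ∂P = ∫ x, x ^ l ∂Q := by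
  rw [integral_eq_lintegral_of_nonneg_ae, integral_eq_lintegral_of_nonneg_ae, h]
  · filter_upwards [hQ.ae_pos] with x hx using pow_nonneg hx.le l
  · fun_prop
  · filter_upwards [hP.ae_pos] with x hx using pow_nonneg hx.le l
  · fun_prop

theorem eventuallyEq_of_iteratedDeriv_eq {f g : ℂ → ℂ} {z : ℂ} (hf : AnalyticAt ℂ f z)
    (hg : AnalyticAt ℂ g z) (h : ∀ n, iteratedDeriv n f z = iteratedDeriv n g z) : f =ᶠ[𝓝 z] g := by
  have h1 := hf.hasFPowerSeriesAt.sub hg.hasFPowerSeriesAt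
  simp only [h, sub_self] at h1
  filter_upwards [h1.eventually_eq_zero] with x hx using sub_eq_zero.1 hx

/-- Both moment generating functions are analytic on `|Re z| < 1/A`, and their Taylor coefficients
at `0` are the moments. They therefore agree on the strip, in particular on the imaginary axis. -/
theorem eq_of_lintegral_pow_eq {P Q : Measure ℝ} (hP : IsLawOnPos P) (hQ : IsLawOnPos Q) {A : ℝ}
    (hA : 0 < A) (hQA : ∀ l : ℕ, ∫⁻ x, ENNReal.ofReal (x ^ l) ∂Q ≤
      ENNReal.ofReal (A ^ l * l.factorial))
    (h : ∀ l : ℕ, ∫⁻ x, ENNReal.ofReal (x ^ l) ∂P = ∫⁻ x, ENNReal.ofReal (x ^ l) ∂Q) : P = Q := by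
  have := hP.1
  have := hQ.1
  have hA' : 0 < A⁻¹ := inv_pos.2 hA
  have hsub : ∀ {K : Measure ℝ}, IsLawOnPos K → (∀ l : ℕ, ∫⁻ x, ENNReal.ofReal (x ^ l) ∂K ≤
      ENNReal.ofReal (A ^ l * l.factorial)) →
      ∀ r ∈ Ioo (-A⁻¹) A⁻¹, r ∈ interior (integrableExpSet id K) := fun hK h r hr =>
    interior_maximal (fun s hs => integrable_exp_mul_of_lintegral_pow_le hK hA h (abs_lt.2 hs))
      isOpen_Ioo hr
  have hP' := hsub hP fun l => (h l).trans_le (hQA l)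
  have hQ' := hsub hQ hQA
  let U : Set ℂ := Complex.re ⁻¹' Ioo (-A⁻¹) A⁻¹
  have hU : IsPreconnected U :=
    ((convex_Ioo _ _).linear_preimage Complex.reLm).isPreconnected
  have h0 : (0 : ℝ) ∈ Ioo (-A⁻¹) A⁻¹ := ⟨by linarith, hA'⟩
  have e : complexMGF id P =ᶠ[𝓝 0] complexMGF id Q := by
    refine eventuallyEq_of_iteratedDeriv_eq (analyticAt_complexMGF (hP' _ h0))
      (analyticAt_complexMGF (hQ' _ h0)) fun n => ?_
    rw [iteratedDeriv_complexMGF (hP' _ h0), iteratedDeriv_complexMGF (hQ' _ h0)]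
    simp only [id, zero_mul, Complex.exp_zero, mul_one, ← Complex.ofReal_pow]
    rw [integral_complex_ofReal, integral_complex_ofReal, hP.integral_pow_eq hQ (h n)]
  have heq := AnalyticOnNhd.eqOn_of_preconnected_of_eventuallyEq (U := U)
    (fun z hz => analyticAt_complexMGF (hP' _ hz)) (fun z hz => analyticAt_complexMGF (hQ' _ hz))
    hU (z₀ := 0) h0 e
  refine Measure.ext_of_charFun (funext fun t => ?_)
  rw [← complexMGF_id_mul_I, ← complexMGF_id_mul_I]
  exact heq (by simpa [U] using hA)

theorem invLaw_invLaw (μ : Measure ℝ) : invLaw (invLaw μ) = μ := by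
  rw [invLaw, invLaw, Measure.map_map measurable_inv measurable_inv]
  simp

theorem lintegral_pow_invLaw {M : Measure ℝ} (hM : IsLawOnPos M) {l : ℕ} {c : ℝ}
    (h : Integrable (fun x : ℝ => (x ^ l)⁻¹) M ∧ ∫ x : ℝ, (x ^ l)⁻¹ ∂M = c) :
    ∫⁻ x, ENNReal.ofReal (x ^ l) ∂(invLaw M) = ENNReal.ofReal c := by
  rw [invLaw, lintegral_map (by fun_prop) measurable_inv, ← h.2,
    ofReal_integral_eq_lintegral_ofReal h.1]
  · simp only [inv_pow]
  · filter_upwards [hM.ae_pos] with x hx using by positivity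

theorem lintegral_pow_invLaw_frechetLaw_le {τ : ℝ} (hτ : 1 < τ) (l : ℕ) :
    ∫⁻ x, ENNReal.ofReal (x ^ l) ∂(invLaw (frechetLaw τ)) ≤ ENNReal.ofReal l.factorial := by
  have hτ0 : 0 < τ := by linarith
  have hl0 : (0 : ℝ) ≤ l := l.cast_nonneg
  have h := hasComplexMoment_frechetLaw hτ0 (q := -l) (by simp; linarith)
  have e : Complex.Gamma (1 - -(l : ℂ) / τ) = (Real.Gamma (1 + l / τ) : ℝ) := by
    rw [← Complex.Gamma_ofReal]
    push_cast
    ring_nf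
  rw [e] at h
  rw [lintegral_pow_invLaw (isLawOnPos_frechetLaw hτ0) h.neg_natCast]
  refine ENNReal.ofReal_le_ofReal ?_
  -- `Γ` is not monotone on `[1, 2]`, so convexity bounds it on `[1, l+1]` by the larger endpoint
  -- value, `l!`.
  have h1 := Real.convexOn_Gamma.le_max_of_mem_Icc (x := 1) (y := (l : ℝ) + 1)
    (z := 1 + l / τ) (by simp) (by simp only [mem_Ioi]; positivity)
    ⟨by simp; positivity, by rw [add_comm]; gcongr; exact div_le_self hl0 hτ.le⟩
  rw [Real.Gamma_one, Real.Gamma_nat_eq_factorial] at h1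
  refine h1.trans (max_le ?_ le_rfl)
  exact_mod_cast l.factorial_pos

theorem IsBarnesBeta₂₂.lintegral_pow_le {τ b₀ b₁ b₂ : ℝ} {μ : Measure ℝ}
    (h : IsBarnesBeta₂₂ τ b₀ b₁ b₂ μ) (l : ℕ) : ∫⁻ x, ENNReal.ofReal (x ^ l) ∂μ ≤ 1 := by
  have := h.1
  calc ∫⁻ x, ENNReal.ofReal (x ^ l) ∂μ ≤ ∫⁻ _, 1 ∂μ := by
        refine lintegral_mono_ae ?_
        have : ∀ᵐ x ∂μ, x ∈ Ioc (0 : ℝ) 1 := h.2.1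
        filter_upwards [this] with x hx
        rw [← ENNReal.ofReal_one]
        exact ENNReal.ofReal_le_ofReal (pow_le_one₀ hx.1.le hx.2)
    _ = 1 := by simp

theorem isLawOnPos_dirac {c : ℝ} (hc : 0 < c) : IsLawOnPos (Measure.dirac c) :=
  isLawOnPos_of_ae_pos (by rw [ae_dirac_iff measurableSet_Ioi]; exact hc)

/-- The inverse is `c⁻¹ β₁ β₂ β₃ Y⁻¹`; the betas are at most `1`, so only the inverse Fréchet
moments grow. -/
theorem lintegral_pow_invLaw_map_mconv_le {τ c : ℝ} (hτ : 1 < τ) (hc : 0 < c)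
    {B₁ B₂ B₃ : Measure ℝ} {b₁ b₂ b₃ d₁ d₂ d₃ e₁ e₂ e₃ : ℝ} (hB₁ : IsBarnesBeta₂₂ τ b₁ d₁ e₁ B₁)
    (hB₂ : IsBarnesBeta₂₂ τ b₂ d₂ e₂ B₂) (hB₃ : IsBarnesBeta₂₂ τ b₃ d₃ e₃ B₃) (l : ℕ) :
    ∫⁻ x, ENNReal.ofReal (x ^ l) ∂(invLaw ((Measure.mconv (invLaw B₁)
      (Measure.mconv (invLaw B₂) (Measure.mconv (invLaw B₃) (frechetLaw τ)))).map
      (fun y => c * y))) ≤ ENNReal.ofReal (c⁻¹ ^ l * l.factorial) := by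
  have hτ0 : 0 < τ := by linarith
  have p1 := hB₁.isLawOnPos
  have p2 := hB₂.isLawOnPos
  have p3 := hB₃.isLawOnPos
  have p4 := isLawOnPos_frechetLaw hτ0
  have p3' := p3.invLaw.mconv p4
  have p2' := p2.invLaw.mconv p3'
  have p1' := p1.invLaw.mconv p2'
  have := p1.1; have := p2.1; have := p3.1; have := p4.1
  have := p1.invLaw.1; have := p2.invLaw.1; have := p3.invLaw.1
  have := p1'.1; have := p2'.1; have := p3'.1
  have hd : invLaw (Measure.dirac c) = Measure.dirac c⁻¹ := by
    rw [invLaw, Measure.map_dirac' measurable_inv]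
  rw [← Measure.dirac_mconv, invLaw_mconv, invLaw_mconv, invLaw_mconv, invLaw_mconv, invLaw_invLaw,
    invLaw_invLaw, invLaw_invLaw, hd,
    lintegral_pow_mconv (isLawOnPos_dirac (inv_pos.2 hc))
      (p1.mconv (p2.mconv (p3.mconv p4.invLaw))),
    lintegral_pow_mconv p1 (p2.mconv (p3.mconv p4.invLaw)),
    lintegral_pow_mconv p2 (p3.mconv p4.invLaw), lintegral_pow_mconv p3 p4.invLaw,
    lintegral_dirac' _ (by fun_prop), ENNReal.ofReal_mul (by positivity)]
  refine mul_le_mul_right ?_ _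
  calc _ ≤ (1 : ENNReal) * (1 * (1 * ENNReal.ofReal l.factorial)) := by
        gcongr
        · exact hB₁.lintegral_pow_le l
        · exact hB₂.lintegral_pow_le l
        · exact hB₃.lintegral_pow_le l
        · exact lintegral_pow_invLaw_frechetLaw_le hτ l
    _ = _ := by simp

/-- Positivity of the cofactor is not assumed in the characterization. It follows from Fubini by
fixing one positive value of the first factor. -/
theorem isLawOnPos_of_mconv {μ N : Measure ℝ} (hμ : IsLawOnPos μ) [hN : IsProbabilityMeasure N]
    (h : IsLawOnPos (μ.mconv N)) : IsLawOnPos N := by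
  have := hμ.1
  have h1 := h.ae_pos
  rw [Measure.mconv, ae_map_iff (by fun_prop) measurableSet_Ioi] at h1
  obtain ⟨x, hx, hx'⟩ := ((Measure.ae_ae_of_ae_prod h1).and hμ.ae_pos).exists
  refine isLawOnPos_of_ae_pos ?_
  filter_upwards [hx] with y hy using (mul_pos_iff_of_pos_left hx').1 hy

/-- The lognormal law is invariant under inversion, with finite nonzero moments that can be divided
out. The moments of the inverse cofactor are then known, and their growth makes them determining. -/
theorem lognormalLaw_mconv_eq {τ : ℝ} {N N' : Measure ℝ} (hN : IsLawOnPos N)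
    (hN' : IsLawOnPos N') {A : ℝ} (hA : 0 < A)
    (hle : ∀ l : ℕ, ∫⁻ x, ENNReal.ofReal (x ^ l) ∂(invLaw N') ≤
      ENNReal.ofReal (A ^ l * l.factorial))
    (h : ∀ l : ℕ, ∫⁻ x, ENNReal.ofReal (x ^ l) ∂(invLaw ((lognormalLaw τ).mconv N)) =
      ∫⁻ x, ENNReal.ofReal (x ^ l) ∂(invLaw ((lognormalLaw τ).mconv N'))) :
    (lognormalLaw τ).mconv N = (lognormalLaw τ).mconv N' := by
  have := hN.1
  have := hN'.1
  have hL := isLawOnPos_lognormalLaw τ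
  have := hL.1
  have e : invLaw N = invLaw N' := by
    refine eq_of_lintegral_pow_eq hN.invLaw hN'.invLaw hA hle fun l => ?_
    have hl := h l
    rw [invLaw_mconv, invLaw_mconv, invLaw_lognormalLaw, lintegral_pow_mconv hL hN.invLaw,
      lintegral_pow_mconv hL hN'.invLaw, lognormalLaw,
      lintegral_pow_map_exp (c := Real.exp (Real.toNNReal (4 * Real.log 2 / τ) * (l : ℝ) ^ 2 / 2))
        (integrable_cexp_mul_gaussianReal _ l)
        ((integral_cexp_mul_gaussianReal _ l).trans (by push_cast; rfl))] at hl
    exact (ENNReal.mul_right_inj (by simpa using Real.exp_pos _) ENNReal.ofReal_ne_top).1 hl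
  rw [← invLaw_invLaw N, e, invLaw_invLaw]

theorem mainTheorem2 (τ lam₁ lam₂ : ℝ) (hτ : 1 < τ) (h₁ : -1 / τ < lam₁) (h₂ : -1 / τ < lam₂) :
    -- the expression is the Mellin transform of exactly one probability law on `(0, ∞)`
    (∃! M : Measure ℝ, IsSelbergLaw τ lam₁ lam₂ M) ∧
    ∀ M : Measure ℝ, IsSelbergLaw τ lam₁ lam₂ M →
      -- factorization `M = c L X₁ X₂ X₃ Y` in law, with independent factors, `Xᵢ = βᵢ⁻¹`,
      -- written with `x₁ = 1 + τ (1 + λ₁)` and `x₂ = 1 + τ (1 + λ₂)`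
      (∀ x₁ x₂ : ℝ, x₁ = 1 + τ * (1 + lam₁) → x₂ = 1 + τ * (1 + lam₂) →
        ∃ B₁ B₂ B₃ : Measure ℝ,
          IsBarnesBeta₂₂ τ (min x₁ x₂) (|x₂ - x₁| / 2) (|x₂ - x₁| / 2) B₁ ∧
          IsBarnesBeta₂₂ τ ((x₁ + x₂) / 2) (1 / 2) (τ / 2) B₂ ∧
          IsBarnesBeta₂₂ τ (1 + τ) ((x₁ + x₂ - 1 - τ) / 2) ((x₁ + x₂ - 1 - τ) / 2) B₃ ∧
          M = (Measure.mconv (lognormalLaw τ) (Measure.mconv (invLaw B₁)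
                (Measure.mconv (invLaw B₂) (Measure.mconv (invLaw B₃) (frechetLaw τ))))).map
              (fun y => selbergConst τ lam₁ lam₂ * y)) ∧
      -- positive integer moments
      (∀ l : ℕ, (l : ℝ) < τ → Integrable (fun x : ℝ => x ^ l) M ∧
        ∫ x : ℝ, x ^ l ∂M = selbergPosMoment τ lam₁ lam₂ l) ∧
      -- negative integer moments
      (∀ l : ℕ, Integrable (fun x : ℝ => (x ^ l)⁻¹) M ∧
        ∫ x : ℝ, (x ^ l)⁻¹ ∂M = selbergNegMoment τ lam₁ lam₂ l) ∧
      -- `log M` is absolutely continuous and infinitely divisible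
      M.map Real.log ≪ volume ∧
      IsInfinitelyDivisible (M.map Real.log) ∧
      -- the Stieltjes moment problems for `M` and `M⁻¹` are indeterminate
      IsStieltjesIndeterminate M ∧
      IsStieltjesIndeterminate (invLaw M) ∧
      -- a law `L N` (independent factors) with the same negative moments coincides with `M`
      (∀ M' N : Measure ℝ, IsLawOnPos M' → IsProbabilityMeasure N →
        M' = Measure.mconv (lognormalLaw τ) N →
        (∀ l : ℕ, Integrable (fun x : ℝ => (x ^ l)⁻¹) M' ∧
          ∫ x : ℝ, (x ^ l)⁻¹ ∂M' = selbergNegMoment τ lam₁ lam₂ l) →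
        M' = M) 
    := by
  have hτ0 : 0 < τ := by linarith
  have hc := selbergConst_pos hτ lam₁ lam₂
  obtain ⟨B₁, B₂, B₃, hB₁, hB₂, hB₃⟩ := exists_barnesBeta_triple hτ h₁ h₂ rfl rfl
  have hM₀ := isSelbergLaw_map_mconv hτ h₁ h₂ rfl rfl hB₁ hB₂ hB₃
  refine ⟨⟨_, hM₀, fun M hM => hM.unique hτ0 hM₀⟩, fun M hM => ?_⟩
  have hL := isLawOnPos_lognormalLaw τ
  have hK := hB₁.isLawOnPos.invLaw.mconv (hB₂.isLawOnPos.invLaw.mconv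
    (hB₃.isLawOnPos.invLaw.mconv (isLawOnPos_frechetLaw hτ0)))
  have hN := hK.map (f := fun y => selbergConst τ lam₁ lam₂ * y) (by fun_prop)
    fun x hx => mul_pos hc hx
  have := hL.1
  have := hK.1
  have := hN.1
  -- The constant is absorbed into the cofactor, giving `M = L N` exactly; absolute continuity,
  -- indeterminacy and the final characterization use only this form.
  have hMN := (hM.unique hτ0 hM₀).trans (mconv_map_const_mul _ _ _)
  have hneg : ∀ l : ℕ, Integrable (fun x : ℝ => (x ^ l)⁻¹) M ∧
      ∫ x : ℝ, (x ^ l)⁻¹ ∂M = selbergNegMoment τ lam₁ lam₂ l := fun l => by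
    have h := hM.2 (-l) (by
      have : (0 : ℝ) ≤ l := l.cast_nonneg
      simp only [Complex.neg_re, Complex.natCast_re]
      linarith)
    rw [selbergMellin_neg_natCast hτ h₁ h₂] at h
    exact h.neg_natCast
  have := hM.1.1
  have : IsProbabilityMeasure (M.map Real.log) :=
    Measure.isProbabilityMeasure_map Real.measurable_log.aemeasurable
  refine ⟨?_, ?_, hneg, ?_, (hM.hasLevyKhintchine hτ h₁ h₂).isInfinitelyDivisible, ?_, ?_, ?_⟩
  · rintro x₁ x₂ rfl rfl
    exact ⟨B₁, B₂, B₃, hB₁, hB₂, hB₃, hM.unique hτ0 hM₀⟩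
  · intro l hl
    have h := hM.2 l (by simpa using hl)
    rw [selbergMellin_natCast hτ h₁ h₂ hl] at h
    exact h.natCast
  · rw [hMN]
    exact lognormalLaw_mconv_map_log_absolutelyContinuous hτ0 hN
  · rw [hMN]
    exact isStieltjesIndeterminate_lognormalLaw_mconv hτ0 hN
  · rw [hMN, invLaw_mconv, invLaw_lognormalLaw]
    exact isStieltjesIndeterminate_lognormalLaw_mconv hτ0 hN.invLaw
  · rintro M' N hM' hN' rfl hmom
    rw [hMN]
    refine lognormalLaw_mconv_eq (isLawOnPos_of_mconv hL hM') hN (inv_pos.2 hc)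
      (lintegral_pow_invLaw_map_mconv_le hτ hc hB₁ hB₂ hB₃) fun l => ?_
    rw [← hMN, lintegral_pow_invLaw hM' (hmom l), lintegral_pow_invLaw hM.1 (hneg l)]
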